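/- **Conventions.** A *quantum circuit* on $n\ge 1$ qubits is a finite sequence of gates from the Shor basis (the Hadamard gate, the phase gate $\mathrm{diag}(1,i)$ and the Toffoli gate), each placed on distinct qubits; $Q$ also denotes the unitary operator that it induces. A *description* of $Q$ is a binary string listing the number of qubits and then the gates, with qubit indices written in a self-delimiting unary code, so that the length of the description bounds both the number of qubits and the number of gates. A *promise problem* is a pair of disjoint sets (yes-instances and no-instances) of strings over $\{0,1\}$. The *trace norm* is $\|X\|_{\mathrm{tr}}=\mathrm{tr}\sqrt{X^\dagger X}$. A promise problem belongs to $\mathrm{BQP}$ if there is a deterministic polynomial-time procedure that outputs, on every input $x\in\{0,1\}^*$, the description of a quantum circuit $Q_x$ such that measuring the first qubit of $Q_x|0\cdots0\rangle$ in the computational basis yields $1$ with probability at least $2/3$ if $x$ is a yes-instance, and with probability at most $1/3$ if $x$ is a no-instance. A promise problem is *complete for* $\mathrm{BQP}$ if it belongs to $\mathrm{BQP}$ and every promise problem in $\mathrm{BQP}$ reduces to it by a deterministic polynomial-time computable map that sends yes-instances to yes-instances and no-instances to no-instances. For a circuit $Q$ on $q_{\mathrm{in}}\ge1$ qubits, let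 $\rho_Q$ be the mixed state of the first qubit of $Q|0^{q_{\mathrm{in}}}\rangle$, all other qubits being traced out. Let $\alpha<\beta$. - $(\alpha,\beta)$-*One Qubit Quantum State Closeness to Identity* ($(\alpha,\beta)$-1QSCI): the input is a description of a quantum circuit $Q$; it is a yes-instance if $\|\rho_Q-I/2\|_{\mathrm{tr}}\le\alpha$ and a no-instance if $\|\rho_Q-I/2\|_{\mathrm{tr}}\ge\beta$. - $(\alpha,\beta)$-*One Qubit Quantum State Distinguishability* ($(\alpha,\beta)$-1QSD): the input consists of descriptions of two quantum circuits $Q_0,Q_1$ on the same number of qubits; it is a yes-instance if $\|\rho_{Q_0}-\rho_{Q_1}\|_{\mathrm{tr}}\ge\beta$ and a no-instance if $\|\rho_{Q_0}-\rho_{Q_1}\|_{\mathrm{tr}}\le\alpha$. **Theorem.** Let $\alpha,\beta$ be real numbers with $0<\alpha<\beta<1$. Then $(\alpha,\beta)$-1QSCI and $(\alpha,\beta)$-1QSD are complete for $\mathrm{BQP}$. Moreover, $(2\alpha,2\beta)$-1QSD is complete for $\mathrm{BQP}$; that is, the claim on 1QSD also holds when the trace norm in its definition is normalised as $\tfrac12\mathrm{tr}\sqrt{X^\dagger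 X}$. -/

import Mathlib

open scoped Matrix

noncomputable section

namespace QComp

/-! ## Promise problems, polynomial time, reductions -/

/-- A promise problem over the alphabet `{0,1}`. -/
structure PromiseProblem where
  yes : Set (List Bool)
  no : Set (List Bool)
  disj : Disjoint yes no

/-- `f` is computed by a (multi-stack) Turing machine in time polynomial in the input length. -/
def PolyTime (f : List Bool → List Bool) : Prop :=
  Nonempty (Turing.TM2ComputableInPolyTime (id : List Bool → List Bool)
    (id : List Bool → List Bool) f)

/-- Deterministic polynomial-time many-one reducibility between promise problems. -/
def PromiseProblem.ReducesTo (A B : PromiseProblem) : Prop :=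
  ∃ f : List Bool → List Bool, PolyTime f ∧
    (∀ x ∈ A.yes, f x ∈ B.yes) ∧ (∀ x ∈ A.no, f x ∈ B.no)

/-! ## Quantum circuits over the Shor basis -/

/-- A gate of the Shor basis, placed on (distinct) qubits of an `n`-qubit register. In
`toffoli a b c` the qubits `a`, `b` are the controls and `c` is the target. -/
inductive Gate (n : ℕ) : Type
  | hadamard (a : Fin n) : Gate n
  | phase (a : Fin n) : Gate n
  | toffoli (a b c : Fin n) (hab : a ≠ b) (hac : a ≠ c) (hbc : b ≠ c) : Gate n

/-- A circuit on `n` qubits: the list of its gates, the first one being applied first. -/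
abbrev Circuit (n : ℕ) : Type := List (Gate n)

/-- The matrix of the one-qubit operator `u` acting on qubit `a`, in the computational basis
of an `n`-qubit register. -/
def onQubit {n : ℕ} (u : Matrix (Fin 2) (Fin 2) ℂ) (a : Fin n) :
    Matrix (Fin n → Fin 2) (Fin n → Fin 2) ℂ :=
  Matrix.of fun x y => if ∀ i, i ≠ a → x i = y i then u (x a) (y a) else 0

/-- The matrix of a gate. (Addition and multiplication in `Fin 2` are those modulo 2.) -/
def Gate.matrix {n : ℕ} : Gate n → Matrix (Fin n → Fin 2) (Fin n → Fin 2) ℂ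
  | .hadamard a => onQubit ((((√2)⁻¹ : ℝ) : ℂ) • !![1, 1; 1, -1]) a
  | .phase a => onQubit !![1, 0; 0, Complex.I] a
  | .toffoli a b c _ _ _ =>
      Matrix.of fun x y => if x = Function.update y c (y c + y a * y b) then 1 else 0

/-- The unitary operator induced by a circuit. -/
def Circuit.unitary {n : ℕ} : Circuit n → Matrix (Fin n → Fin 2) (Fin n → Fin 2) ℂ
  | [] => 1
  | g :: C => Circuit.unitary C * g.matrix

/-- The state `Q |0ⁿ⟩`. -/
def Circuit.finalState {n : ℕ} (Q : Circuit n) : (Fin n → Fin 2) → ℂ :=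
  Circuit.unitary Q *ᵥ Pi.single 0 1

/-- The mixed state of the first qubit of `Q |0ⁿ⟩`, `n = m + 1`, all other qubits being
traced out. -/
def Circuit.outputState {m : ℕ} (Q : Circuit (m + 1)) : Matrix (Fin 2) (Fin 2) ℂ :=
  Matrix.of fun b b' => ∑ z : Fin m → Fin 2,
    Matrix.vecMulVec (Circuit.finalState Q) (star (Circuit.finalState Q))
      (Fin.cons b z) (Fin.cons b' z)

/-- The probability that measuring the first qubit of `Q |0ⁿ⟩`, `n = m + 1`, in the
computational basis yields 1. -/
def Circuit.acceptProb {m : ℕ} (Q : Circuit (m + 1)) : ℝ :=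
  ∑ z : Fin m → Fin 2, ‖Circuit.finalState Q (Fin.cons 1 z)‖ ^ 2

/-! ## Descriptions of circuits -/

/-- The self-delimiting unary code `1ᵏ0`. -/
def unaryCode (k : ℕ) : List Bool := List.replicate k true ++ [false]

/-- The code of a gate: a tag, followed by the indices of its qubits. -/
def Gate.encode {n : ℕ} : Gate n → List Bool
  | .hadamard a => [true, false, false] ++ unaryCode a
  | .phase a => [true, false, true] ++ unaryCode a
  | .toffoli a b c _ _ _ => [true, true] ++ unaryCode a ++ unaryCode b ++ unaryCode c

/-- The codes of the gates, followed by the end marker `0`. -/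
def encodeGates {n : ℕ} : Circuit n → List Bool
  | [] => [false]
  | g :: C => g.encode ++ encodeGates C

/-- The description of a circuit: its number of qubits, followed by its gates. -/
def Circuit.encode {n : ℕ} (Q : Circuit n) : List Bool := unaryCode n ++ encodeGates Q

theorem unaryCode_append_inj {k l : ℕ} {r s : List Bool}
    (h : unaryCode k ++ r = unaryCode l ++ s) : k = l ∧ r = s := by
  induction k generalizing l with
  | zero => cases l <;> simp_all [unaryCode, List.replicate_succ]
  | succ k ih =>
    cases l with
    | zero => simp [unaryCode, List.replicate_succ] at h
    | succ l =>
      have := @ih l (by simpa [unaryCode, List.replicate_succ] using h)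
      exact ⟨by rw [this.1], this.2⟩

theorem Gate.encode_append_inj {n : ℕ} {g g' : Gate n} {r s : List Bool}
    (h : g.encode ++ r = g'.encode ++ s) : g = g' ∧ r = s := by
  cases g with
  | hadamard a =>
    cases g' with
    | hadamard a' =>
      have h1 : unaryCode a ++ r = unaryCode a' ++ s := by simpa [Gate.encode] using h
      have h2 := unaryCode_append_inj h1
      exact ⟨by rw [Fin.ext h2.1], h2.2⟩
    | phase a' => simp [Gate.encode] at h
    | toffoli a' b' c' _ _ _ => simp [Gate.encode] at h
  | phase a =>
    cases g' with
    | hadamard a' => simp [Gate.encode] at h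
    | phase a' =>
      have h1 : unaryCode a ++ r = unaryCode a' ++ s := by simpa [Gate.encode] using h
      have h2 := unaryCode_append_inj h1
      exact ⟨by rw [Fin.ext h2.1], h2.2⟩
    | toffoli a' b' c' _ _ _ => simp [Gate.encode] at h
  | toffoli a b c _ _ _ =>
    cases g' with
    | hadamard a' => simp [Gate.encode] at h
    | phase a' => simp [Gate.encode] at h
    | toffoli a' b' c' _ _ _ =>
      have h1 : unaryCode a ++ (unaryCode b ++ (unaryCode c ++ r)) =
          unaryCode a' ++ (unaryCode b' ++ (unaryCode c' ++ s)) := by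
        simpa [Gate.encode] using h
      have h2 := unaryCode_append_inj h1
      have h3 := unaryCode_append_inj h2.2
      have h4 := unaryCode_append_inj h3.2
      obtain rfl := Fin.ext h2.1
      obtain rfl := Fin.ext h3.1
      obtain rfl := Fin.ext h4.1
      exact ⟨rfl, h4.2⟩

theorem encodeGates_append_inj {n : ℕ} {Q Q' : Circuit n} {r s : List Bool}
    (h : encodeGates Q ++ r = encodeGates Q' ++ s) : Q = Q' ∧ r = s := by
  induction Q generalizing Q' with
  | nil =>
    cases Q' with
    | nil => exact ⟨rfl, by simpa [encodeGates] using h⟩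
    | cons g' Q' => cases g' <;> simp [encodeGates, Gate.encode] at h
  | cons g Q ih =>
    cases Q' with
    | nil => cases g <;> simp [encodeGates, Gate.encode] at h
    | cons g' Q' =>
      have h1 : g.encode ++ (encodeGates Q ++ r) = g'.encode ++ (encodeGates Q' ++ s) := by
        simpa [encodeGates] using h
      have h2 := Gate.encode_append_inj h1
      have h3 := ih h2.2
      exact ⟨by rw [h2.1, h3.1], h3.2⟩

/-- Descriptions are uniquely decodable, even when something is appended to them. -/
theorem Circuit.encode_append_inj {n n' : ℕ} {Q : Circuit n} {Q' : Circuit n'}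
    {r s : List Bool} (h : Circuit.encode Q ++ r = Circuit.encode Q' ++ s) :
    n = n' ∧ HEq Q Q' ∧ r = s := by
  have h1 : unaryCode n ++ (encodeGates Q ++ r) = unaryCode n' ++ (encodeGates Q' ++ s) := by
    simpa [Circuit.encode] using h
  have h2 := unaryCode_append_inj h1
  obtain rfl := h2.1
  have h3 := encodeGates_append_inj h2.2
  exact ⟨rfl, heq_of_eq h3.1, h3.2⟩

/-! ## The class BQP -/

/-- `BQP`, as a class of promise problems: a polynomial-time procedure maps every input `x` to
the description of a quantum circuit `Q_x`, whose first qubit, measured after `Q_x` was applied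
to the all-zero state, tells yes-instances from no-instances with error at most `1/3`. -/
def BQP : Set PromiseProblem :=
  {A | ∃ f : List Bool → List Bool, PolyTime f ∧
    ∀ x, ∃ (m : ℕ) (Q : Circuit (m + 1)), f x = Circuit.encode Q ∧
      (x ∈ A.yes → 2 / 3 ≤ Circuit.acceptProb Q) ∧
      (x ∈ A.no → Circuit.acceptProb Q ≤ 1 / 3)}

/-- `A` belongs to BQP and every promise problem of BQP reduces to `A`. -/
def BQPComplete (A : PromiseProblem) : Prop :=
  A ∈ BQP ∧ ∀ B ∈ BQP, B.ReducesTo A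

/-! ## The two problems -/

/-- The trace norm `tr √(Aᴴ A)`, that is, the sum of the singular values of `A`. -/
def traceNorm {ι : Type} [Fintype ι] [DecidableEq ι] (A : Matrix ι ι ℂ) : ℝ :=
  ∑ i, √((Matrix.isHermitian_conjTranspose_mul_self A).eigenvalues i)

/-- `(α, β)`-One Qubit Quantum State Closeness to Identity. -/
def oneQSCI (α β : ℝ) (hαβ : α < β) : PromiseProblem where
  yes := {w | ∃ (m : ℕ) (Q : Circuit (m + 1)), w = Circuit.encode Q ∧
    traceNorm (Circuit.outputState Q - (1 / 2 : ℂ) • (1 : Matrix (Fin 2) (Fin 2) ℂ)) ≤ α}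
  no := {w | ∃ (m : ℕ) (Q : Circuit (m + 1)), w = Circuit.encode Q ∧
    β ≤ traceNorm (Circuit.outputState Q - (1 / 2 : ℂ) • (1 : Matrix (Fin 2) (Fin 2) ℂ))}
  disj := by
    rw [Set.disjoint_left]
    rintro w ⟨m, Q, hw, h⟩ ⟨m', Q', hw', h'⟩
    have h1 : Circuit.encode Q ++ [] = Circuit.encode Q' ++ [] := by rw [← hw, ← hw']
    obtain ⟨h2, h3, -⟩ := Circuit.encode_append_inj h1
    obtain rfl : m = m' := by omega
    obtain rfl := eq_of_heq h3
    linarith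

/-- `(α, β)`-One Qubit Quantum State Distinguishability. -/
def oneQSD (α β : ℝ) (hαβ : α < β) : PromiseProblem where
  yes := {w | ∃ (m : ℕ) (Q₀ Q₁ : Circuit (m + 1)), w = Circuit.encode Q₀ ++ Circuit.encode Q₁ ∧
    β ≤ traceNorm (Circuit.outputState Q₀ - Circuit.outputState Q₁)}
  no := {w | ∃ (m : ℕ) (Q₀ Q₁ : Circuit (m + 1)), w = Circuit.encode Q₀ ++ Circuit.encode Q₁ ∧
    traceNorm (Circuit.outputState Q₀ - Circuit.outputState Q₁) ≤ α}
  disj := by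
    rw [Set.disjoint_left]
    rintro w ⟨m, Q₀, Q₁, hw, h⟩ ⟨m', Q₀', Q₁', hw', h'⟩
    have h1 := hw.symm.trans hw'
    obtain ⟨h2, h3, h4⟩ := Circuit.encode_append_inj h1
    obtain rfl : m = m' := by omega
    obtain rfl := eq_of_heq h3
    have h5 : Circuit.encode Q₁ ++ [] = Circuit.encode Q₁' ++ [] := by rw [h4]
    obtain rfl := eq_of_heq (Circuit.encode_append_inj h5).2.1
    linarith

end QComp

end

/-! A one-qubit state is determined by its Bloch vector, and the trace norm of a difference of two
states is the Euclidean distance of their Bloch vectors (`traceNorm_eq_norm_bloch`); the vector of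
`I/2` is zero. Both problems are therefore threshold tests on Bloch vectors, with a constant gap `β
- α`.

Membership. Because the gap is constant, a constant number of copies suffices. Each output state is
measured `K` times in each of the three Pauli bases, and by Chebyshev's inequality all empirical
means are close to the Bloch vectors except with small probability (`exists_estimate`). The outcomes
are constantly many bits, so a decision based on them is a fixed Boolean function, hence a
polynomial over the field with two elements, hence a fixed Toffoli circuit (`BoolExpr`).
`exists_gadget` and `exists_decider` combine this into one circuit.

Hardness. The same gadget, applied to `Q_x` and the empty circuit and testing the sign of the first
coordinate `1 - 2p`, where `p` is the acceptance probability, amplifies: its output is `diag(1-q,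
q)` with `q` near 0 on no-instances and near 1 on yes-instances. The empty circuit outputs `|0⟩⟨0|`,
at trace norm `2q`, which is near 0 or near 2; this serves 1QSD for all `0 < α < β < 2` and so both
normalisations. For 1QSCI the decision is combined with a fair coin, so that `q` is near 1/2 on
yes-instances; the trace norm `2|q - 1/2|` is then near 0 on yes-instances and near 1 on
no-instances.

Polynomial time. The maps have to be computed by actual stack machines, and have to produce a
circuit on every word, malformed or not. Qubit `i` of block `j` is placed at `A + j + i * N` with
constants `A` and `N`: indices are unary, so the machine only repeats symbols, and the number of
qubits is affine in the length of the input. Every Toffoli gate is replaced by gates that contain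
one data qubit each, so that repeated indices in the input do no harm. Correctness is computed with
amplitudes on `ℕ → Fin 2`, where ancillas and blocks form a product state. -/

open scoped Matrix

noncomputable section

namespace QComp

open Turing Function

/-! ## Programs for stack machines -/

section Steps

variable {K : Type} [DecidableEq K] {Γ : K → Type} {Λ σ : Type}

/-- `StepsIn M n c c'`: the machine `M` leads from `c` to `c'` in exactly `n` steps. -/
inductive StepsIn (M : Λ → TM2.Stmt Γ Λ σ) : ℕ → TM2.Cfg Γ Λ σ → TM2.Cfg Γ Λ σ → Prop
  | refl (c) : StepsIn M 0 c c
  | head {n c c' c''} (h : TM2.step M c = some c') (h' : StepsIn M n c' c'') :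
      StepsIn M (n + 1) c c''

theorem StepsIn.trans {M : Λ → TM2.Stmt Γ Λ σ} {n m : ℕ} {c c' c'' : TM2.Cfg Γ Λ σ}
    (h : StepsIn M n c c') (h' : StepsIn M m c' c'') : StepsIn M (n + m) c c'' := by
  induction h with
  | refl => simpa using h'
  | head h _ ih =>
    rw [Nat.add_right_comm]
    exact .head h (ih h')

theorem iterate_bind_none {α : Type} (f : α → Option α) (n : ℕ) :
    (flip bind f)^[n] (none : Option α) = none := by
  induction n with
  | zero => rfl
  | succ n ih => rw [Function.iterate_succ_apply]; exact ih

/-- This connects the inductive relation, which is convenient for composing runs, with the iteration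
in terms of which `TM2OutputsInTime` is defined. -/
theorem stepsIn_iff {M : Λ → TM2.Stmt Γ Λ σ} {n : ℕ} {c c' : TM2.Cfg Γ Λ σ} :
    StepsIn M n c c' ↔ (flip bind (TM2.step M))^[n] (some c) = some c' := by
  constructor
  · intro h
    induction h with
    | refl => rfl
    | head h _ ih =>
      rw [Function.iterate_succ_apply]
      simpa [flip, h] using ih
  · intro h
    induction n generalizing c with
    | zero =>
      obtain rfl : c = c' := by simpa using h
      exact .refl _
    | succ n ih =>
      rw [Function.iterate_succ_apply] at h
      cases hc : TM2.step M c with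
      | none =>
        have : flip bind (TM2.step M) (some c) = none := by simpa [flip] using hc
        rw [this, iterate_bind_none] at h
        cases h
      | some d =>
        have : flip bind (TM2.step M) (some c) = some d := by simpa [flip] using hc
        rw [this] at h
        exact .head hc (ih h)

/-- The number of pushes in a statement. -/
def pushCount : TM2.Stmt Γ Λ σ → ℕ
  | .push _ _ q => pushCount q + 1
  | .peek _ _ q => pushCount q
  | .pop _ _ q => pushCount q
  | .load _ q => pushCount q
  | .branch _ q q' => pushCount q + pushCount q'
  | .goto _ => 0
  | .halt => 0

theorem length_stepAux_le (q : TM2.Stmt Γ Λ σ) (v : σ) (S : ∀ k, List (Γ k)) (k : K) :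
    ((TM2.stepAux q v S).stk k).length ≤ (S k).length + pushCount q := by
  induction q generalizing v S with
  | push k' f q ih =>
    refine (ih _ _).trans ?_
    by_cases h : k = k'
    · subst h; simp [pushCount]; omega
    · simp [pushCount, h]
  | peek k' f q ih => exact ih _ _
  | pop k' f q ih =>
    refine (ih _ _).trans ?_
    by_cases h : k = k'
    · subst h; simp [pushCount]
    · simp [pushCount, h]
  | load f q ih => exact ih _ _
  | branch f q q' ih ih' =>
    simp only [TM2.stepAux, pushCount]
    cases f v
    · exact (ih' _ _).trans (by omega)
    · exact (ih _ _).trans (by omega)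
  | goto f => simp [pushCount]
  | halt => simp [pushCount]

/-- A machine cannot write more than a constant number of symbols per step. This bounds the length
of an output by the running time. -/
theorem StepsIn.length_le {M : Λ → TM2.Stmt Γ Λ σ} {C : ℕ} (hC : ∀ l, pushCount (M l) ≤ C)
    {n : ℕ} {c c' : TM2.Cfg Γ Λ σ} (h : StepsIn M n c c') (k : K) :
    (c'.stk k).length ≤ (c.stk k).length + n * C := by
  induction h with
  | refl => simp
  | @head n c c' c'' h _ ih =>
    refine ih.trans ?_
    obtain ⟨l, v, S⟩ := c
    cases l with
    | none => simp at h
    | some l =>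
      obtain rfl : TM2.stepAux (M l) v S = c' := by simpa using h
      have := length_stepAux_le (M l) v S k
      have := hC l
      simp only
      nlinarith

end Steps

/-! ### Running a machine inside a larger one. -/

section Lift

variable {K K' : Type} [DecidableEq K] [DecidableEq K'] {Γ : K' → Type} {Λ Λ' σ σ' ρ : Type}

/-- A statement as a statement of a larger machine: stacks and labels are renamed, the internal
state is a component of the larger one, and halting becomes a jump to `x`. -/
def liftStmt (ι : K → K') (e : σ' ≃ σ × ρ) (f : Λ → Λ') (x : Option Λ') :
    TM2.Stmt (fun k => Γ (ι k)) Λ σ → TM2.Stmt Γ Λ' σ'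
  | .push k g q => .push (ι k) (fun s => g (e s).1) (liftStmt ι e f x q)
  | .peek k g q => .peek (ι k) (fun s a => e.symm (g (e s).1 a, (e s).2)) (liftStmt ι e f x q)
  | .pop k g q => .pop (ι k) (fun s a => e.symm (g (e s).1 a, (e s).2)) (liftStmt ι e f x q)
  | .load g q => .load (fun s => e.symm (g (e s).1, (e s).2)) (liftStmt ι e f x q)
  | .branch g q q' => .branch (fun s => g (e s).1) (liftStmt ι e f x q) (liftStmt ι e f x q')
  | .goto g => .goto fun s => f (g (e s).1)
  | .halt => x.elim .halt fun l => .goto fun _ => l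

/-- The configuration `c'` of the larger machine corresponds to the configuration `c`; the stacks
that are not in use are given by `B` and the unused component of the state is `r`. -/
structure Sim (ι : K → K') (e : σ' ≃ σ × ρ) (f : Λ → Λ') (x : Option Λ')
    (B : ∀ k, List (Γ k)) (r : ρ) (c : TM2.Cfg (fun k => Γ (ι k)) Λ σ)
    (c' : TM2.Cfg Γ Λ' σ') : Prop where
  label : c'.l = c.l.elim x fun l => some (f l)
  var : e c'.var = (c.var, r)
  stk : ∀ k, c'.stk (ι k) = c.stk k
  frame : ∀ k, k ∉ Set.range ι → c'.stk k = B k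

variable {ι : K → K'} {e : σ' ≃ σ × ρ} {f : Λ → Λ'} {x : Option Λ'} {B : ∀ k, List (Γ k)} {r : ρ}

/-- As `ι` is injective, an update of one small stack changes exactly the corresponding large stack,
and never a stack of the frame `B`. -/
theorem Sim.stepAux (hι : Injective ι) (q : TM2.Stmt (fun k => Γ (ι k)) Λ σ) {v : σ}
    {S : ∀ k, List (Γ (ι k))} {v' : σ'} {S' : ∀ k, List (Γ k)} (hv : e v' = (v, r))
    (hS : ∀ k, S' (ι k) = S k) (hB : ∀ k, k ∉ Set.range ι → S' k = B k) :
    Sim ι e f x B r (TM2.stepAux q v S) (TM2.stepAux (liftStmt ι e f x q) v' S') := by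
  have upd : ∀ {S : ∀ k, List (Γ (ι k))} {S' : ∀ k, List (Γ k)} (k : K) (a : List (Γ (ι k))),
      (∀ k, S' (ι k) = S k) → ∀ k', update S' (ι k) a (ι k') = update S k a k' := by
    intro S S' k a h k'
    by_cases hk : k' = k
    · subst hk; simp
    · rw [update_of_ne hk, update_of_ne (hι.ne hk), h]
  have updB : ∀ {S' : ∀ k, List (Γ k)} (k : K) (a : List (Γ (ι k))),
      (∀ k, k ∉ Set.range ι → S' k = B k) →
        ∀ k', k' ∉ Set.range ι → update S' (ι k) a k' = B k' := by
    intro S' k a h k' hk'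
    rw [update_of_ne, h k' hk']
    rintro rfl
    exact hk' ⟨k, rfl⟩
  induction q generalizing v S v' S' with
  | push k g q ih =>
    simp only [liftStmt, TM2.stepAux]
    rw [hS, hv]
    exact ih hv (upd k _ hS) (updB k _ hB)
  | peek k g q ih =>
    simp only [liftStmt, TM2.stepAux]
    rw [hS, hv]
    exact ih (by simp) hS hB
  | pop k g q ih =>
    simp only [liftStmt, TM2.stepAux]
    rw [hS, hv]
    exact ih (by simp) (upd k _ hS) (updB k _ hB)
  | load g q ih =>
    simp only [liftStmt, TM2.stepAux]
    rw [hv]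
    exact ih (by simp) hS hB
  | branch g q q' ih ih' =>
    simp only [liftStmt, TM2.stepAux]
    rw [hv]
    cases g v
    · exact ih' hv hS hB
    · exact ih hv hS hB
  | goto g =>
    simp only [liftStmt, TM2.stepAux]
    exact ⟨by simp [hv], hv, hS, hB⟩
  | halt =>
    cases x <;> exact ⟨rfl, hv, hS, hB⟩

/-- The two machines run in lockstep, so time bounds carry over unchanged. -/
theorem Sim.stepsIn (hι : Injective ι) {M : Λ → TM2.Stmt (fun k => Γ (ι k)) Λ σ}
    {M' : Λ' → TM2.Stmt Γ Λ' σ'} (hM : ∀ l, M' (f l) = liftStmt ι e f x (M l)) {n : ℕ}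
    {c d : TM2.Cfg (fun k => Γ (ι k)) Λ σ} (h : StepsIn M n c d) {c' : TM2.Cfg Γ Λ' σ'}
    (hc : Sim ι e f x B r c c') : ∃ d', StepsIn M' n c' d' ∧ Sim ι e f x B r d d' := by
  induction h generalizing c' with
  | refl => exact ⟨c', .refl _, hc⟩
  | @head n c c₁ c₂ h _ ih =>
    obtain ⟨l, v, S⟩ := c
    cases l with
    | none => simp at h
    | some l =>
      obtain rfl : TM2.stepAux (M l) v S = c₁ := by simpa using h
      obtain ⟨l', v', S'⟩ := c'
      obtain ⟨h1, h2, h3, h4⟩ := hc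
      obtain rfl : l' = some (f l) := h1
      obtain ⟨d', hd, hs⟩ := ih (Sim.stepAux (f := f) (x := x) hι (M l) h2 h3 h4)
      refine ⟨d', .head ?_ hd, hs⟩
      simp [hM]

end Lift

/-- A program with one entry and one exit: it exits by halting. -/
structure Frag {K : Type} (Γ : K → Type) (σ : Type) where
  Λ : Type
  [fin : Fintype Λ]
  main : Λ
  code : Λ → TM2.Stmt Γ Λ σ

attribute [instance] Frag.fin

/-! ### Combinators for programs, with their running times. -/

namespace Frag

variable {K : Type} [DecidableEq K] {Γ : K → Type} {σ : Type}

/-- `F`, started with state `v` and stacks `S`, exits with `v'` and `S'` within `t` steps. -/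
def Runs (F : Frag Γ σ) (v : σ) (S : ∀ k, List (Γ k)) (v' : σ) (S' : ∀ k, List (Γ k)) (t : ℕ) :
    Prop :=
  ∃ n ≤ t, StepsIn F.code n ⟨some F.main, v, S⟩ ⟨none, v', S'⟩

theorem Runs.mono {F : Frag Γ σ} {v v' : σ} {S S' : ∀ k, List (Γ k)} {t t' : ℕ}
    (h : F.Runs v S v' S' t) (ht : t ≤ t') : F.Runs v S v' S' t' :=
  let ⟨n, hn, hs⟩ := h
  ⟨n, hn.trans ht, hs⟩

/-- The case of `Sim` in which stacks and state stay the same: only labels are renamed, and halting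
becomes a jump to `x`. All combinators below reduce to it. -/
theorem embed {F : Frag Γ σ} {Λ' : Type} {M : Λ' → TM2.Stmt Γ Λ' σ} {f : F.Λ → Λ'}
    {x : Option Λ'}
    (hM : ∀ l, M (f l) = liftStmt (Γ := Γ) id (Equiv.prodPUnit.{0, 0} σ).symm f x (F.code l))
    {v v' : σ} {S S' : ∀ k, List (Γ k)} {t : ℕ} (h : F.Runs v S v' S' t) :
    ∃ n ≤ t, StepsIn M n ⟨some (f F.main), v, S⟩ ⟨x, v', S'⟩ := by
  obtain ⟨n, hn, hs⟩ := h
  obtain ⟨⟨l, w, T⟩, hd, h1, h2, h3, -⟩ :=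
    Sim.stepsIn (B := S) (r := PUnit.unit) injective_id hM hs
      (c' := ⟨some (f F.main), v, S⟩) ⟨rfl, rfl, fun _ => rfl, fun _ _ => rfl⟩
  obtain rfl : l = x := h1
  obtain rfl : w = v' := congrArg Prod.fst h2
  obtain rfl : T = S' := funext h3
  exact ⟨n, hn, hd⟩

/-- A single statement without jumps. -/
def single (q : TM2.Stmt Γ Unit σ) : Frag Γ σ where
  Λ := Unit
  main := ()
  code _ := q

theorem runs_single {q : TM2.Stmt Γ Unit σ} {v v' : σ} {S S' : ∀ k, List (Γ k)}
    (h : TM2.stepAux q v S = ⟨none, v', S'⟩) : (single q).Runs v S v' S' 1 :=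
  ⟨1, le_rfl, .head (by simp [single, h]) (.refl _)⟩

/-- `F`, then `G`. -/
def seq (F G : Frag Γ σ) : Frag Γ σ where
  Λ := F.Λ ⊕ G.Λ
  main := .inl F.main
  code := Sum.elim
    (fun l => liftStmt (Γ := Γ) id (Equiv.prodPUnit.{0, 0} σ).symm .inl (some (.inr G.main))
      (F.code l))
    (fun l => liftStmt (Γ := Γ) id (Equiv.prodPUnit.{0, 0} σ).symm .inr none (G.code l))

theorem Runs.seq {F G : Frag Γ σ} {v v' v'' : σ} {S S' S'' : ∀ k, List (Γ k)} {t t' : ℕ}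
    (h : F.Runs v S v' S' t) (h' : G.Runs v' S' v'' S'' t') :
    (F.seq G).Runs v S v'' S'' (t + t') := by
  obtain ⟨n, hn, hs⟩ := embed (M := (F.seq G).code) (f := .inl) (fun _ => rfl) h
  obtain ⟨n', hn', hs'⟩ := embed (M := (F.seq G).code) (f := .inr) (fun _ => rfl) h'
  exact ⟨n + n', by omega, hs.trans hs'⟩

/-- Pop a symbol from the stack `k` and go on with `F` or `G`, depending on the new state. -/
def branch (k : K) (g : σ → Option (Γ k) → σ) (b : σ → Bool) (F G : Frag Γ σ) : Frag Γ σ where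
  Λ := Option (F.Λ ⊕ G.Λ)
  main := none
  code := fun
    | none => .pop k g <| .branch b (.goto fun _ => some (.inl F.main))
        (.goto fun _ => some (.inr G.main))
    | some (.inl l) => liftStmt (Γ := Γ) id (Equiv.prodPUnit.{0, 0} σ).symm (some ∘ .inl) none
        (F.code l)
    | some (.inr l) => liftStmt (Γ := Γ) id (Equiv.prodPUnit.{0, 0} σ).symm (some ∘ .inr) none
        (G.code l)

theorem Runs.branch_true {k : K} {g : σ → Option (Γ k) → σ} {b : σ → Bool} {F G : Frag Γ σ}
    {v v' : σ} {S S' : ∀ k, List (Γ k)} {t : ℕ} (hb : b (g v (S k).head?) = true)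
    (h : F.Runs (g v (S k).head?) (update S k (S k).tail) v' S' t) :
    (branch k g b F G).Runs v S v' S' (t + 1) := by
  obtain ⟨n, hn, hs⟩ := embed (M := (branch k g b F G).code) (f := some ∘ .inl) (fun _ => rfl) h
  exact ⟨n + 1, by omega, .head (by simp [branch, hb]) hs⟩

theorem Runs.branch_false {k : K} {g : σ → Option (Γ k) → σ} {b : σ → Bool} {F G : Frag Γ σ}
    {v v' : σ} {S S' : ∀ k, List (Γ k)} {t : ℕ} (hb : b (g v (S k).head?) = false)
    (h : G.Runs (g v (S k).head?) (update S k (S k).tail) v' S' t) :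
    (branch k g b F G).Runs v S v' S' (t + 1) := by
  obtain ⟨n, hn, hs⟩ := embed (M := (branch k g b F G).code) (f := some ∘ .inr) (fun _ => rfl) h
  exact ⟨n + 1, by omega, .head (by simp [branch, hb]) hs⟩

/-- Pop symbols from the stack `k`, and execute `F` after each of them as long as the new state
satisfies `b`. -/
def loop (k : K) (g : σ → Option (Γ k) → σ) (b : σ → Bool) (F : Frag Γ σ) : Frag Γ σ where
  Λ := Option F.Λ
  main := none
  code := fun
    | none => .pop k g <| .branch b (.goto fun _ => some F.main) .halt
    | some l => liftStmt (Γ := Γ) id (Equiv.prodPUnit.{0, 0} σ).symm some (some none) (F.code l)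

theorem Runs.loop_stop {k : K} {g : σ → Option (Γ k) → σ} {b : σ → Bool} {F : Frag Γ σ}
    {v : σ} {S : ∀ k, List (Γ k)} (hb : b (g v (S k).head?) = false) :
    (loop k g b F).Runs v S (g v (S k).head?) (update S k (S k).tail) 1 :=
  ⟨1, le_rfl, .head (by simp [loop, hb]) (.refl _)⟩

theorem Runs.loop_go {k : K} {g : σ → Option (Γ k) → σ} {b : σ → Bool} {F : Frag Γ σ}
    {v v' v'' : σ} {S S' S'' : ∀ k, List (Γ k)} {t t' : ℕ} (hb : b (g v (S k).head?) = true)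
    (h : F.Runs (g v (S k).head?) (update S k (S k).tail) v' S' t)
    (h' : (loop k g b F).Runs v' S' v'' S'' t') :
    (loop k g b F).Runs v S v'' S'' (t + 1 + t') := by
  obtain ⟨n, hn, hs⟩ := embed (M := (loop k g b F).code) (f := some) (fun _ => rfl) h
  obtain ⟨n', hn', hs'⟩ := h'
  refine ⟨n + 1 + n', by omega, ?_⟩
  exact (StepsIn.head (by simp [loop, hb]) hs).trans hs'

/-- The program of a machine, as a part of a program with more stacks. -/
def lift {K₀ : Type} {σ₀ ρ : Type} (ι : K₀ → K) (e : σ ≃ σ₀ × ρ)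
    (F : Frag (fun k => Γ (ι k)) σ₀) : Frag Γ σ where
  Λ := F.Λ
  main := F.main
  code l := liftStmt ι e id none (F.code l)

/-- The part `r` of the state and the stacks outside the range of `ι` pass through the run
untouched. -/
theorem Runs.lift {K₀ : Type} [DecidableEq K₀] {σ₀ ρ : Type} {ι : K₀ → K} (hι : Injective ι)
    {e : σ ≃ σ₀ × ρ} {F : Frag (fun k => Γ (ι k)) σ₀} {v v' : σ₀} {r : ρ}
    {S S' : ∀ k, List (Γ (ι k))} {t : ℕ} (h : F.Runs v S v' S' t) {T T' : ∀ k, List (Γ k)}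
    (hT : ∀ k, T (ι k) = S k) (hT' : ∀ k, T' (ι k) = S' k)
    (hTT' : ∀ k, k ∉ Set.range ι → T' k = T k) :
    (lift ι e F).Runs (e.symm (v, r)) T (e.symm (v', r)) T' t := by
  obtain ⟨n, hn, hs⟩ := h
  obtain ⟨⟨l, w, U⟩, hd, h1, h2, h3, h4⟩ :=
    Sim.stepsIn (e := e) (f := id) (x := none) (M' := (Frag.lift ι e F).code) (B := T) (r := r)
      hι (fun _ => rfl) hs (c' := ⟨some F.main, e.symm (v, r), T⟩)
      ⟨rfl, by simp, hT, fun _ _ => rfl⟩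
  obtain rfl : l = none := h1
  obtain rfl : w = e.symm (v', r) := by rw [← h2, Equiv.symm_apply_apply]
  obtain rfl : U = T' := by
    funext k
    by_cases hk : k ∈ Set.range ι
    · obtain ⟨k, rfl⟩ := hk
      exact (h3 k).trans (hT' k).symm
    · exact (h4 k hk).trans (hTT' k hk).symm
  exact ⟨n, hn, hd⟩

end Frag

/-! ## Polynomial time -/

theorem initList_eq (tm : FinTM2) (s : List (tm.Γ tm.k₀)) :
    initList tm s = ⟨some tm.main, tm.initialState, update (fun _ => []) tm.k₀ s⟩ := by
  unfold initList
  congr 1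
  funext k
  by_cases h : k = tm.k₀
  · subst h; simp
  · rw [dif_neg h, update_of_ne h]

theorem haltList_eq (tm : FinTM2) (s : List (tm.Γ tm.k₁)) :
    haltList tm s = ⟨none, tm.initialState, update (fun _ => []) tm.k₁ s⟩ := by
  unfold haltList
  congr 1
  funext k
  by_cases h : k = tm.k₁
  · subst h; simp
  · rw [dif_neg h, update_of_ne h]

/-- The program of a machine. -/
def fragOf (tm : FinTM2) : Frag tm.Γ tm.σ :=
  @Frag.mk tm.K tm.Γ tm.σ tm.Λ tm.ΛFin tm.main tm.m

/-- The final configuration must have the initial internal state and no nonempty stack except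
possibly the output stack. This is why the programs below clean up after themselves. -/
theorem outputsInTime_iff {tm : FinTM2} {s : List (tm.Γ tm.k₀)} {s' : List (tm.Γ tm.k₁)} {t : ℕ} :
    Nonempty (TM2OutputsInTime tm s (some s') t) ↔
      (fragOf tm).Runs tm.initialState (update (fun _ => []) tm.k₀ s) tm.initialState
        (update (fun _ => []) tm.k₁ s') t := by
  constructor
  · rintro ⟨⟨⟨n, h⟩, hn⟩⟩
    refine ⟨n, hn, stepsIn_iff.2 ?_⟩
    have : (flip bind tm.step)^[n] (some (initList tm s)) = some (haltList tm s') := h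
    rwa [initList_eq, haltList_eq] at this
  · rintro ⟨n, hn, h⟩
    refine ⟨⟨⟨n, ?_⟩, hn⟩⟩
    have h' := stepsIn_iff.1 h
    have : (flip bind tm.step)^[n] (some (initList tm s)) = some (haltList tm s') := by
      rw [initList_eq, haltList_eq]
      exact h'
    exact this

/-- A function is polynomial-time if it is computed by a program. -/
theorem PolyTime.of_runs {K : Type} [DecidableEq K] [Fintype K] {Γ : K → Type} {σ : Type}
    [Fintype σ] (F : Frag Γ σ) (k₀ k₁ : K) (v₀ : σ) (e₀ : Γ k₀ ≃ Bool) (e₁ : Γ k₁ ≃ Bool)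
    (p : Polynomial ℕ) {f : List Bool → List Bool}
    (h : ∀ x, F.Runs v₀ (update (fun _ => []) k₀ (x.map e₀.symm)) v₀
      (update (fun _ => []) k₁ ((f x).map e₁.symm)) (p.eval x.length)) : PolyTime f := by
  have : Fintype (Γ k₀) := Fintype.ofEquiv Bool e₀.symm
  let tm : FinTM2 :=
    { K := K, k₀ := k₀, k₁ := k₁, Γ := Γ, Λ := F.Λ, main := F.main, σ := σ,
      initialState := v₀, m := F.code }
  exact ⟨{ tm := tm, inputAlphabet := e₀, outputAlphabet := e₁, time := p
           outputsFun := fun x => Classical.choice (outputsInTime_iff.2 (h x)) }⟩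

theorem eval_mono (p : Polynomial ℕ) {m n : ℕ} (h : m ≤ n) : p.eval m ≤ p.eval n := by
  rw [Polynomial.eval_eq_sum_range, Polynomial.eval_eq_sum_range]
  gcongr

/-- The program that moves the stack `k` onto the stack `k'`. -/
def moveStack {K : Type} {Γ : K → Type} {σ : Type} (get : σ → Option Bool)
    (set : σ → Option Bool → σ) (k k' : K) (c : Γ k ≃ Bool) (c' : Γ k' ≃ Bool) : Frag Γ σ :=
  .loop k (fun s a => set s (a.map c)) (fun s => (get s).isSome)
    (.single (.push k' (fun s => c'.symm ((get s).getD false)) .halt))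

/-- The word arrives reversed, so two moves through an auxiliary stack transfer it faithfully. The
laws `h₁` and `h₂` say that `get` and `set` access a register. -/
theorem runs_moveStack {K : Type} [DecidableEq K] {Γ : K → Type} {σ : Type}
    {get : σ → Option Bool} {set : σ → Option Bool → σ} (h₁ : ∀ s a, get (set s a) = a)
    (h₂ : ∀ s a b, set (set s a) b = set s b) {k k' : K} (hk : k ≠ k') {c : Γ k ≃ Bool}
    {c' : Γ k' ≃ Bool} (u u' : List Bool) (v : σ) (S : ∀ k, List (Γ k))
    (hS : S k = u.map c.symm) (hS' : S k' = u'.map c'.symm) :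
    (moveStack get set k k' c c').Runs v S (set v none)
      (update (update S k []) k' ((u.reverse ++ u').map c'.symm)) (2 * u.length + 1) := by
  induction u generalizing u' v S with
  | nil =>
    have := Frag.Runs.loop_stop (k := k) (g := fun s a => set s (a.map c))
      (b := fun s => (get s).isSome)
      (F := .single (.push k' (fun s => c'.symm ((get s).getD false)) .halt)) (v := v) (S := S)
      (by simp [hS, h₁])
    have e : update (update S k []) k' (([] : List Bool).reverse ++ u' |>.map c'.symm) =
        update S k (S k).tail := by
      have : (([] : List Bool).reverse ++ u' |>.map c'.symm) = update S k [] k' := by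
        rw [update_of_ne hk.symm, hS']; simp
      rw [this, update_eq_self, hS]; simp
    rw [e]
    simpa [hS, moveStack] using this
  | cons a u ih =>
    have step := ih (a :: u') (set v (some a))
      (update (update S k (S k).tail) k' (c'.symm a :: S k'))
      (by rw [update_of_ne hk, update_self, hS]; simp) (by simp [hS'])
    have := Frag.Runs.loop_go (k := k) (g := fun s a => set s (a.map c))
      (b := fun s => (get s).isSome)
      (F := .single (.push k' (fun s => c'.symm ((get s).getD false)) .halt)) (v := v) (S := S)
      (by simp [hS, h₁])
      (Frag.runs_single (v' := set v (some a))
        (S' := update (update S k (S k).tail) k' (c'.symm a :: S k'))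
        (by simp [hS, h₁, update_of_ne hk.symm])) step
    rw [h₂] at this
    have e : update (update S k []) k' (((a :: u).reverse ++ u').map c'.symm) =
        update (update (update (update S k (S k).tail) k' (c'.symm a :: S k')) k []) k'
          ((u.reverse ++ a :: u').map c'.symm) := ?_
    · rw [e]
      exact this.mono (by simp; omega)
    funext j
    by_cases h : j = k'
    · subst h; simp
    · by_cases h' : j = k
      · subst h'; simp [hk]
      · simp [h, h']

/-- Both machines are placed side by side on disjoint stacks; one further stack and one register
carry the intermediate word across in two moves. Its length is at most `|x| + p(|x|) * C`, which
keeps the time bound of the second machine polynomial in `|x|`. -/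
theorem PolyTime.comp {f g : List Bool → List Bool} (hg : PolyTime g) (hf : PolyTime f) :
    PolyTime (g ∘ f) := by
  obtain ⟨⟨⟨tm, i, o⟩, p, hp⟩⟩ := hf
  obtain ⟨⟨⟨tm', i', o'⟩, p', hp'⟩⟩ := hg
  have := tm.kFin
  have := tm'.kFin
  have := tm.σFin
  have := tm'.σFin
  have := tm.ΛFin
  let C := ∑ l, pushCount (tm.m l)
  have hC : ∀ l, pushCount (tm.m l) ≤ C := fun l =>
    Finset.single_le_sum (f := fun l => pushCount (tm.m l)) (fun _ _ => Nat.zero_le _)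
      (Finset.mem_univ l)
  have run : ∀ x, (fragOf tm).Runs tm.initialState (update (fun _ => []) tm.k₀ (x.map i.symm))
      tm.initialState (update (fun _ => []) tm.k₁ ((f x).map o.symm)) (p.eval x.length) :=
    fun x => outputsInTime_iff.1 ⟨hp x⟩
  have run' : ∀ x, (fragOf tm').Runs tm'.initialState
      (update (fun _ => []) tm'.k₀ (x.map i'.symm)) tm'.initialState
      (update (fun _ => []) tm'.k₁ ((g x).map o'.symm)) (p'.eval x.length) :=
    fun x => outputsInTime_iff.1 ⟨hp' x⟩
  have len : ∀ x, (f x).length ≤ x.length + p.eval x.length * C := by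
    intro x
    obtain ⟨n, hn, h⟩ := run x
    have h' := h.length_le hC tm.k₁
    simp only [update_self, List.length_map] at h'
    -- The output stack may coincide with the input stack, in which case the input already counts.
    -- The equality of stacks is generalised because the alphabets depend on them.
    have h0 : (update (fun _ => []) tm.k₀ (x.map i.symm) tm.k₁ : List (tm.Γ tm.k₁)).length
        ≤ x.length := by
      by_cases hk : tm.k₁ = tm.k₀
      · have : ∀ k, k = tm.k₀ →
            (update (fun _ => []) tm.k₀ (x.map i.symm) k : List (tm.Γ k)).length ≤ x.length := by
          rintro k rfl; simp
        exact this _ hk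
      · simp [hk]
    have := Nat.mul_le_mul_right C hn
    omega
  let Γ : tm.K ⊕ tm'.K ⊕ Unit → Type := Sum.elim tm.Γ (Sum.elim tm'.Γ fun _ => Bool)
  let σ := tm.σ × tm'.σ × Option Bool
  let e : σ ≃ tm.σ × (tm'.σ × Option Bool) := Equiv.refl _
  let e' : σ ≃ tm'.σ × (tm.σ × Option Bool) :=
    ⟨fun s => (s.2.1, s.1, s.2.2), fun s => (s.2.1, s.1, s.2.2), fun _ => rfl, fun _ => rfl⟩
  let get : σ → Option Bool := fun s => s.2.2
  let set : σ → Option Bool → σ := fun s a => (s.1, s.2.1, a)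
  let F₁ : Frag Γ σ := Frag.lift (Γ := Γ) Sum.inl e (fragOf tm)
  let F₂ : Frag Γ σ :=
    moveStack (Γ := Γ) get set (.inl tm.k₁) (.inr (.inr ())) o (Equiv.refl Bool)
  let F₃ : Frag Γ σ :=
    moveStack (Γ := Γ) get set (.inr (.inr ())) (.inr (.inl tm'.k₀)) (Equiv.refl Bool) i'
  let F₄ : Frag Γ σ := Frag.lift (Γ := Γ) (Sum.inr ∘ Sum.inl) e' (fragOf tm')
  let v₀ : σ := (tm.initialState, tm'.initialState, none)
  let q : Polynomial ℕ := Polynomial.X + p * Polynomial.C C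
  refine PolyTime.of_runs (Γ := Γ) (F₁.seq (F₂.seq (F₃.seq F₄))) (.inl tm.k₀)
    (.inr (.inl tm'.k₁)) v₀ i o' (p + (2 * q + 1 + (2 * q + 1 + p'.comp q))) fun x => ?_
  have r₁ : F₁.Runs v₀ (update (fun _ => []) (.inl tm.k₀) (x.map i.symm)) v₀
      (update (fun _ => []) (.inl tm.k₁) ((f x).map o.symm)) (p.eval x.length) := by
    refine Frag.Runs.lift (Γ := Γ) Sum.inl_injective (e := e)
      (r := (tm'.initialState, none)) (run x) ?_ ?_ ?_
    · intro k
      by_cases h : k = tm.k₀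
      · subst h; simp; rfl
      · rw [update_of_ne h, update_of_ne (by simpa using h)]; rfl
    · intro k
      by_cases h : k = tm.k₁
      · subst h; simp; rfl
      · rw [update_of_ne h, update_of_ne (by simpa using h)]; rfl
    · rintro (k | k) hk
      · exact absurd ⟨k, rfl⟩ hk
      · rw [update_of_ne (by simp), update_of_ne (by simp)]
  have r₂ := runs_moveStack (Γ := Γ) (get := get) (set := set) (fun _ _ => rfl)
    (fun _ _ _ => rfl) (k := .inl tm.k₁) (k' := .inr (.inr ())) (by simp) (c := o)
    (c' := Equiv.refl Bool) (f x) [] v₀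
    (update (fun _ => []) (.inl tm.k₁) ((f x).map o.symm)) (update_self ..) (by simp)
  have r₃ := runs_moveStack (Γ := Γ) (get := get) (set := set) (fun _ _ => rfl)
    (fun _ _ _ => rfl) (k := .inr (.inr ())) (k' := .inr (.inl tm'.k₀)) (by simp)
    (c := Equiv.refl Bool) (c' := i') (f x).reverse [] v₀
    (update (fun _ => []) (.inr (.inr ())) ((f x).reverse.map (Equiv.refl Bool).symm))
    (update_self ..) (by simp)
  have r₄ : F₄.Runs v₀ (update (fun _ => []) (.inr (.inl tm'.k₀)) ((f x).map i'.symm)) v₀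
      (update (fun _ => []) (.inr (.inl tm'.k₁)) ((g (f x)).map o'.symm))
      (p'.eval (f x).length) := by
    refine Frag.Runs.lift (Γ := Γ) (ι := Sum.inr ∘ Sum.inl)
      (Sum.inr_injective.comp Sum.inl_injective) (e := e')
      (r := (tm.initialState, none)) (run' (f x)) ?_ ?_ ?_
    · intro k
      by_cases h : k = tm'.k₀
      · subst h; simp; rfl
      · rw [update_of_ne h, update_of_ne (by simpa using h)]; rfl
    · intro k
      by_cases h : k = tm'.k₁
      · subst h; simp; rfl
      · rw [update_of_ne h, update_of_ne (by simpa using h)]; rfl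
    · rintro (k | k | k) hk
      · rw [update_of_ne (by simp), update_of_ne (by simp)]
      · exact absurd ⟨k, rfl⟩ hk
      · rw [update_of_ne (by simp), update_of_ne (by simp)]
  have move : ∀ {k k' : tm.K ⊕ tm'.K ⊕ Unit} (a : List (Γ k)) (b : List (Γ k')),
      update (update (update (fun _ => []) k a) k []) k' b =
        (update (fun _ => []) k' b : ∀ k, List (Γ k)) := by
    intro k k' a b
    rw [update_idem]
    congr 1
    exact update_eq_self k _
  rw [move, List.append_nil] at r₂ r₃
  rw [List.reverse_reverse] at r₃
  refine (r₁.seq (r₂.seq (r₃.seq r₄))).mono ?_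
  have hq : (f x).length ≤ q.eval x.length := by simpa [q] using len x
  have := eval_mono p' hq
  simp only [Polynomial.eval_add, Polynomial.eval_mul, Polynomial.eval_comp, Polynomial.eval_one,
    Polynomial.eval_ofNat, List.length_reverse]
  omega

/-! ## Gates with unrestricted qubit indices -/

/-- A gate of the Shor basis on arbitrary indices. -/
inductive RawGate : Type
  | hadamard (a : ℕ)
  | phase (a : ℕ)
  | toffoli (a b c : ℕ)

/-- The code of a raw gate. -/
def RawGate.encode : RawGate → List Bool
  | .hadamard a => [true, false, false] ++ unaryCode a
  | .phase a => [true, false, true] ++ unaryCode a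
  | .toffoli a b c => [true, true] ++ unaryCode a ++ unaryCode b ++ unaryCode c

/-- A list of gates that simulates `g`, with the qubit `i` placed on `s + i * N`. A Toffoli gate
is decomposed into gates that act on only one of these qubits each: qubit 1 is in the state `1`,
and the qubits 3, 4, 5 are in the state `0` before and after. -/
def RawGate.simulate (N s : ℕ) : RawGate → List RawGate
  | .hadamard a => [.hadamard (s + a * N)]
  | .phase a => [.phase (s + a * N)]
  -- The products are accumulated on the scratch qubits 3, 4, 5, used once, and uncomputed in
  -- reverse order. If `s` is at least 6, each gate sits on distinct qubits even when `a`, `b`, `c`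
  -- coincide, as they may in a malformed input.
  | .toffoli a b c =>
      [.toffoli 1 (s + a * N) 3, .toffoli 1 (s + b * N) 4, .toffoli 3 4 5,
        .toffoli 1 5 (s + c * N), .toffoli 3 4 5, .toffoli 1 (s + b * N) 4,
        .toffoli 1 (s + a * N) 3]

/-! ## Parsing descriptions

Missing symbols are read as `0`. -/

/-- The number of leading ones. -/
def ones : List Bool → ℕ
  | true :: w => ones w + 1
  | _ => 0

/-- What follows the first zero. -/
def afterZero : List Bool → List Bool
  | true :: w => afterZero w
  | false :: w => w
  | [] => []

/-- An index is paid for by the symbols that it consumes. This yields both the running times of the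
programs and the bounds on qubit indices. -/
theorem ones_add_length_afterZero (w : List Bool) : ones w + (afterZero w).length ≤ w.length := by
  induction w with
  | nil => simp [ones, afterZero]
  | cons b w ih => cases b <;> simp [ones, afterZero]; omega

/-- The gate whose code, without its first symbol, is a prefix of `w`. -/
def headGate : List Bool → RawGate
  | true :: w => .toffoli (ones w) (ones (afterZero w)) (ones (afterZero (afterZero w)))
  | w => if w.tail.head? = some true then .phase (ones w.tail.tail)
      else .hadamard (ones w.tail.tail)

/-- What follows the first gate. -/
def afterGate : List Bool → List Bool
  | true :: w => afterZero (afterZero (afterZero w))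
  | w => afterZero w.tail.tail

/-- Together with the symbol `true` removed before each gate, this makes the parser terminate. -/
theorem length_afterGate_le (w : List Bool) : (afterGate w).length ≤ w.length := by
  unfold afterGate
  split
  · rename_i w
    have := ones_add_length_afterZero w
    have := ones_add_length_afterZero (afterZero w)
    have := ones_add_length_afterZero (afterZero (afterZero w))
    simp; omega
  · have := ones_add_length_afterZero w.tail.tail
    simp at this; omega

/-- The list of gates described by `w`. -/
def gatesOf : List Bool → List RawGate
  | true :: w => headGate w :: gatesOf (afterGate w)
  | _ => []
termination_by w => w.length
decreasing_by have := length_afterGate_le w; simp; omega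

/-- What follows the list of gates. -/
def afterGates : List Bool → List Bool
  | true :: w => afterGates (afterGate w)
  | w => w.tail
termination_by w => w.length
decreasing_by have := length_afterGate_le w; simp; omega

theorem gatesOf_cons (w : List Bool) :
    gatesOf (true :: w) = headGate w :: gatesOf (afterGate w) := by rw [gatesOf]

theorem gatesOf_of_ne {w : List Bool} (h : w.head? ≠ some true) : gatesOf w = [] := by
  rcases w with _ | ⟨_ | _, w⟩ <;> simp_all [gatesOf]

theorem afterGates_cons (w : List Bool) :
    afterGates (true :: w) = afterGates (afterGate w) := by rw [afterGates]

theorem afterGates_of_ne {w : List Bool} (h : w.head? ≠ some true) : afterGates w = w.tail := by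
  rcases w with _ | ⟨_ | _, w⟩ <;> simp_all [afterGates]

theorem length_afterGates_le (w : List Bool) : (afterGates w).length ≤ w.length := by
  induction hn : w.length using Nat.strong_induction_on generalizing w with
  | _ n ih =>
    by_cases h : w.head? = some true
    · obtain ⟨w, rfl⟩ : ∃ w', w = true :: w' := by
        rcases w with _ | ⟨_ | _, w⟩ <;> simp_all
      have := length_afterGate_le w
      simp at hn
      rw [afterGates_cons]
      exact (ih _ (by omega) _ rfl).trans (by omega)
    · rw [afterGates_of_ne h]
      simp; omega

/-! ## The programs -/

/-- The stacks of the program: the input, a temporary stack (and output), the input of the current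
pass, two registers, and the reversed output. -/
inductive Stk : Type
  | mst | tmp | inp | x | y | out
  deriving DecidableEq

instance : Fintype Stk := ⟨{.mst, .tmp, .inp, .x, .y, .out}, fun k => by cases k <;> simp⟩

/-- The contents of the stacks. -/
def store (m t i x y o : List Bool) : Stk → List Bool
  | .mst => m
  | .tmp => t
  | .inp => i
  | .x => x
  | .y => y
  | .out => o

section

variable (m t i x y o a : List Bool)

@[simp] theorem update_inp : update (store m t i x y o) .inp a = store m t a x y o := by
  funext k; cases k <;> rfl
@[simp] theorem update_out : update (store m t i x y o) .out a = store m t i x y a := by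
  funext k; cases k <;> rfl

end

/-- Programs over these stacks, with a register for the symbol that was popped last. -/
abbrev Prog : Type 1 := Frag (fun _ : Stk => Bool) (Option Bool)

/-- Push the given symbols, which may depend on the register. -/
def pushStmt : List (Stk × (Option Bool → Bool)) →
    TM2.Stmt (fun _ : Stk => Bool) Unit (Option Bool)
  | [] => .halt
  | p :: l => .push p.1 p.2 (pushStmt l)

/-- The effect of `pushStmt`. -/
def pushAll (v : Option Bool) :
    List (Stk × (Option Bool → Bool)) → (Stk → List Bool) → Stk → List Bool
  | [], S => S
  | p :: l, S => pushAll v l (update S p.1 (p.2 v :: S p.1))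

theorem stepAux_pushStmt (l : List (Stk × (Option Bool → Bool))) (v : Option Bool)
    (S : Stk → List Bool) : TM2.stepAux (pushStmt l) v S = ⟨none, v, pushAll v l S⟩ := by
  induction l generalizing S with
  | nil => rfl
  | cons p l ih => exact ih _

/-- `F` transforms the stacks `S` to `S'` within `t` steps. -/
def Prog.Maps (F : Prog) (S S' : Stk → List Bool) (t : ℕ) : Prop :=
  ∀ v, ∃ v', F.Runs v S v' S' t

namespace Prog

theorem Maps.mono {F : Prog} {S S' : Stk → List Bool} {t t' : ℕ} (h : F.Maps S S' t)
    (ht : t ≤ t') : F.Maps S S' t' := fun v => let ⟨v', hv⟩ := h v; ⟨v', hv.mono ht⟩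

theorem Maps.seq {F G : Prog} {S S' S'' : Stk → List Bool} {t t' : ℕ} (h : F.Maps S S' t)
    (h' : G.Maps S' S'' t') : Maps (Frag.seq F G) S S'' (t + t') := fun v =>
  let ⟨v', hv⟩ := h v
  let ⟨v'', hv'⟩ := h' v'
  ⟨v'', hv.seq hv'⟩

/-- Write a fixed word. -/
def emit (w : List Bool) : Prog := .single (pushStmt (w.map fun b => (.out, fun _ => b)))

theorem maps_emit (w m t i x y o : List Bool) :
    (emit w).Maps (store m t i x y o) (store m t i x y (w.reverse ++ o)) 1 := by
  refine fun v => ⟨v, Frag.runs_single ?_⟩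
  rw [stepAux_pushStmt]
  congr 1
  induction w generalizing o with
  | nil => rfl
  | cons b w ih =>
    simp only [List.map_cons, pushAll, update_out]
    rw [ih]
    simp [store]

/-- Pop ones from `k`, up to the next zero, and push a one on each stack in `l` for each of
them. -/
def unaryLoop (k : Stk) (l : List Stk) : Prog :=
  .loop k (fun _ a => a) (fun v => v == some true)
    (.single (pushStmt (l.map fun k' => (k', fun _ => true))))

theorem pushAll_true (l : List Stk) (v : Option Bool) (S : Stk → List Bool) :
    pushAll v (l.map fun k' => (k', fun _ => true)) S =
      fun k => List.replicate (l.count k) true ++ S k := by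
  induction l generalizing S with
  | nil => rfl
  | cons a l ih =>
    simp only [List.map_cons, pushAll]
    rw [ih]
    funext k
    by_cases h : k = a
    · subst h
      simp [List.replicate_succ', List.append_assoc]
    · rw [update_of_ne h, List.count_cons_of_ne (Ne.symm h)]

/-- A stack that occurs `N` times in `l` receives `N` ones for each one that is read: this is how
indices are multiplied by `N`. -/
theorem maps_unaryLoop {k : Stk} {l : List Stk} (hk : k ∉ l) {S : Stk → List Bool}
    {S' : Stk → List Bool} (h : S' k = afterZero (S k))
    (h' : ∀ k', k' ≠ k → S' k' = List.replicate (ones (S k) * l.count k') true ++ S k') :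
    (unaryLoop k l).Maps S S' (2 * ones (S k) + 1) := by
  suffices H : ∀ (w : List Bool) (S : Stk → List Bool), S k = w → ∀ v,
      ∃ v', (unaryLoop k l).Runs v S v' (fun k' => if k' = k then afterZero w else
        List.replicate (ones w * l.count k') true ++ S k') (2 * ones w + 1) by
    intro v
    obtain ⟨v', hv'⟩ := H _ S rfl v
    refine ⟨v', ?_⟩
    convert hv' using 1
    funext k'
    split_ifs with hk'
    · subst hk'; exact h
    · exact h' _ hk'
  clear h h' S S'
  intro w
  induction w with
  | nil =>
    intro S hS v
    refine ⟨none, ?_⟩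
    have := Frag.Runs.loop_stop (k := k) (g := fun _ a => a) (b := fun v => v == some true)
      (F := .single (pushStmt (l.map fun k' => (k', fun _ => true)))) (v := v) (S := S)
      (by simp [hS])
    simp only [hS, List.head?_nil, List.tail_nil] at this
    refine Frag.Runs.mono (t := 1) ?_ (by simp)
    unfold unaryLoop
    convert this using 1
    funext k'
    by_cases h : k' = k
    · subst h; simp [afterZero]
    · simp [h, ones]
  | cons b w ih =>
    intro S hS v
    cases b with
    | false =>
      refine ⟨some false, ?_⟩
      have := Frag.Runs.loop_stop (k := k) (g := fun _ a => a) (b := fun v => v == some true)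
        (F := .single (pushStmt (l.map fun k' => (k', fun _ => true)))) (v := v) (S := S)
        (by simp [hS])
      simp only [hS, List.head?_cons, List.tail_cons] at this
      refine Frag.Runs.mono (t := 1) ?_ (by simp)
      unfold unaryLoop
      convert this using 1
      funext k'
      by_cases h : k' = k
      · subst h; simp [afterZero]
      · simp [h, ones]
    | true =>
      obtain ⟨v', hv'⟩ := ih (fun k' => List.replicate (l.count k') true ++ update S k w k')
        (by simp [List.count_eq_zero_of_not_mem hk]) (some true)
      refine ⟨v', ?_⟩
      have := Frag.Runs.loop_go (k := k) (g := fun _ a => a) (b := fun v => v == some true)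
        (F := .single (pushStmt (l.map fun k' => (k', fun _ => true)))) (v := v) (S := S)
        (by simp [hS]) (v' := some true)
        (S' := fun k' => List.replicate (l.count k') true ++ update S k w k') (t := 1)
        (Frag.runs_single (by rw [stepAux_pushStmt, pushAll_true, hS]; rfl)) hv'
      refine Frag.Runs.mono (t := 1 + 1 + (2 * ones w + 1)) ?_ (by simp [ones]; omega)
      unfold unaryLoop
      convert this using 1
      funext k'
      by_cases h : k' = k
      · subst h; simp [afterZero]
      · simp only [h, if_false, ones, ne_eq, not_false_eq_true, update_of_ne, ← List.append_assoc,
          List.replicate_append_replicate]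
        congr 2
        ring

/-- Empty the stack `k`, and move its contents to each stack in `l`. -/
def copyLoop (k : Stk) (l : List Stk) : Prog :=
  .loop k (fun _ a => a) (fun v => v.isSome)
    (.single (pushStmt (l.map fun k' => (k', fun v => v.getD false))))

theorem pushAll_bit (l : List Stk) (hl : l.Nodup) (b : Bool) (S : Stk → List Bool) :
    pushAll (some b) (l.map fun k' => (k', fun v => v.getD false)) S =
      fun k => if k ∈ l then b :: S k else S k := by
  induction l generalizing S with
  | nil => rfl
  | cons a l ih =>
    simp only [List.map_cons, pushAll]
    rw [ih hl.of_cons]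
    funext k
    by_cases h : k = a
    · subst h
      simp [(List.nodup_cons.1 hl).1]
    · simp [h]

/-- The loop stops only at the empty stack, so the register ends as `none` whatever it was before.
This restores the initial state at the end of `polyTime_tasks`. -/
theorem runs_copyLoop {k : Stk} {l : List Stk} (hk : k ∉ l) (hl : l.Nodup)
    {S S' : Stk → List Bool} (h : S' k = [])
    (h' : ∀ k', k' ≠ k → S' k' = (if k' ∈ l then (S k).reverse else []) ++ S k')
    (v : Option Bool) : (copyLoop k l).Runs v S none S' (2 * (S k).length + 1) := by
  suffices H : ∀ (w : List Bool) (S : Stk → List Bool), S k = w → ∀ v,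
      (copyLoop k l).Runs v S none (fun k' => if k' = k then [] else
        (if k' ∈ l then w.reverse else []) ++ S k') (2 * w.length + 1) by
    convert H _ S rfl v using 1
    funext k'
    split_ifs with hk'
    · subst hk'; exact h
    all_goals rw [h' _ hk']; simp_all
  clear h h' S S'
  intro w
  induction w with
  | nil =>
    intro S hS v
    have := Frag.Runs.loop_stop (k := k) (g := fun _ a => a) (b := fun v => v.isSome)
      (F := .single (pushStmt (l.map fun k' => (k', fun v => v.getD false)))) (v := v) (S := S)
      (by simp [hS])
    simp only [hS, List.head?_nil, List.tail_nil] at this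
    refine Frag.Runs.mono (t := 1) ?_ (by simp)
    unfold copyLoop
    convert this using 1
    funext k'
    by_cases h : k' = k
    · subst h; simp
    · simp [h]
  | cons b w ih =>
    intro S hS v
    have hv' := ih (fun k' => if k' ∈ l then b :: update S k w k' else update S k w k')
      (by simp [hk]) (some b)
    have step : TM2.stepAux (pushStmt (l.map fun k' => (k', fun v => v.getD false)))
        (S k).head? (update S k (S k).tail) = ⟨none, some b,
          fun k' => if k' ∈ l then b :: update S k w k' else update S k w k'⟩ := by
      simp only [hS]
      rw [stepAux_pushStmt, List.head?_cons, pushAll_bit l hl]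
      rfl
    have := Frag.Runs.loop_go (k := k) (g := fun _ a => a) (b := fun v => v.isSome)
      (F := .single (pushStmt (l.map fun k' => (k', fun v => v.getD false)))) (v := v) (S := S)
      (by simp [hS]) (v' := some b)
      (S' := fun k' => if k' ∈ l then b :: update S k w k' else update S k w k') (t := 1)
      (Frag.runs_single step) hv'
    refine Frag.Runs.mono (t := 1 + 1 + (2 * w.length + 1)) ?_ (by simp; omega)
    unfold copyLoop
    convert this using 1
    funext k'
    by_cases h : k' = k
    · subst h; simp
    · by_cases h'' : k' ∈ l <;> simp [h, h'']

/-- Empty the input of the pass, and write `N` ones for each symbol. -/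
def countLoop (N : ℕ) : Prog :=
  .loop .inp (fun _ a => a) (fun v => v.isSome)
    (.single (pushStmt ((List.replicate N Stk.out).map fun k' => (k', fun _ => true))))

theorem maps_countLoop (N : ℕ) (m t i x y o : List Bool) :
    (countLoop N).Maps (store m t i x y o)
      (store m t [] x y (List.replicate (i.length * N) true ++ o)) (2 * i.length + 1) := by
  induction i generalizing o with
  | nil =>
    intro v
    have := Frag.Runs.loop_stop (k := Stk.inp) (g := fun _ a => a) (b := fun v => v.isSome)
      (F := .single (pushStmt ((List.replicate N Stk.out).map fun k' => (k', fun _ => true))))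
      (v := v) (S := store m t [] x y o) (by simp [store])
    refine ⟨none, ?_⟩
    simpa [countLoop, store] using this
  | cons b i ih =>
    intro v
    obtain ⟨v', hv'⟩ := ih (List.replicate N true ++ o) (some b)
    have := Frag.Runs.loop_go (k := Stk.inp) (g := fun _ a => a) (b := fun v => v.isSome)
      (F := .single (pushStmt ((List.replicate N Stk.out).map fun k' => (k', fun _ => true))))
      (v := v) (S := store m t (b :: i) x y o) (by simp [store]) (v' := some b)
      (S' := store m t i x y (List.replicate N true ++ o)) (t := 1)
      (Frag.runs_single (by
        rw [stepAux_pushStmt, pushAll_true]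
        simp only [update_inp]
        congr 1
        funext k
        cases k <;> simp [store, List.count_replicate])) hv'
    refine ⟨v', Frag.Runs.mono (t := 1 + 1 + (2 * i.length + 1)) ?_ (by simp; omega)⟩
    unfold countLoop
    convert this using 2
    rw [← List.append_assoc, List.replicate_append_replicate, List.length_cons]
    congr 3
    ring

end Prog

/-- The codes of a list of gates. -/
def encodeAll (l : List RawGate) : List Bool := l.flatMap RawGate.encode

theorem encodeAll_append (l l' : List RawGate) :
    encodeAll (l ++ l') = encodeAll l ++ encodeAll l' := List.flatMap_append

theorem ones_replicate (n : ℕ) : ones (List.replicate n true) = n := by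
  induction n with
  | zero => rfl
  | succ n ih => simp [List.replicate_succ, ones, ih]

theorem afterZero_replicate (n : ℕ) : afterZero (List.replicate n true) = [] := by
  induction n with
  | zero => rfl
  | succ n ih => simp [List.replicate_succ, afterZero, ih]

/-- The stacks, the output being `o`. -/
abbrev storeOut (m t i x y o : List Bool) : Stk → List Bool := store m t i x y o.reverse

/-! ### Translating the gates of a description. -/

namespace Prog

theorem Maps.cast {F : Prog} {S S' T : Stk → List Bool} {t t' : ℕ} (h : F.Maps S S' t)
    (hS : S' = T) (ht : t ≤ t') : F.Maps S T t' := hS ▸ h.mono ht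

section

variable (N : ℕ) (m t i x y o : List Bool)

theorem maps_emit' (w : List Bool) :
    (emit w).Maps (storeOut m t i x y o) (storeOut m t i x y (o ++ w)) 1 := by
  simpa [storeOut] using maps_emit w m t i x y o.reverse

/-- Besides being written, the index can be kept in a register listed in `l`: the simulation of a
Toffoli gate needs both control indices twice, but the input is read only once. -/
theorem maps_read (l : List Stk) (hl : Stk.inp ∉ l) (h : Stk.mst ∉ l) (h' : Stk.tmp ∉ l)
    (h'' : Stk.out ∉ l) :
    (unaryLoop .inp (List.replicate N .out ++ l)).Maps (storeOut m t i x y o)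
      (storeOut m t (afterZero i) (List.replicate (ones i * l.count .x) true ++ x)
        (List.replicate (ones i * l.count .y) true ++ y)
        (o ++ List.replicate (ones i * N) true)) (2 * ones i + 1) := by
  refine maps_unaryLoop ?_ rfl ?_
  · simp [hl, List.mem_replicate]
  · intro k hk
    cases k <;> simp_all [store, List.count_eq_zero_of_not_mem]

theorem maps_skip : (unaryLoop .inp []).Maps (storeOut m t i x y o)
    (storeOut m t (afterZero i) x y o) (2 * ones i + 1) := by
  simpa using maps_read 0 m t i x y o [] (by simp) (by simp) (by simp) (by simp)

theorem maps_read_out : (unaryLoop .inp (List.replicate N .out)).Maps (storeOut m t i x y o)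
    (storeOut m t (afterZero i) x y (o ++ List.replicate (ones i * N) true))
    (2 * ones i + 1) := by
  simpa using maps_read N m t i x y o [] (by simp) (by simp) (by simp) (by simp)

theorem maps_read_x : (unaryLoop .inp (List.replicate N .out ++ [.x])).Maps
    (storeOut m t i [] y o) (storeOut m t (afterZero i) (List.replicate (ones i) true) y
      (o ++ List.replicate (ones i * N) true)) (2 * ones i + 1) := by
  simpa using maps_read N m t i [] y o [.x] (by simp) (by simp) (by simp) (by simp)

theorem maps_read_y : (unaryLoop .inp (List.replicate N .out ++ [.y])).Maps
    (storeOut m t i x [] o) (storeOut m t (afterZero i) x (List.replicate (ones i) true)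
      (o ++ List.replicate (ones i * N) true)) (2 * ones i + 1) := by
  simpa using maps_read N m t i x [] o [.y] (by simp) (by simp) (by simp) (by simp)

theorem maps_write_x (a : ℕ) : (unaryLoop .x (List.replicate N .out)).Maps
    (storeOut m t i (List.replicate a true) y o)
    (storeOut m t i [] y (o ++ List.replicate (a * N) true)) (2 * a + 1) := by
  have := maps_unaryLoop (k := .x) (l := List.replicate N .out) (by simp [List.mem_replicate])
    (S := storeOut m t i (List.replicate a true) y o)
    (S' := storeOut m t i [] y (o ++ List.replicate (a * N) true))
    (by simp [store, afterZero_replicate]) (by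
      intro k hk
      cases k <;> simp_all [store, ones_replicate, List.count_replicate])
  simpa [store, ones_replicate] using this

theorem maps_write_y (a : ℕ) : (unaryLoop .y (List.replicate N .out)).Maps
    (storeOut m t i x (List.replicate a true) o)
    (storeOut m t i x [] (o ++ List.replicate (a * N) true)) (2 * a + 1) := by
  have := maps_unaryLoop (k := .y) (l := List.replicate N .out) (by simp [List.mem_replicate])
    (S := storeOut m t i x (List.replicate a true) o)
    (S' := storeOut m t i x [] (o ++ List.replicate (a * N) true))
    (by simp [store, afterZero_replicate]) (by
      intro k hk
      cases k <;> simp_all [store, ones_replicate, List.count_replicate])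
  simpa [store, ones_replicate] using this

end

/-- Read an index and write the code of a one-qubit gate. -/
def oneQubitProg (N s : ℕ) (tag : List Bool) : Prog :=
  .seq (emit (tag ++ List.replicate s true)) <|
  .seq (unaryLoop .inp (List.replicate N .out)) (emit [false])

/-- Read three indices and write the code of the simulation of a Toffoli gate. -/
def toffoliProg (N s : ℕ) : Prog :=
  .seq (emit ([true, true] ++ unaryCode 1 ++ List.replicate s true)) <|
  .seq (unaryLoop .inp (List.replicate N .out ++ [.x])) <|
  .seq (emit ([false] ++ unaryCode 3 ++ [true, true] ++ unaryCode 1 ++ List.replicate s true)) <|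
  .seq (unaryLoop .inp (List.replicate N .out ++ [.y])) <|
  .seq (emit ([false] ++ unaryCode 4 ++ (RawGate.toffoli 3 4 5).encode ++ [true, true] ++
    unaryCode 1 ++ unaryCode 5 ++ List.replicate s true)) <|
  .seq (unaryLoop .inp (List.replicate N .out)) <|
  .seq (emit ([false] ++ (RawGate.toffoli 3 4 5).encode ++ [true, true] ++ unaryCode 1 ++
    List.replicate s true)) <|
  -- Uncomputation runs backwards, so the second control is replayed before the first.
  .seq (unaryLoop .y (List.replicate N .out)) <|
  .seq (emit ([false] ++ unaryCode 4 ++ [true, true] ++ unaryCode 1 ++ List.replicate s true)) <|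
  .seq (unaryLoop .x (List.replicate N .out)) (emit ([false] ++ unaryCode 3))

theorem maps_oneQubitProg (N s : ℕ) (tag m t i o : List Bool) :
    (oneQubitProg N s tag).Maps (storeOut m t i [] [] o)
      (storeOut m t (afterZero i) [] [] (o ++ (tag ++ unaryCode (s + ones i * N))))
      (2 * ones i + 3) := by
  refine ((maps_emit' m t i [] [] o _).seq ((maps_read_out N m t i [] [] _).seq
    (maps_emit' m t _ [] [] _ _))).cast ?_ (by omega)
  simp [unaryCode, List.replicate_add,
    -List.replicate_append_replicate]

theorem maps_toffoliProg (N s : ℕ) (m t i o : List Bool) :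
    (toffoliProg N s).Maps (storeOut m t i [] [] o)
      (storeOut m t (afterZero (afterZero (afterZero i))) [] [] (o ++ encodeAll
        ((RawGate.toffoli (ones i) (ones (afterZero i)) (ones (afterZero (afterZero i)))).simulate
          N s)))
      (4 * (ones i + ones (afterZero i) + ones (afterZero (afterZero i))) + 11) := by
  refine ((maps_emit' m t i [] [] o _).seq <| (maps_read_x N m t i [] _).seq <|
    (maps_emit' m t _ _ [] _ _).seq <| (maps_read_y N m t _ _ _).seq <|
    (maps_emit' m t _ _ _ _ _).seq <| (maps_read_out N m t _ _ _ _).seq <|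
    (maps_emit' m t _ _ _ _ _).seq <| (maps_write_y N m t _ _ _ _).seq <|
    (maps_emit' m t _ _ _ _ _).seq <| (maps_write_x N m t _ _ _ _).seq <|
    (maps_emit' m t _ _ _ _ _)).cast ?_ (by omega)
  simp [unaryCode, List.replicate_add,
    -List.replicate_append_replicate, encodeAll, RawGate.simulate, RawGate.encode]

/-- Read a gate without the first symbol of its code, and write the code of its simulation. -/
def gateProg (N s : ℕ) : Prog :=
  .branch .inp (fun _ a => a) (fun v => v == some true) (toffoliProg N s) <|
  .branch .inp (fun _ a => a) (fun v => v == some true)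
    (oneQubitProg N s [true, false, true]) (oneQubitProg N s [true, false, false])

/-- The time is charged to the symbols consumed, so that the bounds for a list of gates add up to a
linear one. -/
theorem maps_gateProg (N s : ℕ) (m t i o : List Bool) :
    (gateProg N s).Maps (storeOut m t i [] [] o)
      (storeOut m t (afterGate i) [] [] (o ++ encodeAll ((headGate i).simulate N s)))
      (4 * (i.length - (afterGate i).length) + 12) := by
  have key : ∀ i' tag, afterGate i = afterZero i' → i'.length ≤ i.length →
      encodeAll ((headGate i).simulate N s) = tag ++ unaryCode (s + ones i' * N) →
      (oneQubitProg N s tag).Maps (storeOut m t i' [] [] o)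
        (storeOut m t (afterGate i) [] [] (o ++ encodeAll ((headGate i).simulate N s)))
        (4 * (i.length - (afterGate i).length) + 3) := by
    intro i' tag h1 h2 h3
    rw [h1, h3]
    have := ones_add_length_afterZero i'
    exact (maps_oneQubitProg N s tag m t i' o).mono (by omega)
  have main : i.head? ≠ some true → ∀ v, ∃ v',
      (Frag.branch (Γ := fun _ : Stk => Bool) .inp (fun _ a => a) (fun v => v == some true)
        (oneQubitProg N s [true, false, true]) (oneQubitProg N s [true, false, false])).Runs v
          (storeOut m t i.tail [] [] o) v'
        (storeOut m t (afterGate i) [] [] (o ++ encodeAll ((headGate i).simulate N s)))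
        (4 * (i.length - (afterGate i).length) + 4) := by
    intro hi v
    have h1 : afterGate i = afterZero i.tail.tail := by
      rcases i with _ | ⟨_ | _, i⟩ <;> simp_all [afterGate]
    have h2 : headGate i = if i.tail.head? = some true then .phase (ones i.tail.tail)
        else .hadamard (ones i.tail.tail) := by
      rcases i with _ | ⟨_ | _, i⟩ <;> simp_all [headGate]
    have h3 : i.tail.tail.length ≤ i.length := by simp; omega
    by_cases hb : i.tail.head? = some true
    · obtain ⟨v', hv'⟩ := key i.tail.tail [true, false, true] h1 h3
        (by simp [h2, hb, encodeAll, RawGate.simulate, RawGate.encode]) (some true)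
      refine ⟨v', Frag.Runs.branch_true (by simp [store, hb]) ?_⟩
      simpa [store, hb] using hv'
    · obtain ⟨v', hv'⟩ := key i.tail.tail [true, false, false] h1 h3
        (by rw [h2, if_neg hb]; simp [encodeAll, RawGate.simulate, RawGate.encode]) i.tail.head?
      refine ⟨v', Frag.Runs.branch_false (by simp [store]; simpa using hb) ?_⟩
      simpa [store] using hv'
  intro v
  by_cases hi : i.head? = some true
  · obtain ⟨i, rfl⟩ : ∃ i', i = true :: i' := by
      rcases i with _ | ⟨_ | _, i⟩ <;> simp_all
    obtain ⟨v', hv'⟩ := maps_toffoliProg N s m t i o (some true)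
    refine ⟨v', (Frag.Runs.branch_true (t := 4 * ((true :: i).length -
      (afterGate (true :: i)).length) + 11) (by simp [store]) ?_).mono (by omega)⟩
    have := ones_add_length_afterZero i
    have := ones_add_length_afterZero (afterZero i)
    have := ones_add_length_afterZero (afterZero (afterZero i))
    have := hv'.mono (t' := 4 * ((true :: i).length -
      (afterGate (true :: i)).length) + 11) (by simp [afterGate]; omega)
    simpa [store, headGate, afterGate] using this
  · obtain ⟨v', hv'⟩ := main hi i.head?
    refine ⟨v', (Frag.Runs.branch_false (t := 4 * (i.length - (afterGate i).length) + 4)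
      (by simpa [store] using hi) ?_).mono (by omega)⟩
    simpa [store] using hv'

/-- Read a list of gates, and write the codes of their simulations. -/
def gatesProg (N s : ℕ) : Prog :=
  .loop .inp (fun _ a => a) (fun v => v == some true) (gateProg N s)

/-- The fixed cost of a gate, 12 steps and one test of the loop, is charged to its first symbol, and
at most 4 steps to every other symbol; hence the factor 13. -/
theorem maps_gatesProg (N s : ℕ) (m t i o : List Bool) :
    (gatesProg N s).Maps (storeOut m t i [] [] o)
      (storeOut m t (afterGates i) [] []
        (o ++ encodeAll ((gatesOf i).flatMap (RawGate.simulate N s)))) (13 * i.length + 1) := by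
  induction hn : i.length using Nat.strong_induction_on generalizing i o with
  | _ n ih =>
    intro v
    by_cases h : i.head? = some true
    · obtain ⟨i, rfl⟩ : ∃ i', i = true :: i' := by
        rcases i with _ | ⟨_ | _, i⟩ <;> simp_all
      have hle := length_afterGate_le i
      simp only [List.length_cons] at hn
      obtain ⟨v', hv'⟩ := maps_gateProg N s m t i o (some true)
      obtain ⟨v'', hv''⟩ := ih _ (by omega) (afterGate i)
        (o ++ encodeAll ((headGate i).simulate N s)) rfl v'
      refine ⟨v'', Frag.Runs.mono (Frag.Runs.loop_go (v' := v')
        (t := 4 * (i.length - (afterGate i).length) + 12)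
        (t' := 13 * (afterGate i).length + 1) (by simp [store])
        (by simpa [store] using hv') ?_) (by omega)⟩
      simpa [afterGates_cons, gatesOf_cons, encodeAll_append, gatesProg] using hv''
    · refine ⟨i.head?, Frag.Runs.mono (t := 1) ?_ (by omega)⟩
      have := Frag.Runs.loop_stop (k := Stk.inp) (Γ := fun _ => Bool) (g := fun _ a => a)
        (b := fun v => v == some true) (F := gateProg N s) (v := v)
        (S := storeOut m t i [] [] o) (by simpa [store] using h)
      simpa [store, gatesOf_of_ne h, afterGates_of_ne h, encodeAll, gatesProg] using this

end Prog

/-- The parts of the output of a program. -/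
inductive Task : Type
  /-- a fixed word -/
  | word (w : List Bool)
  /-- `c + N * n` in unary, where `n` is the length of the input -/
  | count (N c : ℕ)
  /-- simulations of the two circuits described by the input -/
  | circuits (N s s' : ℕ)

/-- The first circuit described by `w`. -/
def firstGates (w : List Bool) : List RawGate := gatesOf (afterZero w)

/-- The second circuit described by `w`. -/
def secondGates (w : List Bool) : List RawGate :=
  gatesOf (afterZero (afterGates (afterZero w)))

/-- The output of a task. -/
def Task.eval (w : List Bool) : Task → List Bool
  | .word u => u
  | .count N c => unaryCode (c + w.length * N)
  | .circuits N s s' => encodeAll ((firstGates w).flatMap (RawGate.simulate N s)) ++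
      encodeAll ((secondGates w).flatMap (RawGate.simulate N s'))

/-! ### Programs for lists of tasks. -/

namespace Prog

/-- Prepare the input of a pass. -/
def prepare : Prog := .seq (copyLoop .mst [.tmp]) (copyLoop .tmp [.mst, .inp])

/-- The word is reversed twice, so `mst` is restored for later passes and `inp` receives the input
in its original order. -/
theorem maps_prepare (m o : List Bool) : prepare.Maps (storeOut m [] [] [] [] o)
    (storeOut m [] m [] [] o) (4 * m.length + 2) := by
  refine Maps.mono (t := (2 * m.length + 1) + (2 * m.length + 1))
    (.seq (S' := storeOut [] m.reverse [] [] [] o) (fun v => ⟨none, ?_⟩) (fun v => ⟨none, ?_⟩)) (by omega)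
  · refine runs_copyLoop (k := .mst) (by simp) (by simp) rfl ?_ v
    intro k hk
    cases k <;> simp_all [store]
  · have := runs_copyLoop (k := .tmp) (l := [.mst, .inp]) (by simp) (by simp)
      (S := storeOut [] m.reverse [] [] [] o) (S' := storeOut m [] m [] [] o) rfl
      (by intro k hk; cases k <;> simp_all [store]) v
    simpa [store] using this

/-- The program of a task. -/
def ofTask : Task → Prog
  | .word w => emit w
  | .count N c => .seq prepare <| .seq (emit (List.replicate c true)) <|
      .seq (countLoop N) (emit [false])
  | .circuits N s s' => .seq prepare <| .seq (unaryLoop .inp []) <| .seq (gatesProg N s) <|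
      .seq (unaryLoop .inp []) <| .seq (gatesProg N s') (copyLoop .inp [])

theorem maps_ofTask (τ : Task) (m o : List Bool) :
    (ofTask τ).Maps (storeOut m [] [] [] [] o) (storeOut m [] [] [] [] (o ++ τ.eval m))
      (40 * m.length + 10) := by
  cases τ with
  | word w => exact (maps_emit' m [] [] [] [] o w).mono (by omega)
  | count N c =>
    have h := maps_countLoop N m [] m [] [] (o ++ List.replicate c true).reverse
    have h' : (countLoop N).Maps (storeOut m [] m [] [] (o ++ List.replicate c true))
        (storeOut m [] [] [] []
          (o ++ List.replicate c true ++ List.replicate (m.length * N) true))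
        (2 * m.length + 1) := 
      h.cast (by simp [storeOut, -List.replicate_append_replicate]) le_rfl
    refine ((maps_prepare m o).seq <| (maps_emit' m [] m [] [] o _).seq <| h'.seq <|
      maps_emit' m [] [] [] [] _ _).cast ?_ (by omega)
    simp [Task.eval, unaryCode, List.replicate_add,
    -List.replicate_append_replicate]
  | circuits N s s' =>
    -- The input may continue after the second circuit; the rest is discarded, so that every task
    -- starts with an empty `inp`.
    have drain : ∀ i o, (copyLoop .inp []).Maps (storeOut m [] i [] [] o)
        (storeOut m [] [] [] [] o) (2 * i.length + 1) := fun i o v =>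
      ⟨none, runs_copyLoop (k := .inp) (by simp) (by simp) rfl
        (by intro k hk; cases k <;> simp_all [store]) v⟩
    have h1 := ones_add_length_afterZero m
    have h2 := length_afterGates_le (afterZero m)
    have h3 := ones_add_length_afterZero (afterGates (afterZero m))
    have h4 := length_afterGates_le (afterZero (afterGates (afterZero m)))
    refine ((maps_prepare m o).seq <| (maps_skip m [] m [] [] o).seq <|
      (maps_gatesProg N s m [] _ _).seq <| (maps_skip m [] _ [] [] _).seq <|
      (maps_gatesProg N s' m [] _ _).seq <| drain _ _).cast ?_ (by omega)
    simp [Task.eval, firstGates, secondGates]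

/-- The program of a list of tasks. -/
def ofTasks : List Task → Prog
  | [] => emit []
  | τ :: l => .seq (ofTask τ) (ofTasks l)

theorem maps_ofTasks (l : List Task) (m o : List Bool) :
    (ofTasks l).Maps (storeOut m [] [] [] [] o)
      (storeOut m [] [] [] [] (o ++ l.flatMap (Task.eval m)))
      (l.length * (40 * m.length + 10) + 1) := by
  induction l generalizing o with
  | nil => exact (maps_emit' m [] [] [] [] o []).cast (by simp) (by omega)
  | cons τ l ih =>
    exact ((maps_ofTask τ m o).seq (ih _)).cast (by simp)
      (by rw [List.length_cons, add_mul]; omega)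

end Prog

theorem Frag.Runs.exists_length_le {K : Type} [DecidableEq K] {Γ : K → Type} {σ : Type}
    (F : Frag Γ σ) : ∃ C, ∀ {v S v' S' t}, F.Runs v S v' S' t →
      ∀ k, (S' k).length ≤ (S k).length + t * C := by
  refine ⟨∑ l, pushCount (F.code l), fun {v S v' S' t} ⟨n, hn, h⟩ k => ?_⟩
  refine (h.length_le (fun l => Finset.single_le_sum (f := fun l => pushCount (F.code l))
    (fun _ _ => Nat.zero_le _) (Finset.mem_univ l)) k).trans ?_
  gcongr

/-- The output is collected in reverse on `out`. At the end the input is erased and `out` is moved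
to `tmp`, which puts the output in order and leaves no other stack nonempty. The time of this last
move is bounded by the number of symbols the tasks can have written. -/
theorem polyTime_tasks (l : List Task) : PolyTime fun w => l.flatMap (Task.eval w) := by
  obtain ⟨C, hC⟩ := Frag.Runs.exists_length_le (Prog.ofTasks l)
  let F : Prog := .seq (Prog.ofTasks l) <| .seq (Prog.copyLoop .mst []) (Prog.copyLoop .out [.tmp])
  let p : Polynomial ℕ := Polynomial.C l.length * (40 * Polynomial.X + 10) + 1
  refine PolyTime.of_runs F .mst .tmp none (Equiv.refl Bool) (Equiv.refl Bool)
    (p + (2 * Polynomial.X + 1 + (2 * (p * Polynomial.C C) + 1))) fun x => ?_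
  obtain ⟨v, hv⟩ := Prog.maps_ofTasks l x [] none
  have len := hC hv .out
  have h2 := Prog.runs_copyLoop (k := .mst) (l := []) (by simp) (by simp)
    (S := storeOut x [] [] [] [] ([] ++ l.flatMap (Task.eval x)))
    (S' := storeOut [] [] [] [] [] ([] ++ l.flatMap (Task.eval x))) rfl
    (by intro k hk; cases k <;> simp_all [store]) v
  have h3 := Prog.runs_copyLoop (k := .out) (l := [.tmp]) (by simp) (by simp)
    (S := storeOut [] [] [] [] [] ([] ++ l.flatMap (Task.eval x)))
    (S' := store [] (l.flatMap (Task.eval x)) [] [] [] []) rfl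
    (by intro k hk; cases k <;> simp_all [store]) none
  have e1 : update (fun _ : Stk => ([] : List Bool)) .mst x = storeOut x [] [] [] [] [] := by
    funext k; cases k <;> rfl
  have e2 : update (fun _ : Stk => ([] : List Bool)) .tmp (l.flatMap (Task.eval x)) =
      store [] (l.flatMap (Task.eval x)) [] [] [] [] := by
    funext k; cases k <;> rfl
  simp only [Equiv.refl_symm, Equiv.coe_refl, List.map_id]
  rw [e1, e2]
  refine (hv.seq (h2.seq h3)).mono ?_
  simp only [store, List.nil_append, List.length_reverse, List.reverse_nil, List.length_nil,
    zero_add] at len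
  simp only [store, List.nil_append, List.length_reverse, p, Polynomial.eval_add,
    Polynomial.eval_mul, Polynomial.eval_C, Polynomial.eval_one, Polynomial.eval_X,
    Polynomial.eval_ofNat]
  omega

/-! ## States of infinitely many qubits -/

/-- An assignment of bits to all qubits. -/
abbrev Bits : Type := ℕ → Fin 2

/-- Amplitudes. -/
abbrev State : Type := Bits → ℂ

/-- The operator `u` on the qubit `a`. -/
def oneQubit (u : Matrix (Fin 2) (Fin 2) ℂ) (a : ℕ) (Ψ : State) : State :=
  fun y => ∑ b, u (y a) b * Ψ (update y a b)

/-- The Hadamard matrix. -/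
def hadamardMatrix : Matrix (Fin 2) (Fin 2) ℂ := (((√2)⁻¹ : ℝ) : ℂ) • !![1, 1; 1, -1]

/-- The phase matrix. -/
def phaseMatrix : Matrix (Fin 2) (Fin 2) ℂ := !![1, 0; 0, Complex.I]

/-- The Toffoli gate on bit strings. -/
def flipBit (a b c : ℕ) (y : Bits) : Bits := update y c (y c + y a * y b)

/-- The action of a gate on states. -/
def RawGate.apply : RawGate → State → State
  | .hadamard a => oneQubit hadamardMatrix a
  | .phase a => oneQubit phaseMatrix a
  | .toffoli a b c => fun Ψ y => Ψ (flipBit a b c y)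

/-- The action of a list of gates. -/
def run : List RawGate → State → State
  | [], Ψ => Ψ
  | g :: l, Ψ => run l (g.apply Ψ)

theorem run_append (l l' : List RawGate) (Ψ : State) : run (l ++ l') Ψ = run l' (run l Ψ) := by
  induction l generalizing Ψ with
  | nil => rfl
  | cons g l ih => exact ih _

open Classical in
/-- All qubits are `0`. -/
def zeroState : State := fun y => if y = 0 then 1 else 0

/-- The gate is placed on distinct qubits with indices below `n`. -/
def RawGate.Valid (n : ℕ) : RawGate → Prop
  | .hadamard a => a < n
  | .phase a => a < n
  | .toffoli a b c => a < n ∧ b < n ∧ c < n ∧ a ≠ b ∧ a ≠ c ∧ b ≠ c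

/-- The raw gate of a gate. -/
def Gate.raw {n : ℕ} : Gate n → RawGate
  | .hadamard a => .hadamard a
  | .phase a => .phase a
  | .toffoli a b c _ _ _ => .toffoli a b c

theorem Gate.raw_valid {n : ℕ} (g : Gate n) : g.raw.Valid n := by
  cases g with
  | hadamard a => exact a.2
  | phase a => exact a.2
  | toffoli a b c hab hac hbc =>
    exact ⟨a.2, b.2, c.2, by simpa [Fin.ext_iff] using hab, by simpa [Fin.ext_iff] using hac,
      by simpa [Fin.ext_iff] using hbc⟩

theorem Gate.encode_raw {n : ℕ} (g : Gate n) : g.raw.encode = g.encode := by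
  cases g <;> rfl

theorem Circuit.encode_eq {n : ℕ} (Q : Circuit n) :
    Circuit.encode Q = unaryCode n ++ (encodeAll (Q.map Gate.raw) ++ [false]) := by
  unfold Circuit.encode
  congr 1
  induction Q with
  | nil => rfl
  | cons g Q ih =>
    simp only [encodeGates, ih, List.map_cons, encodeAll, List.flatMap_cons, Gate.encode_raw,
      List.append_assoc]

theorem exists_circuit {n : ℕ} (l : List RawGate) (h : ∀ g ∈ l, g.Valid n) :
    ∃ Q : Circuit n, Q.map Gate.raw = l := by
  induction l with
  | nil => exact ⟨[], rfl⟩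
  | cons g l ih =>
    obtain ⟨Q, hQ⟩ := ih fun g' hg' => h g' (List.mem_cons_of_mem _ hg')
    obtain ⟨g', hg'⟩ : ∃ g' : Gate n, g'.raw = g := by
      have hg := h g List.mem_cons_self
      cases g with
      | hadamard a => exact ⟨.hadamard ⟨a, hg⟩, rfl⟩
      | phase a => exact ⟨.phase ⟨a, hg⟩, rfl⟩
      | toffoli a b c =>
        obtain ⟨ha, hb, hc, hab, hac, hbc⟩ := hg
        exact ⟨.toffoli ⟨a, ha⟩ ⟨b, hb⟩ ⟨c, hc⟩ (by simpa [Fin.ext_iff] using hab)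
          (by simpa [Fin.ext_iff] using hac) (by simpa [Fin.ext_iff] using hbc), rfl⟩
    exact ⟨g' :: Q, by simp [hQ, hg']⟩

/-- Extend a bit string by zeros. -/
def extend {n : ℕ} (x : Fin n → Fin 2) : Bits := fun i => if h : i < n then x ⟨i, h⟩ else 0

theorem extend_update {n : ℕ} (x : Fin n → Fin 2) (a : Fin n) (b : Fin 2) :
    extend (update x a b) = update (extend x) a b := by
  funext i
  by_cases h : i = a
  · subst h; simp [extend]
  · by_cases hi : i < n
    · have : (⟨i, hi⟩ : Fin n) ≠ a := by simpa [Fin.ext_iff] using h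
      simp [extend, hi, h, this]
    · simp [extend, hi, h]

@[simp] theorem extend_apply {n : ℕ} (x : Fin n → Fin 2) (a : Fin n) : extend x a = x a := by
  simp [extend]

theorem extend_injective {n : ℕ} : Injective (extend (n := n)) := fun x y h => by
  funext i
  simpa using congrFun h i

/-- Row `x` of the matrix is supported on the strings that agree with `x` outside `a`, that is, on
the strings `update x a b`. -/
theorem mulVec_onQubit {n : ℕ} (u : Matrix (Fin 2) (Fin 2) ℂ) (a : Fin n) (Ψ : State)
    (x : Fin n → Fin 2) :
    (onQubit u a *ᵥ fun y => Ψ (extend y)) x = oneQubit u a Ψ (extend x) := by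
  have e : (onQubit u a *ᵥ fun y => Ψ (extend y)) x = ∑ y : Fin n → Fin 2,
      (if ∀ i, i ≠ a → x i = y i then u (x a) (y a) else 0) * Ψ (extend y) := rfl
  rw [e, oneQubit]
  symm
  refine Finset.sum_of_injOn (fun b => update x a b) (fun b _ b' _ h => ?_)
    (fun _ _ => Finset.mem_univ _) (fun y _ hy => ?_) (fun b _ => ?_)
  · simpa using congrFun h a
  · rw [if_neg, zero_mul]
    intro h
    refine hy ⟨y a, Finset.mem_coe.2 (Finset.mem_univ _), ?_⟩
    funext i
    by_cases hi : i = a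
    · subst hi; simp
    · simpa [hi] using h i hi
  · rw [if_pos]
    · simp [extend_update]
    · intro i hi
      simp [hi]

theorem flipBit_flipBit {a b c : ℕ} (hac : a ≠ c) (hbc : b ≠ c) (y : Bits) :
    flipBit a b c (flipBit a b c y) = y := by
  funext i
  by_cases h : i = c
  · subst h
    simp only [flipBit, update_self, update_of_ne hac, update_of_ne hbc]
    generalize y i = p
    generalize y a = q
    generalize y b = r
    revert p q r
    decide
  · simp [flipBit, h]

theorem Gate.mulVec_matrix {n : ℕ} (g : Gate n) (Ψ : State) :
    (g.matrix *ᵥ fun y => Ψ (extend y)) = fun x => g.raw.apply Ψ (extend x) := by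
  funext x
  cases g with
  | hadamard a => exact mulVec_onQubit _ a Ψ x
  | phase a => exact mulVec_onQubit _ a Ψ x
  | toffoli a b c hab hac hbc =>
    have h1 : ∀ y : Fin n → Fin 2, extend (update y c (y c + y a * y b)) =
        flipBit a b c (extend y) := fun y => by
      rw [extend_update, flipBit, extend_apply, extend_apply, extend_apply]
    have hac' : (a : ℕ) ≠ c := by simpa [Fin.ext_iff] using hac
    have hbc' : (b : ℕ) ≠ c := by simpa [Fin.ext_iff] using hbc
    -- The Toffoli permutation is an involution, so its matrix has the single entry of row `x` in
    -- the column that is the image of `x`.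
    have h2 : ∀ y : Fin n → Fin 2, x = update y c (y c + y a * y b) ↔
        y = update x c (x c + x a * x b) := fun y => by
      rw [← extend_injective.eq_iff, ← (extend_injective (n := n)).eq_iff (a := y), h1, h1]
      constructor
      · intro h; rw [h, flipBit_flipBit hac' hbc']
      · intro h; rw [h, flipBit_flipBit hac' hbc']
    simp only [Gate.matrix, Matrix.mulVec, dotProduct, Matrix.of_apply, h2, ite_mul, one_mul,
      zero_mul, Finset.sum_ite_eq', Finset.mem_univ, if_true, h1]
    rfl

/-- No condition on the support of `Ψ` is needed, because the gates never change bits from `n` on.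
-/
theorem Circuit.mulVec_unitary {n : ℕ} (Q : Circuit n) (Ψ : State) :
    (Circuit.unitary Q *ᵥ fun y => Ψ (extend y)) = fun x => run (Q.map Gate.raw) Ψ (extend x) := by
  induction Q generalizing Ψ with
  | nil => simp [Circuit.unitary, run]
  | cons g Q ih =>
    rw [Circuit.unitary, ← Matrix.mulVec_mulVec, Gate.mulVec_matrix, ih]
    rfl

theorem Circuit.finalState_eq {n : ℕ} (Q : Circuit n) (x : Fin n → Fin 2) :
    Circuit.finalState Q x = run (Q.map Gate.raw) zeroState (extend x) := by
  have : (Pi.single 0 1 : (Fin n → Fin 2) → ℂ) = fun x => zeroState (extend x) := by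
    funext x
    have h0 : extend (0 : Fin n → Fin 2) = 0 := by funext i; simp [extend]
    by_cases h : x = 0
    · subst h; simp [zeroState, h0]
    · have : extend x ≠ 0 := fun h' => h (extend_injective (h'.trans h0.symm))
      simp [zeroState, h, this]
  rw [Circuit.finalState, this, Circuit.mulVec_unitary]

/-! ## Operators on parts of the register -/

theorem comp_update_of_injective {f : ℕ → ℕ} (hf : Injective f) (y : Bits) (a : ℕ) (b : Fin 2) :
    update y (f a) b ∘ f = update (y ∘ f) a b := update_comp_eq_of_injective _ hf _ _

/-- The factor `χ` is constant along the qubits in the range of `f`, so it can be pulled out of the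
sum. -/
theorem oneQubit_embed {f : ℕ → ℕ} (hf : Injective f) (φ χ : State)
    (hχ : ∀ y i b, χ (update y (f i) b) = χ y) (u : Matrix (Fin 2) (Fin 2) ℂ) (a : ℕ) :
    oneQubit u (f a) (fun y => φ (y ∘ f) * χ y) = fun y => oneQubit u a φ (y ∘ f) * χ y := by
  funext y
  simp only [oneQubit, Finset.sum_mul, comp_update_of_injective hf, hχ, comp_apply, mul_assoc]

/-- No value of an ancilla is assumed: the scratch qubits are restored in any case, and comparing
both strings bit by bit leaves finite identities in `Fin 2`. -/
theorem simulate_toffoli {N s : ℕ} (hN : 0 < N) (hs : 6 ≤ s) {a b c : ℕ} (hac : a ≠ c)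
    (hbc : b ≠ c) (Ψ : State) (y : Bits) :
    run ((RawGate.toffoli a b c).simulate N s) Ψ y =
      Ψ (update y (s + c * N) (y (s + c * N) + y 1 * (y 5 +
        (y 3 + y 1 * y (s + a * N)) * (y 4 + y 1 * y (s + b * N))))) := by
  have inj : ∀ i j, i ≠ j → s + i * N ≠ s + j * N := fun i j h h' =>
    h (Nat.eq_of_mul_eq_mul_right hN (by omega))
  have hac := inj a c hac
  have hbc := inj b c hbc
  have ha : 6 ≤ s + a * N := hs.trans (Nat.le_add_right _ _)
  have hb : 6 ≤ s + b * N := hs.trans (Nat.le_add_right _ _)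
  have hc : 6 ≤ s + c * N := hs.trans (Nat.le_add_right _ _)
  simp only [RawGate.simulate, run, RawGate.apply]
  generalize s + a * N = a at *
  generalize s + b * N = b at *
  generalize s + c * N = c at *
  congr 1
  have na : a ≠ 3 ∧ a ≠ 4 ∧ a ≠ 5 := by omega
  have nb : b ≠ 3 ∧ b ≠ 4 ∧ b ≠ 5 := by omega
  have nc : 1 ≠ c ∧ 3 ≠ c ∧ 4 ≠ c ∧ 5 ≠ c := by omega
  have nc' : c ≠ 3 ∧ c ≠ 4 ∧ c ≠ 5 := by omega
  funext k
  by_cases h : k = c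
  · subst h
    simp [flipBit, na, nb, nc, nc', hac, hbc]
  · simp only [flipBit, update_apply, na, nb, nc, nc', hac, hbc, h, if_false, if_true,
      Nat.reduceEqDiff]
    by_cases h3 : k = 3
    · subst h3
      simp
      generalize y 1 = q
      generalize y 3 = r
      generalize y a = w
      revert q r w
      decide
    · by_cases h4 : k = 4
      · subst h4
        simp
        generalize y 1 = q
        generalize y 4 = r
        generalize y b = w
        revert q r w
        decide
      · by_cases h5 : k = 5
        · subst h5
          simp
          generalize y 1 = q
          generalize y 3 = r
          generalize y 4 = t
          generalize y 5 = v
          generalize y a = w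
          generalize y b = z
          revert q r t v w z
          decide
        · simp [h3, h4, h5]

/-- Which qubits carry the `i`-th qubit of a block. -/
def place (N s i : ℕ) : ℕ := s + i * N

theorem place_injective {N : ℕ} (hN : 0 < N) (s : ℕ) : Injective (place N s) := fun i j h =>
  Nat.eq_of_mul_eq_mul_right hN (by simpa [place] using h)

/-- Both sides vanish where `χ` does. On its support the ancillas have their prescribed values, and
the formula of `simulate_toffoli` collapses to the original gate. -/
theorem run_simulate {n N s : ℕ} (hN : 0 < N) (hs : 6 ≤ s) (φ χ : State)
    (hχ : ∀ y i b, χ (update y (place N s i) b) = χ y)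
    (hχ' : ∀ y, χ y ≠ 0 → y 1 = 1 ∧ y 3 = 0 ∧ y 4 = 0 ∧ y 5 = 0) {g : RawGate}
    (hg : g.Valid n) :
    run (g.simulate N s) (fun y => φ (y ∘ place N s) * χ y) =
      fun y => g.apply φ (y ∘ place N s) * χ y := by
  cases g with
  | hadamard a => exact oneQubit_embed (place_injective hN s) φ χ hχ _ a
  | phase a => exact oneQubit_embed (place_injective hN s) φ χ hχ _ a
  | toffoli a b c =>
    obtain ⟨-, -, -, -, hac, hbc⟩ := hg
    funext y
    rw [simulate_toffoli hN hs hac hbc]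
    have := fun v => hχ y c v
    simp only [place] at this
    rw [this]
    by_cases h : χ y = 0
    · simp [h]
    · obtain ⟨h1, h3, h4, h5⟩ := hχ' y h
      congr 1
      simp only [RawGate.apply, flipBit, h1, h3, h4, h5, one_mul, zero_add]
      congr 1
      exact comp_update_of_injective (place_injective hN s) y c _

theorem run_flatMap_simulate {n N s : ℕ} (hN : 0 < N) (hs : 6 ≤ s) (φ χ : State)
    (hχ : ∀ y i b, χ (update y (place N s i) b) = χ y)
    (hχ' : ∀ y, χ y ≠ 0 → y 1 = 1 ∧ y 3 = 0 ∧ y 4 = 0 ∧ y 5 = 0) {l : List RawGate}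
    (hl : ∀ g ∈ l, g.Valid n) :
    run (l.flatMap (RawGate.simulate N s)) (fun y => φ (y ∘ place N s) * χ y) =
      fun y => run l φ (y ∘ place N s) * χ y := by
  induction l generalizing φ with
  | nil => rfl
  | cons g l ih =>
    rw [List.flatMap_cons, run_append, run_simulate hN hs φ χ hχ hχ' (hl g List.mem_cons_self),
      ih _ fun g' hg' => hl g' (List.mem_cons_of_mem _ hg')]
    rfl

/-! ## Blocks -/

/-- The values of the ancillas: the qubits 1 and 2 are `1`. -/
def ancillas : Bits := fun i => if i = 1 ∨ i = 2 then 1 else 0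

open Classical in
/-- The ancillas below `A` have their values, and the blocks are in the states `φ`. -/
def blockState (A N : ℕ) (φ : ℕ → State) : State := fun y =>
  (if ∀ i < A, y i = ancillas i then 1 else 0) *
    ∏ j ∈ Finset.range N, φ j (y ∘ place N (A + j))

/-- After the shift by `A`, the blocks are the residue classes modulo `N`. -/
theorem place_ne {A N j k : ℕ} (hj : j < N) (hk : k < N) (hjk : j ≠ k) (i i' : ℕ) :
    place N (A + j) i ≠ place N (A + k) i' := by
  intro h
  have h' : j + i * N = k + i' * N := by unfold place at h; omega
  have := congrArg (· % N) h'
  simp only [Nat.add_mul_mod_self_right, Nat.mod_eq_of_lt hj, Nat.mod_eq_of_lt hk] at this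
  exact hjk this

/-- The condition on the ancillas and the factors of all other blocks form the factor `χ` of
`run_flatMap_simulate`. -/
theorem run_block {n A N j : ℕ} (hA : 6 ≤ A) (hj : j < N) (φ : ℕ → State) {l : List RawGate}
    (hl : ∀ g ∈ l, g.Valid n) :
    run (l.flatMap (RawGate.simulate N (A + j))) (blockState A N φ) =
      blockState A N (update φ j (run l (φ j))) := by
  classical
  have split : ∀ φ' : ℕ → State, blockState A N φ' = fun y => φ' j (y ∘ place N (A + j)) *
      ((if ∀ i < A, y i = ancillas i then 1 else 0) *
        ∏ k ∈ (Finset.range N).erase j, φ' k (y ∘ place N (A + k))) := by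
    intro φ'
    funext y
    rw [blockState, ← Finset.mul_prod_erase _ _ (Finset.mem_range.2 hj)]
    ring
  rw [split, split, run_flatMap_simulate (n := n) (by omega) (by omega) (φ j) _ _ _ hl]
  · funext y
    simp only [update_self]
    congr 2
    refine Finset.prod_congr rfl fun k hk => ?_
    rw [update_of_ne (Finset.ne_of_mem_erase hk)]
  · intro y i b
    congr 1
    · congr 1
      refine propext (forall₂_congr fun i' hi' => ?_)
      rw [update_of_ne]
      have := Nat.zero_le (i * N)
      unfold place; omega
    · refine Finset.prod_congr rfl fun k hk => ?_
      congr 1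
      funext i'
      have hk' := Finset.mem_erase.1 hk
      rw [comp_apply, update_of_ne (place_ne (Finset.mem_range.1 hk'.2) hj hk'.1 _ _)]
      rfl
  · intro y hy
    have : ∀ i < A, y i = ancillas i := by
      by_contra h
      simp [h] at hy
    refine ⟨this 1 (by omega), this 3 (by omega), this 4 (by omega), this 5 (by omega)⟩

/-- The gates `l j` in each of the first `k` blocks. -/
def blockGates (A N k : ℕ) (l : ℕ → List RawGate) : List RawGate :=
  (List.range k).flatMap fun j => (l j).flatMap (RawGate.simulate N (A + j))

theorem run_blockGates {n A N k : ℕ} (hA : 6 ≤ A) (hk : k ≤ N) (φ : ℕ → State)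
    {l : ℕ → List RawGate} (hl : ∀ j, ∀ g ∈ l j, g.Valid n) :
    run (blockGates A N k l) (blockState A N φ) =
      blockState A N fun j => if j < k then run (l j) (φ j) else φ j := by
  induction k with
  | zero => simp [blockGates, run]
  | succ k ih =>
    rw [blockGates, List.range_succ, List.flatMap_append, run_append, ← blockGates,
      ih (by omega), List.flatMap_cons, List.flatMap_nil, List.append_nil,
      run_block hA (by omega) _ (hl k)]
    congr 1
    funext j
    by_cases h : j = k
    · subst h; simp
    · rw [update_of_ne h]
      have : j < k + 1 ↔ j < k := by omega
      simp [this]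

/-! ## Preparation of the ancillas -/

theorem oneQubit_oneQubit (u v : Matrix (Fin 2) (Fin 2) ℂ) (a : ℕ) (Ψ : State) :
    oneQubit u a (oneQubit v a Ψ) = oneQubit (u * v) a Ψ := by
  funext y
  simp only [oneQubit, update_self, update_idem, Matrix.mul_apply, Fin.sum_univ_two]
  ring

theorem inv_sqrt_two_sq : ((((√2)⁻¹ : ℝ) : ℂ)) * (((√2)⁻¹ : ℝ) : ℂ) = 1 / 2 := by
  rw [← Complex.ofReal_mul, ← mul_inv, Real.mul_self_sqrt (by norm_num)]
  norm_num

/-- The negation of the qubit `a`. -/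
def notGates (a : ℕ) : List RawGate := [.hadamard a, .phase a, .phase a, .hadamard a]

/-- This is `X = H Z H` with `Z = P²`. -/
theorem run_notGates (a : ℕ) (Ψ : State) :
    run (notGates a) Ψ = fun y => Ψ (update y a (y a + 1)) := by
  simp only [notGates, run, RawGate.apply, oneQubit_oneQubit]
  have : hadamardMatrix * (phaseMatrix * (phaseMatrix * hadamardMatrix)) = !![0, 1; 1, 0] := by
    have h := inv_sqrt_two_sq
    ext i j
    fin_cases i <;> fin_cases j <;>
      simp [hadamardMatrix, phaseMatrix, Matrix.mul_apply, Fin.sum_univ_two, ← mul_assoc,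
        -Complex.ofReal_inv] <;> linear_combination 2 * h
  rw [this]
  funext y
  rw [oneQubit, Fin.sum_univ_two]
  rcases Fin.exists_fin_two.1 ⟨y a, rfl⟩ with h | h <;> rw [h] <;> simp

/-- Set the constant ancillas. -/
def prepGates : List RawGate := notGates 1 ++ notGates 2

theorem exists_place {A N k : ℕ} (hN : 0 < N) (hk : A ≤ k) :
    ∃ j < N, ∃ i, k = place N (A + j) i :=
  ⟨(k - A) % N, Nat.mod_lt _ hN, (k - A) / N, by
    have := Nat.mod_add_div (k - A) N
    rw [mul_comm] at this
    unfold place; omega⟩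

/-- Both sides are indicators of a single bit string: `ancillas` below `A`, and zero in all blocks.
-/
theorem run_prepGates {A N : ℕ} (hA : 6 ≤ A) (hN : 0 < N) :
    run prepGates zeroState = blockState A N fun _ => zeroState := by
  classical
  rw [prepGates, run_append, run_notGates, run_notGates]
  funext y
  have key : update (update y 2 (y 2 + 1)) 1 (update y 2 (y 2 + 1) 1 + 1) = 0 ↔
      (∀ i < A, y i = ancillas i) ∧ ∀ j < N, y ∘ place N (A + j) = 0 := by
    have flip : ∀ b : Fin 2, b + 1 = 0 ↔ b = 1 := by decide
    have hp : ∀ j i, 6 ≤ place N (A + j) i := fun j i => by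
      have := Nat.zero_le (i * N)
      unfold place; omega
    constructor
    · intro h
      have h0 : ∀ i, i ≠ 1 → i ≠ 2 → y i = 0 := fun i h1 h2 => by
        have := congrFun h i
        simpa [h1, h2] using this
      refine ⟨fun i _ => ?_, fun j _ => funext fun i => h0 _ ?_ ?_⟩
      · by_cases h1 : i = 1
        · subst h1
          have := congrFun h 1
          simpa [ancillas, flip] using this
        · by_cases h2 : i = 2
          · subst h2
            have := congrFun h 2
            simpa [ancillas, flip] using this
          · simp [ancillas, h1, h2, h0]
      · have := hp j i; omega
      · have := hp j i; omega
    · rintro ⟨h, h'⟩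
      funext i
      by_cases hi : i < A
      · by_cases h1 : i = 1
        · subst h1; simp [h 1 hi, ancillas]
        · by_cases h2 : i = 2
          · subst h2; simp [h 2 hi, ancillas]
          · simp [h1, h2, h i hi, ancillas]
      · obtain ⟨j, hj, i', rfl⟩ := exists_place hN (not_lt.1 hi)
        have := hp j i'
        have h0 := congrFun (h' j hj) i'
        rw [update_of_ne (by omega), update_of_ne (by omega)]
        exact h0
  simp only [zeroState, key, blockState]
  by_cases h : ∀ i < A, y i = ancillas i
  · by_cases h' : ∀ j < N, y ∘ place N (A + j) = 0
    · rw [if_pos ⟨h, h'⟩, if_pos h, one_mul]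
      exact (Finset.prod_eq_one fun j hj => if_pos (h' j (Finset.mem_range.1 hj))).symm
    · rw [if_neg (fun h'' => h' h''.2), if_pos h, one_mul]
      push Not at h'
      obtain ⟨j, hj, hj'⟩ := h'
      exact (Finset.prod_eq_zero (Finset.mem_range.2 hj) (if_neg hj')).symm
  · rw [if_neg (fun h'' => h h''.1), if_neg h, zero_mul]

/-! ## Reduced states -/

/-- The bit strings that vanish from `n` on. -/
def strings (n : ℕ) : Finset Bits :=
  Finset.univ.map ⟨extend (n := n), extend_injective⟩

theorem mem_strings {n : ℕ} {y : Bits} : y ∈ strings n ↔ ∀ i, n ≤ i → y i = 0 := by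
  simp only [strings, Finset.mem_map, Finset.mem_univ, true_and, Embedding.coeFn_mk]
  constructor
  · rintro ⟨x, rfl⟩ i hi
    simp [extend, hi]
  · intro h
    refine ⟨fun i => y i, funext fun i => ?_⟩
    by_cases hi : i < n
    · simp [extend, hi]
    · simp [extend, hi, h i (not_lt.1 hi)]

theorem update_mem_strings {n a : ℕ} (ha : a < n) (b : Fin 2) {y : Bits} :
    update y a b ∈ strings n ↔ y ∈ strings n := by
  rw [mem_strings, mem_strings]
  refine forall₂_congr fun i hi => ?_
  rw [update_of_ne (by omega)]

theorem strings_mono {n m : ℕ} (h : n ≤ m) : strings n ⊆ strings m := fun _ hy =>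
  mem_strings.2 fun i hi => mem_strings.1 hy i (h.trans hi)

/-- The strings are grouped into pairs that differ only in the qubit `a`. -/
theorem sum_strings {M : Type} [AddCommMonoid M] {n a : ℕ} (ha : a < n) (h : Bits → M) :
    ∑ y ∈ strings n, h y = ∑ y ∈ strings n with y a = 0, ∑ b, h (update y a b) := by
  rw [← Finset.sum_filter_add_sum_filter_not _ (fun y => y a = 0)]
  simp only [Fin.sum_univ_two, Finset.sum_add_distrib]
  congr 1
  · refine Finset.sum_congr rfl fun y hy => ?_
    rw [← (Finset.mem_filter.1 hy).2, update_eq_self]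
  · have one : ∀ b : Fin 2, b ≠ 0 → b = 1 := by decide
    refine Finset.sum_nbij' (fun y => update y a 0) (fun y => update y a 1) ?_ ?_ ?_ ?_ ?_
    · intro y hy
      simpa [update_mem_strings ha] using (Finset.mem_filter.1 hy).1
    · intro y hy
      simpa [update_mem_strings ha] using (Finset.mem_filter.1 hy).1
    · intro y hy
      rw [update_idem, ← one _ (Finset.mem_filter.1 hy).2, update_eq_self]
    · intro y hy
      rw [update_idem, ← (Finset.mem_filter.1 hy).2, update_eq_self]
    · intro y hy
      rw [update_idem, ← one _ (Finset.mem_filter.1 hy).2, update_eq_self]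

/-- The reduced state of the qubit `0`, for states of the first `n` qubits. -/
def reduced (n : ℕ) (Ψ : State) : Matrix (Fin 2) (Fin 2) ℂ :=
  Matrix.of fun b b' => ∑ y ∈ strings n with y 0 = 0,
    Ψ (update y 0 b) * star (Ψ (update y 0 b'))

theorem reduced_apply (n : ℕ) (Ψ : State) (b b' : Fin 2) : reduced n Ψ b b' =
    ∑ y ∈ strings n with y 0 = 0, Ψ (update y 0 b) * star (Ψ (update y 0 b')) := rfl

theorem reduced_oneQubit (n : ℕ) (u : Matrix (Fin 2) (Fin 2) ℂ) (Ψ : State) :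
    reduced n (oneQubit u 0 Ψ) = u * reduced n Ψ * uᴴ := by
  ext b b'
  simp only [reduced_apply, Matrix.mul_apply, Matrix.conjTranspose_apply, Fin.sum_univ_two,
    oneQubit, update_self, update_idem, Finset.mul_sum, Finset.sum_mul, ← Finset.sum_add_distrib,
    star_add, star_mul']
  refine Finset.sum_congr rfl fun y _ => ?_
  ring

theorem reduced_isHermitian (n : ℕ) (Ψ : State) : (reduced n Ψ)ᴴ = reduced n Ψ := by
  ext b b'
  simp only [Matrix.conjTranspose_apply, reduced_apply, star_sum, star_mul', star_star]
  exact Finset.sum_congr rfl fun y _ => mul_comm _ _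

/-- The total weight of a state of the first `n` qubits. -/
def weight (n : ℕ) (Ψ : State) : ℂ := ∑ y ∈ strings n, Ψ y * star (Ψ y)

theorem trace_reduced {n : ℕ} (hn : 0 < n) (Ψ : State) :
    reduced n Ψ 0 0 + reduced n Ψ 1 1 = weight n Ψ := by
  rw [weight, sum_strings hn, reduced_apply, reduced_apply, ← Finset.sum_add_distrib]
  simp

theorem weight_oneQubit {n a : ℕ} (ha : a < n) {u : Matrix (Fin 2) (Fin 2) ℂ} (hu : uᴴ * u = 1)
    (Ψ : State) : weight n (oneQubit u a Ψ) = weight n Ψ := by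
  rw [weight, weight, sum_strings ha, sum_strings ha]
  refine Finset.sum_congr rfl fun y _ => ?_
  have h := fun i j => congrFun (congrFun hu i) j
  simp only [Matrix.mul_apply, Fin.sum_univ_two, Matrix.conjTranspose_apply] at h
  simp only [oneQubit, update_self, update_idem, Fin.sum_univ_two, star_add, star_mul']
  have h00 := h 0 0
  have h01 := h 0 1
  have h10 := h 1 0
  have h11 := h 1 1
  simp only [Matrix.one_apply_eq, Matrix.one_apply_ne (zero_ne_one' (Fin 2)),
    Matrix.one_apply_ne (one_ne_zero' (Fin 2))] at h00 h01 h10 h11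
  -- The entries of `uᴴ * u = 1` are weighted with the products of the two amplitudes of the pair.
  linear_combination Ψ (update y a 0) * star (Ψ (update y a 0)) * h00 +
    Ψ (update y a 1) * star (Ψ (update y a 0)) * h01 +
    Ψ (update y a 0) * star (Ψ (update y a 1)) * h10 +
    Ψ (update y a 1) * star (Ψ (update y a 1)) * h11

theorem hadamardMatrix_unitary : hadamardMatrixᴴ * hadamardMatrix = 1 := by
  have h := inv_sqrt_two_sq
  ext i j
  fin_cases i <;> fin_cases j <;>
    simp [hadamardMatrix, Matrix.mul_apply, Fin.sum_univ_two, Complex.conj_ofReal,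
      -Complex.ofReal_inv] <;> linear_combination 2 * h

theorem phaseMatrix_unitary : phaseMatrixᴴ * phaseMatrix = 1 := by
  ext i j
  fin_cases i <;> fin_cases j <;> simp [phaseMatrix, Matrix.mul_apply, Fin.sum_univ_two]

theorem flipBit_mem_strings {n a b c : ℕ} (hc : c < n) {y : Bits} :
    flipBit a b c y ∈ strings n ↔ y ∈ strings n := update_mem_strings hc _

theorem weight_apply {n : ℕ} {g : RawGate} (hg : g.Valid n) (Ψ : State) :
    weight n (g.apply Ψ) = weight n Ψ := by
  cases g with
  | hadamard a => exact weight_oneQubit hg hadamardMatrix_unitary Ψ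
  | phase a => exact weight_oneQubit hg phaseMatrix_unitary Ψ
  | toffoli a b c =>
    obtain ⟨-, -, hc, -, hac, hbc⟩ := hg
    refine Finset.sum_nbij' (flipBit a b c) (flipBit a b c)
      (fun y hy => (flipBit_mem_strings hc).2 hy) (fun y hy => (flipBit_mem_strings hc).2 hy)
      (fun y _ => flipBit_flipBit hac hbc y) (fun y _ => flipBit_flipBit hac hbc y) fun y _ => rfl

theorem weight_run {n : ℕ} {l : List RawGate} (hl : ∀ g ∈ l, g.Valid n) (Ψ : State) :
    weight n (run l Ψ) = weight n Ψ := by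
  induction l generalizing Ψ with
  | nil => rfl
  | cons g l ih =>
    rw [run, ih fun g' hg' => hl g' (List.mem_cons_of_mem _ hg'),
      weight_apply (hl g List.mem_cons_self)]

theorem weight_zeroState (n : ℕ) : weight n zeroState = 1 := by
  rw [weight, Finset.sum_eq_single 0]
  · simp [zeroState]
  · intro y _ hy
    simp [zeroState, hy]
  · intro h
    exact absurd (mem_strings.2 fun _ _ => rfl) h

theorem run_eq_zero {n : ℕ} {l : List RawGate} (hl : ∀ g ∈ l, g.Valid n) {Ψ : State}
    (hΨ : ∀ y ∉ strings n, Ψ y = 0) : ∀ y ∉ strings n, run l Ψ y = 0 := by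
  induction l generalizing Ψ with
  | nil => exact hΨ
  | cons g l ih =>
    refine ih (fun g' hg' => hl g' (List.mem_cons_of_mem _ hg')) ?_
    intro y hy
    have hg := hl g List.mem_cons_self
    have one : ∀ (u : Matrix (Fin 2) (Fin 2) ℂ) (a : ℕ), a < n → oneQubit u a Ψ y = 0 :=
      fun u a ha => Finset.sum_eq_zero fun b _ => by
        rw [hΨ _ (by rwa [update_mem_strings ha]), mul_zero]
    cases g with
    | hadamard a => exact one _ a hg
    | phase a => exact one _ a hg
    | toffoli a b c => exact hΨ _ (by rwa [flipBit_mem_strings hg.2.2.1])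

theorem zeroState_eq_zero (n : ℕ) : ∀ y ∉ strings n, zeroState y = 0 := by
  intro y hy
  have : y ≠ 0 := by
    rintro rfl
    exact hy (mem_strings.2 fun _ _ => rfl)
  simp [zeroState, this]

/-- A block may have more qubits than the circuit it simulates; the surplus qubits remain 0 and do
not affect the reduced state. -/
theorem reduced_eq_of_le {n m : ℕ} (hn : 0 < n) (h : n ≤ m) {Ψ : State}
    (hΨ : ∀ y ∉ strings n, Ψ y = 0) : reduced m Ψ = reduced n Ψ := by
  ext b b'
  symm
  refine Finset.sum_subset (Finset.filter_subset_filter _ (strings_mono h)) fun y hy hy' => ?_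
  have : y ∉ strings n := fun h' => hy' (Finset.mem_filter.2 ⟨h', (Finset.mem_filter.1 hy).2⟩)
  rw [hΨ _ (by rwa [update_mem_strings hn]), zero_mul]

theorem Circuit.outputState_eq {m : ℕ} (Q : Circuit (m + 1)) :
    Circuit.outputState Q = reduced (m + 1) (run (Q.map Gate.raw) zeroState) := by
  ext b b'
  have e : ∀ (z : Fin m → Fin 2) (b : Fin 2),
      extend (Fin.cons b z : Fin (m + 1) → Fin 2) =
        update (extend (Fin.cons 0 z : Fin (m + 1) → Fin 2)) 0 b := fun z b => by
    have := extend_update (Fin.cons 0 z : Fin (m + 1) → Fin 2) 0 b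
    rw [Fin.update_cons_zero] at this
    exact this
  simp only [Circuit.outputState, Matrix.of_apply, Matrix.vecMulVec_apply, Pi.star_apply,
    Circuit.finalState_eq, reduced_apply]
  refine Finset.sum_bij (fun z _ => extend (Fin.cons 0 z : Fin (m + 1) → Fin 2)) ?_ ?_ ?_ ?_
  · intro z _
    rw [Finset.mem_filter]
    exact ⟨by simp [strings], by simp [extend]⟩
  · intro z _ z' _ h
    exact Fin.cons_right_injective 0 (extend_injective h)
  · intro y hy
    obtain ⟨hy, hy0⟩ := Finset.mem_filter.1 hy
    obtain ⟨x, -, rfl⟩ := Finset.mem_map.1 hy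
    refine ⟨Fin.tail x, Finset.mem_univ _, ?_⟩
    have : x 0 = 0 := by simpa [extend] using hy0
    rw [← this, Fin.cons_self_tail]
    rfl
  · intro z _
    rw [e z b, e z b']

theorem Circuit.acceptProb_eq {m : ℕ} (Q : Circuit (m + 1)) :
    Circuit.acceptProb Q = (Circuit.outputState Q 1 1).re := by
  simp only [Circuit.acceptProb, Circuit.outputState, Matrix.of_apply, Matrix.vecMulVec_apply,
    Pi.star_apply, Complex.re_sum]
  refine Finset.sum_congr rfl fun z _ => ?_
  rw [Complex.star_def, Complex.mul_conj, Complex.ofReal_re, Complex.sq_norm]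

/-- The probability that the first qubit has the value `c`. -/
def bitProb (n : ℕ) (Ψ : State) (c : Fin 2) : ℝ := ∑ y ∈ strings n with y 0 = c, ‖Ψ y‖ ^ 2

theorem bitProb_nonneg (n : ℕ) (Ψ : State) (c : Fin 2) : 0 ≤ bitProb n Ψ c :=
  Finset.sum_nonneg fun _ _ => sq_nonneg _

theorem bitProb_eq {n : ℕ} (hn : 0 < n) (Ψ : State) (c : Fin 2) :
    (bitProb n Ψ c : ℂ) = reduced n Ψ c c := by
  rw [bitProb, reduced_apply, Complex.ofReal_sum]
  refine Finset.sum_nbij' (fun y => update y 0 0) (fun y => update y 0 c) ?_ ?_ ?_ ?_ ?_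
  · intro y hy
    simpa [update_mem_strings hn] using (Finset.mem_filter.1 hy).1
  · intro y hy
    simpa [update_mem_strings hn] using (Finset.mem_filter.1 hy).1
  · intro y hy
    rw [update_idem, ← (Finset.mem_filter.1 hy).2, update_eq_self]
  · intro y hy
    rw [update_idem, ← (Finset.mem_filter.1 hy).2, update_eq_self]
  · intro y hy
    have : update (update y 0 0) 0 c = y := by
      rw [update_idem, ← (Finset.mem_filter.1 hy).2, update_eq_self]
    rw [this, Complex.star_def, Complex.mul_conj, Complex.normSq_eq_norm_sq]

/-! ## Measuring the heads of the blocks -/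

/-- The first qubits of the blocks. -/
def heads (A N : ℕ) (y : Bits) : Fin N → Fin 2 := fun j => y (A + j)

/-- Assemble the contents of the blocks. -/
def assemble (A N : ℕ) (hN : 0 < N) (p : Fin N → Bits) : Bits := fun i =>
  if i < A then ancillas i else p ⟨(i - A) % N, Nat.mod_lt _ hN⟩ ((i - A) / N)

theorem assemble_comp_place {A N : ℕ} (hN : 0 < N) (p : Fin N → Bits) (j : Fin N) :
    assemble A N hN p ∘ place N (A + j) = p j := by
  funext i
  have h1 : place N (A + j) i - A = j + i * N := by unfold place; omega
  have h2 : ¬ place N (A + j) i < A := by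
    have := Nat.zero_le (i * N)
    unfold place; omega
  simp only [comp_apply, assemble, h1, h2, if_false]
  congr 1
  · congr 1
    simp [Nat.mod_eq_of_lt j.2]
  · rw [Nat.add_mul_div_right _ _ hN, Nat.div_eq_of_lt j.2, zero_add]

theorem assemble_self {A N : ℕ} (hN : 0 < N) {y : Bits} (hy : ∀ i < A, y i = ancillas i) :
    assemble A N hN (fun j => y ∘ place N (A + j)) = y := by
  funext i
  unfold assemble
  split_ifs with h
  · exact (hy i h).symm
  · simp only [comp_apply, place]
    congr 1
    have := Nat.mod_add_div (i - A) N
    rw [mul_comm] at this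
    omega

/-- In a product state the measurement outcomes of the heads are independent. Strings with the right
ancillas correspond to tuples of block contents through `assemble`, and the other strings have
amplitude zero. Grouping the tuples by their heads turns the sum into a product of marginals. -/
theorem sum_blockState {A N L : ℕ} (hN : 0 < N) (φ : ℕ → State)
    (g : (Fin N → Fin 2) → ℝ) :
    ∑ y ∈ strings (A + N * L), g (heads A N y) * ‖blockState A N φ y‖ ^ 2 =
      ∑ h, g h * ∏ j : Fin N, bitProb L (φ j) (h j) := by
  classical
  have h1 : ∑ y ∈ strings (A + N * L), g (heads A N y) * ‖blockState A N φ y‖ ^ 2 =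
      ∑ p ∈ Fintype.piFinset (fun _ : Fin N => strings L),
        g (fun j => p j 0) * ∏ j : Fin N, ‖φ j (p j)‖ ^ 2 := by
    symm
    refine Finset.sum_of_injOn (assemble A N hN) ?_ ?_ ?_ ?_
    · intro p _ q _ h
      funext j
      rw [← assemble_comp_place (A := A) hN p j, h, assemble_comp_place]
    · intro p hp
      rw [Finset.mem_coe, mem_strings]
      intro i hi
      have hiA : ¬ i < A := by
        have := Nat.zero_le (N * L); omega
      rw [assemble, if_neg hiA]
      refine mem_strings.1 (Fintype.mem_piFinset.1 (Finset.mem_coe.1 hp) _) _ ?_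
      rw [Nat.le_div_iff_mul_le hN, mul_comm]
      omega
    · intro y hy hy'
      have : ¬ ∀ i < A, y i = ancillas i := by
        intro h
        refine hy' ⟨fun j => y ∘ place N (A + j), ?_, assemble_self hN h⟩
        rw [Finset.mem_coe, Fintype.mem_piFinset]
        intro j
        rw [mem_strings]
        intro i hi
        refine mem_strings.1 hy _ ?_
        have := Nat.mul_le_mul_right N hi
        rw [mul_comm L N] at this
        unfold place; omega
      simp [blockState, this]
    · intro p _
      have e1 : heads A N (assemble A N hN p) = fun j => p j 0 := by
        funext j
        have := congrFun (assemble_comp_place (A := A) hN p j) 0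
        simpa [place, heads] using this
      have e2 : ∀ i < A, assemble A N hN p i = ancillas i := fun i hi => by simp [assemble, hi]
      rw [e1, blockState, if_pos e2, one_mul, Finset.prod_range, norm_prod, Finset.prod_pow]
      simp only [assemble_comp_place]
  rw [h1, ← Finset.sum_fiberwise _ (fun p => fun j => p j 0)]
  refine Finset.sum_congr rfl fun h _ => ?_
  simp only [bitProb]
  rw [Finset.prod_univ_sum, Finset.mul_sum]
  have e : (Fintype.piFinset fun _ : Fin N => strings L).filter (fun p => (fun j => p j 0) = h) =
      Fintype.piFinset fun j => (strings L).filter fun y => y 0 = h j := by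
    ext p
    simp only [Finset.mem_filter, Fintype.mem_piFinset, funext_iff, forall_and]
  rw [e]
  refine Finset.sum_congr rfl fun p hp => ?_
  congr 2
  funext j
  exact (Finset.mem_filter.1 (Fintype.mem_piFinset.1 hp j)).2

/-! ## Classical circuits -/

/-- A classical reversible gate. -/
def RawGate.Classical : RawGate → Prop
  | .toffoli a b c => a ≠ c ∧ b ≠ c
  | _ => False

/-- The action of a classical gate on bit strings. -/
def RawGate.step : RawGate → Bits → Bits
  | .toffoli a b c => flipBit a b c
  | _ => id

/-- The action of a classical circuit on bit strings. -/
def forward : List RawGate → Bits → Bits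
  | [], y => y
  | g :: l, y => forward l (g.step y)

theorem forward_append (l l' : List RawGate) (y : Bits) :
    forward (l ++ l') y = forward l' (forward l y) := by
  induction l generalizing y with
  | nil => rfl
  | cons g l ih => exact ih _

theorem RawGate.Classical.step_step {g : RawGate} (hg : g.Classical) (y : Bits) :
    g.step (g.step y) = y := by
  cases g with
  | hadamard a => exact hg.elim
  | phase a => exact hg.elim
  | toffoli a b c => exact flipBit_flipBit hg.1 hg.2 y

theorem run_forward {l : List RawGate} (hl : ∀ g ∈ l, g.Classical) (Ψ : State) (y : Bits) :
    run l Ψ (forward l y) = Ψ y := by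
  induction l generalizing Ψ y with
  | nil => rfl
  | cons g l ih =>
    have hg := hl g List.mem_cons_self
    rw [run, forward, ih fun g' hg' => hl g' (List.mem_cons_of_mem _ hg')]
    have := hg.step_step y
    cases g with
    | hadamard a => exact hg.elim
    | phase a => exact hg.elim
    | toffoli a b c => exact congrArg Ψ this

theorem forward_bijOn {n : ℕ} {l : List RawGate} (hl : ∀ g ∈ l, g.Classical)
    (hl' : ∀ g ∈ l, g.Valid n) : Bijective (forward l) ∧
      ∀ y, forward l y ∈ strings n ↔ y ∈ strings n := by
  induction l with
  | nil => exact ⟨bijective_id, fun _ => Iff.rfl⟩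
  | cons g l ih =>
    have hg := hl g List.mem_cons_self
    obtain ⟨h1, h2⟩ := ih (fun g' hg' => hl g' (List.mem_cons_of_mem _ hg'))
      (fun g' hg' => hl' g' (List.mem_cons_of_mem _ hg'))
    refine ⟨h1.comp (Involutive.bijective hg.step_step), fun y => ?_⟩
    rw [forward, h2]
    cases g with
    | hadamard a => exact Iff.rfl
    | phase a => exact Iff.rfl
    | toffoli a b c => exact flipBit_mem_strings (hl' _ List.mem_cons_self).2.2.1

/-- This is the principle of deferred measurement. After the classical circuit, qubit 0 is a
function of the other qubits on the support of the state, so two strings that differ only in qubit 0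
never both have nonzero amplitude. Hence the off-diagonal entries vanish, even if garbage is left on
other qubits. -/
theorem reduced_run_classical {n : ℕ} (hn : 0 < n) {l : List RawGate}
    (hl : ∀ g ∈ l, g.Classical) (hl' : ∀ g ∈ l, g.Valid n) (Φ : State) (f : Bits → Fin 2)
    (hf : ∀ y b, f (update y 0 b) = f y)
    (h : ∀ y, Φ y ≠ 0 → forward l y 0 = f y ∧ f (forward l y) = f y) :
    reduced n (run l Φ) = Matrix.diagonal fun c =>
      ((∑ y ∈ strings n, (if f y = c then 1 else 0) * ‖Φ y‖ ^ 2 : ℝ) : ℂ) := by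
  obtain ⟨hb, hs⟩ := forward_bijOn hl hl'
  have supp : ∀ y, run l Φ y ≠ 0 → y 0 = f y := by
    intro y hy
    obtain ⟨x, rfl⟩ := hb.2 y
    rw [run_forward hl] at hy
    rw [(h x hy).1, (h x hy).2]
  ext c c'
  rw [reduced_apply]
  by_cases hc : c = c'
  · subst hc
    rw [Matrix.diagonal_apply_eq]
    have e1 : ∑ y ∈ strings n, (if f y = c then 1 else 0) * ‖Φ y‖ ^ 2 =
        ∑ y ∈ strings n, (if f y = c then 1 else 0) * ‖run l Φ y‖ ^ 2 := by
      refine Finset.sum_bij (fun y _ => forward l y) (fun y hy => (hs y).2 hy)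
        (fun y _ y' _ e => hb.1 e) (fun y hy => ?_) fun y _ => ?_
      · obtain ⟨x, rfl⟩ := hb.2 y
        exact ⟨x, (hs x).1 hy, rfl⟩
      · rw [run_forward hl]
        by_cases hy : Φ y = 0
        · simp [hy]
        · rw [(h y hy).2]
    rw [e1, sum_strings hn, Complex.ofReal_sum]
    refine Finset.sum_congr rfl fun y _ => ?_
    rw [Complex.star_def, Complex.mul_conj, Complex.normSq_eq_norm_sq,
      Finset.sum_eq_single c]
    · by_cases hy : run l Φ (update y 0 c) = 0
      · simp [hy]
      · rw [← supp _ hy, update_self, if_pos rfl, one_mul]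
    · intro b _ hbc
      by_cases hy : run l Φ (update y 0 b) = 0
      · simp [hy]
      · rw [← supp _ hy, update_self, if_neg hbc, zero_mul]
    · simp
  · rw [Matrix.diagonal_apply_ne _ hc]
    refine Finset.sum_eq_zero fun y _ => ?_
    by_contra hne
    have h1 := supp _ (left_ne_zero_of_mul hne)
    have h2 := supp _ (star_ne_zero.1 (right_ne_zero_of_mul hne))
    rw [update_self, hf] at h1 h2
    exact hc (h1.trans h2.symm)

/-! ## Boolean functions -/

/-- Polynomial expressions over the field with two elements. -/
inductive BoolExpr (N : ℕ) : Type
  | one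
  | var (j : Fin N)
  | add (e e' : BoolExpr N)
  | mul (e e' : BoolExpr N)

namespace BoolExpr

variable {N : ℕ}

/-- The value of an expression. -/
def eval (x : Fin N → Fin 2) : BoolExpr N → Fin 2
  | one => 1
  | var j => x j
  | add e e' => e.eval x + e'.eval x
  | mul e e' => e.eval x * e'.eval x

/-- Interpolation over the field with two elements: `p + q + 1` is the indicator of `p = q`,
products of such factors are indicators of points, and their sums are indicators of sets. -/
theorem exists_eval (F : (Fin N → Fin 2) → Fin 2) : ∃ e : BoolExpr N, ∀ x, e.eval x = F x := by
  classical
  have const : ∀ c : Fin 2, ∃ e : BoolExpr N, ∀ x, e.eval x = c := by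
    intro c
    rcases Fin.exists_fin_two.1 ⟨c, rfl⟩ with h | h
    · exact ⟨add one one, fun x => h ▸ rfl⟩
    · exact ⟨one, fun x => h ▸ rfl⟩
  have lit : ∀ p q : Fin 2, p + (q + 1) = if p = q then 1 else 0 := by decide
  have point : ∀ (h : Fin N → Fin 2) (s : Finset (Fin N)), ∃ e : BoolExpr N,
      ∀ x, e.eval x = if ∀ j ∈ s, x j = h j then 1 else 0 := by
    intro h s
    induction s using Finset.induction_on with
    | empty => exact ⟨one, fun x => by simp [eval]⟩
    | insert j s _ ih =>
      obtain ⟨e, he⟩ := ih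
      obtain ⟨c, hc⟩ := const (h j + 1)
      refine ⟨mul (add (var j) c) e, fun x => ?_⟩
      simp only [eval, he, hc, lit, Finset.forall_mem_insert]
      by_cases h1 : x j = h j <;> by_cases h2 : ∀ j ∈ s, x j = h j <;> simp [h1, h2]
  have set : ∀ T : Finset (Fin N → Fin 2), ∃ e : BoolExpr N,
      ∀ x, e.eval x = if x ∈ T then 1 else 0 := by
    intro T
    induction T using Finset.induction_on with
    | empty => simpa using const 0
    | insert h T hT ih =>
      obtain ⟨e, he⟩ := ih
      obtain ⟨c, hc⟩ := point h Finset.univ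
      refine ⟨add c e, fun x => ?_⟩
      have hx : (∀ j ∈ Finset.univ, x j = h j) ↔ x = h := by simp [funext_iff]
      simp only [eval, he, hc, hx, Finset.mem_insert]
      by_cases h1 : x = h
      · subst h1; simp [hT]
      · simp [h1]
  obtain ⟨e, he⟩ := set (Finset.univ.filter fun x => F x = 1)
  refine ⟨e, fun x => ?_⟩
  rw [he]
  have : ∀ c : Fin 2, (if c = 1 then 1 else 0) = c := by decide
  simpa using this (F x)

/-- One less than the number of qubits that a circuit for the expression needs. -/
def width : BoolExpr N → ℕ
  | one => 0
  | var _ => 0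
  | add e e' => e.width + e'.width + 2
  | mul e e' => e.width + e'.width + 2

/-- A circuit that writes the value of the expression on the qubit `c + e.width`, if the qubits
from `c` to `c + e.width` are `0`, the qubits `1` and `2` are `1`, and the variables are given by
the qubits `loc j`. -/
def gates (loc : Fin N → ℕ) : ℕ → BoolExpr N → List RawGate
  | c, one => [.toffoli 1 2 c]
  | c, var j => [.toffoli 1 (loc j) c]
  | c, add e e' => e.gates loc c ++ (e'.gates loc (c + e.width + 1) ++
      [.toffoli 1 (c + e.width) (c + e.width + 1 + e'.width + 1),
        .toffoli 1 (c + e.width + 1 + e'.width) (c + e.width + 1 + e'.width + 1)])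
  | c, mul e e' => e.gates loc c ++ (e'.gates loc (c + e.width + 1) ++
      [.toffoli (c + e.width) (c + e.width + 1 + e'.width) (c + e.width + 1 + e'.width + 1)])

theorem valid_gates {loc : Fin N → ℕ} {n : ℕ} (hn : ∀ j, loc j < n) (e : BoolExpr N) {c : ℕ}
    (hc : 3 ≤ c) (hloc : ∀ j, c + e.width < loc j) (hcn : c + e.width < n) :
    ∀ g ∈ e.gates loc c, g.Classical ∧ g.Valid n := by
  induction e generalizing c with
  | one =>
    simp only [width] at hcn
    simp only [gates, List.mem_singleton, forall_eq, RawGate.Classical, RawGate.Valid]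
    omega
  | var j =>
    have h1 := hn j
    have h2 := hloc j
    simp only [width] at hcn h2
    simp only [gates, List.mem_singleton, forall_eq, RawGate.Classical, RawGate.Valid]
    omega
  | add e e' ih ih' =>
    simp only [width] at hcn hloc
    simp only [gates, List.mem_append, List.mem_cons, List.not_mem_nil, or_false]
    rintro g (h | h | rfl | rfl)
    · exact ih hc (fun j => by have := hloc j; omega) (by omega) g h
    · exact ih' (by omega) (fun j => by have := hloc j; omega) (by omega) g h
    · simp only [RawGate.Classical, RawGate.Valid]; omega
    · simp only [RawGate.Classical, RawGate.Valid]; omega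
  | mul e e' ih ih' =>
    simp only [width] at hcn hloc
    simp only [gates, List.mem_append, List.mem_cons, List.not_mem_nil, or_false]
    rintro g (h | h | rfl)
    · exact ih hc (fun j => by have := hloc j; omega) (by omega) g h
    · exact ih' (by omega) (fun j => by have := hloc j; omega) (by omega) g h
    · simp only [RawGate.Classical, RawGate.Valid]; omega

/-- Every node has a target qubit of its own in the interval, so nothing has to be uncomputed;
intermediate values remain there as garbage. The second claim is the frame condition that lets the
induction combine two subexpressions. -/
theorem forward_gates {loc : Fin N → ℕ} (e : BoolExpr N) {c : ℕ} (hc : 3 ≤ c)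
    (hloc : ∀ j, c + e.width < loc j) {y : Bits} (h1 : y 1 = 1) (h2 : y 2 = 1)
    (h0 : ∀ i, c ≤ i → i ≤ c + e.width → y i = 0) :
    forward (e.gates loc c) y (c + e.width) = e.eval (fun j => y (loc j)) ∧
      ∀ i, i < c ∨ c + e.width < i → forward (e.gates loc c) y i = y i := by
  -- The common part of sum and product: both operands are evaluated on consecutive intervals, and
  -- the last qubit is still 0.
  have node : ∀ (e e' : BoolExpr N),
      (∀ {c : ℕ}, 3 ≤ c → (∀ j, c + e.width < loc j) → ∀ {y : Bits}, y 1 = 1 → y 2 = 1 →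
        (∀ i, c ≤ i → i ≤ c + e.width → y i = 0) →
        forward (e.gates loc c) y (c + e.width) = e.eval (fun j => y (loc j)) ∧
          ∀ i, i < c ∨ c + e.width < i → forward (e.gates loc c) y i = y i) →
      (∀ {c : ℕ}, 3 ≤ c → (∀ j, c + e'.width < loc j) → ∀ {y : Bits}, y 1 = 1 → y 2 = 1 →
        (∀ i, c ≤ i → i ≤ c + e'.width → y i = 0) →
        forward (e'.gates loc c) y (c + e'.width) = e'.eval (fun j => y (loc j)) ∧
          ∀ i, i < c ∨ c + e'.width < i → forward (e'.gates loc c) y i = y i) →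
      ∀ {c : ℕ}, 3 ≤ c → (∀ j, c + (e.width + e'.width + 2) < loc j) → ∀ {y : Bits}, y 1 = 1 →
        y 2 = 1 → (∀ i, c ≤ i → i ≤ c + (e.width + e'.width + 2) → y i = 0) →
        ∃ z, forward (e'.gates loc (c + e.width + 1)) (forward (e.gates loc c) y) = z ∧
          z (c + e.width) = e.eval (fun j => y (loc j)) ∧
          z (c + e.width + 1 + e'.width) = e'.eval (fun j => y (loc j)) ∧
          ∀ i, i < c ∨ c + e.width + 1 + e'.width < i → z i = y i := by
    intro e e' ih ih' c hc hloc y h1 h2 h0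
    obtain ⟨a1, a2⟩ := ih hc (fun j => by have := hloc j; omega) h1 h2
      (fun i hi hi' => h0 i hi (by omega))
    obtain ⟨b1, b2⟩ := ih' (c := c + e.width + 1) (by omega)
      (fun j => by have := hloc j; omega) (y := forward (e.gates loc c) y)
      (by rw [a2 1 (by omega), h1]) (by rw [a2 2 (by omega), h2])
      (fun i hi hi' => by rw [a2 i (by omega), h0 i (by omega) (by omega)])
    refine ⟨_, rfl, ?_, ?_, fun i hi => ?_⟩
    · rw [b2 _ (by omega), a1]
    · rw [b1]
      congr 1
      funext j
      have := hloc j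
      rw [a2 _ (by omega)]
    · rw [b2 i (by omega), a2 i (by omega)]
  induction e generalizing c y with
  | one =>
    have := h0 c le_rfl (by simp [width])
    refine ⟨by simp [gates, forward, RawGate.step, flipBit, width, eval, h1, h2, this],
      fun i hi => ?_⟩
    simp only [width] at hi
    simp only [gates, forward, RawGate.step, flipBit]
    rw [update_of_ne (by omega)]
  | var j =>
    have := h0 c le_rfl (by simp [width])
    refine ⟨by simp [gates, forward, RawGate.step, flipBit, width, eval, h1, this],
      fun i hi => ?_⟩
    simp only [width] at hi
    simp only [gates, forward, RawGate.step, flipBit]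
    rw [update_of_ne (by omega)]
  | add e e' ih ih' =>
    simp only [width] at hloc h0 ⊢
    obtain ⟨z, hz, z1, z2, z3⟩ := node e e' ih ih' hc hloc h1 h2 h0
    have ht : c + (e.width + e'.width + 2) = c + e.width + 1 + e'.width + 1 := by omega
    have zt : z (c + e.width + 1 + e'.width + 1) = 0 := by
      rw [z3 _ (by omega), h0 _ (by omega) (by omega)]
    have zo : z 1 = 1 := by rw [z3 1 (by omega), h1]
    simp only [gates, forward_append, hz, forward, RawGate.step, flipBit, ht, eval]
    constructor
    · rw [update_self, update_self, zt, update_of_ne (by omega), update_of_ne (by omega), z1, zo,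
        z2, zero_add, one_mul, one_mul]
    · intro i hi
      rw [update_of_ne (by omega), update_of_ne (by omega), z3 i (by omega)]
  | mul e e' ih ih' =>
    simp only [width] at hloc h0 ⊢
    obtain ⟨z, hz, z1, z2, z3⟩ := node e e' ih ih' hc hloc h1 h2 h0
    have ht : c + (e.width + e'.width + 2) = c + e.width + 1 + e'.width + 1 := by omega
    have zt : z (c + e.width + 1 + e'.width + 1) = 0 := by
      rw [z3 _ (by omega), h0 _ (by omega) (by omega)]
    simp only [gates, forward_append, hz, forward, RawGate.step, flipBit, ht, eval]
    constructor
    · rw [update_self, zt, z1, z2, zero_add]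
    · intro i hi
      rw [update_of_ne (by omega), z3 i (by omega)]

end BoolExpr

/-! ## The parser is correct on descriptions -/

theorem ones_unaryCode (n : ℕ) (r : List Bool) : ones (unaryCode n ++ r) = n := by
  induction n with
  | zero => rfl
  | succ n ih =>
    simpa [unaryCode, List.replicate_succ, ones] using ih

theorem afterZero_unaryCode (n : ℕ) (r : List Bool) : afterZero (unaryCode n ++ r) = r := by
  induction n with
  | zero => rfl
  | succ n ih =>
    simpa [unaryCode, List.replicate_succ, afterZero] using ih

theorem RawGate.encode_eq_cons (g : RawGate) : ∃ u, g.encode = true :: u ∧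
    ∀ r, headGate (u ++ r) = g ∧ afterGate (u ++ r) = r := by
  cases g with
  | hadamard a =>
    exact ⟨[false, false] ++ unaryCode a, rfl, fun r => by
      simp [headGate, afterGate, ones_unaryCode, afterZero_unaryCode]⟩
  | phase a =>
    exact ⟨[false, true] ++ unaryCode a, rfl, fun r => by
      simp [headGate, afterGate, ones_unaryCode, afterZero_unaryCode]⟩
  | toffoli a b c =>
    exact ⟨[true] ++ unaryCode a ++ unaryCode b ++ unaryCode c, rfl, fun r => by
      simp [headGate, afterGate, ones_unaryCode, afterZero_unaryCode]⟩

theorem gatesOf_encodeAll (l : List RawGate) (r : List Bool) :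
    gatesOf (encodeAll l ++ false :: r) = l ∧ afterGates (encodeAll l ++ false :: r) = r := by
  induction l with
  | nil => exact ⟨gatesOf_of_ne (by simp [encodeAll]), afterGates_of_ne (by simp [encodeAll])⟩
  | cons g l ih =>
    obtain ⟨u, hu, h⟩ := g.encode_eq_cons
    have e : encodeAll (g :: l) ++ false :: r = true :: (u ++ (encodeAll l ++ false :: r)) := by
      simp [encodeAll, hu]
    rw [e, gatesOf_cons, afterGates_cons, (h _).1, (h _).2, ih.1, ih.2]
    exact ⟨rfl, rfl⟩

theorem firstGates_encode {n : ℕ} (Q : Circuit n) (r : List Bool) :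
    firstGates (Circuit.encode Q ++ r) = Q.map Gate.raw := by
  rw [firstGates, Circuit.encode_eq, List.append_assoc, afterZero_unaryCode, List.append_assoc]
  exact (gatesOf_encodeAll _ _).1

theorem secondGates_encode {n n' : ℕ} (Q : Circuit n) (Q' : Circuit n') :
    secondGates (Circuit.encode Q ++ Circuit.encode Q') = Q'.map Gate.raw := by
  rw [secondGates, Circuit.encode_eq, List.append_assoc, afterZero_unaryCode, List.append_assoc,
    List.singleton_append, (gatesOf_encodeAll _ _).2, ← List.append_nil (Circuit.encode Q')]
  exact firstGates_encode Q' []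

/-- A single description is read as a pair whose second circuit is empty, so 1QSCI and the circuits
of a BQP procedure are handled by the same gadget. -/
theorem secondGates_encode_nil {n : ℕ} (Q : Circuit n) : secondGates (Circuit.encode Q) = [] := by
  rw [secondGates, Circuit.encode_eq, afterZero_unaryCode, (gatesOf_encodeAll _ _).2]
  simp [afterZero, gatesOf]

/-- All qubit indices are below `n`. -/
def RawGate.Below (n : ℕ) : RawGate → Prop
  | .hadamard a => a < n
  | .phase a => a < n
  | .toffoli a b c => a < n ∧ b < n ∧ c < n

theorem headGate_below {n : ℕ} (w : List Bool) (h : w.length < n) : (headGate w).Below n := by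
  unfold headGate
  split
  · rename_i w
    have := ones_add_length_afterZero w
    have := ones_add_length_afterZero (afterZero w)
    have := ones_add_length_afterZero (afterZero (afterZero w))
    simp only [List.length_cons] at h
    exact ⟨by omega, by omega, by omega⟩
  · have := ones_add_length_afterZero w.tail.tail
    simp only [List.length_tail] at this
    split_ifs
    · exact lt_of_le_of_lt (by omega) h
    · exact lt_of_le_of_lt (by omega) h

theorem gatesOf_below {n : ℕ} (w : List Bool) (h : w.length < n) :
    ∀ g ∈ gatesOf w, g.Below n := by
  induction hw : w.length using Nat.strong_induction_on generalizing w with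
  | _ m ih =>
    by_cases hi : w.head? = some true
    · obtain ⟨w, rfl⟩ : ∃ w', w = true :: w' := by
        rcases w with _ | ⟨_ | _, w⟩ <;> simp_all
      have := length_afterGate_le w
      simp only [List.length_cons] at h hw
      rw [gatesOf_cons]
      intro g hg
      rcases List.mem_cons.1 hg with rfl | hg
      · exact headGate_below w (by omega)
      · exact ih _ (by omega) (afterGate w) (by omega) rfl g hg
    · rw [gatesOf_of_ne hi]
      simp

/-- The bound holds for every word, malformed or not, since an index never exceeds the number of
symbols that encode it. The number of qubits can thus be computed from the length of the input
alone. -/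
theorem firstGates_below (w : List Bool) : ∀ g ∈ firstGates w, g.Below (w.length + 1) :=
  gatesOf_below _ (by have := ones_add_length_afterZero w; omega)

theorem secondGates_below (w : List Bool) : ∀ g ∈ secondGates w, g.Below (w.length + 1) :=
  gatesOf_below _ (by
    have := ones_add_length_afterZero w
    have := length_afterGates_le (afterZero w)
    have := ones_add_length_afterZero (afterGates (afterZero w))
    omega)

theorem RawGate.Valid.below {n : ℕ} {g : RawGate} (h : g.Valid n) : g.Below n := by
  cases g with
  | hadamard a => exact h
  | phase a => exact h
  | toffoli a b c => exact ⟨h.1, h.2.1, h.2.2.1⟩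

/-- Distinctness of the qubits is built into `RawGate.simulate`, so a bound on the indices is
enough; `hL` ensures that the ancillas lie below `M` as well. -/
theorem valid_simulate {L M N s : ℕ} (hs : 6 ≤ s) (hM : ∀ i < L, s + i * N < M) (hL : 0 < L)
    {g : RawGate} (hg : g.Below L) : ∀ g' ∈ g.simulate N s, g'.Valid M := by
  have h0 := hM 0 hL
  cases g with
  | hadamard a =>
    simp only [RawGate.simulate, List.mem_singleton, forall_eq]
    exact hM a hg
  | phase a =>
    simp only [RawGate.simulate, List.mem_singleton, forall_eq]
    exact hM a hg
  | toffoli a b c =>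
    have ha := hM a hg.1
    have hb := hM b hg.2.1
    have hc := hM c hg.2.2
    simp only [RawGate.simulate, List.mem_cons, List.not_mem_nil, or_false]
    rintro g' (rfl | rfl | rfl | rfl | rfl | rfl | rfl) <;> simp only [RawGate.Valid] <;> omega

theorem valid_blockGates {A L N k : ℕ} (hA : 6 ≤ A) (hk : k ≤ N) (hL : 0 < L)
    {l : ℕ → List RawGate} (hl : ∀ j, ∀ g ∈ l j, g.Below L) :
    ∀ g ∈ blockGates A N k l, g.Valid (A + N * L) := by
  intro g hg
  obtain ⟨j, hj, hg⟩ := List.mem_flatMap.1 hg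
  obtain ⟨g', hg', hg⟩ := List.mem_flatMap.1 hg
  refine valid_simulate (by omega) (fun i hi => ?_) hL (hl j g' hg') g hg
  have := List.mem_range.1 hj
  have : (i + 1) * N ≤ L * N := Nat.mul_le_mul_right N hi
  rw [add_mul, one_mul, mul_comm L] at this
  omega

/-! ## The gadget -/

/-- The basis change before the first qubit of a block is measured: measure in the bases of the
three Pauli matrices in turn. -/
def basisGates (t : ℕ) : List RawGate :=
  if t % 3 = 0 then [] else if t % 3 = 1 then [.hadamard 0] else [.phase 0, .hadamard 0]

/-- The matrix of the basis change. -/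
def basisMatrix (t : ℕ) : Matrix (Fin 2) (Fin 2) ℂ :=
  if t % 3 = 0 then 1 else
    if t % 3 = 1 then hadamardMatrix else hadamardMatrix * phaseMatrix

theorem basisGates_valid (t : ℕ) : ∀ g ∈ basisGates t, g.Valid 1 := by
  unfold basisGates
  split_ifs <;> simp [RawGate.Valid]

theorem reduced_basisGates (n t : ℕ) (φ : State) :
    reduced n (run (basisGates t) φ) = basisMatrix t * reduced n φ * (basisMatrix t)ᴴ := by
  unfold basisGates basisMatrix
  split_ifs
  · simp [run]
  · exact reduced_oneQubit n _ φ
  · simp only [run, RawGate.apply, oneQubit_oneQubit]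
    exact reduced_oneQubit n _ φ

/-- The probability to measure `c` after the basis change. -/
def basisProb (ρ : Matrix (Fin 2) (Fin 2) ℂ) (t : ℕ) (c : Fin 2) : ℝ :=
  ((basisMatrix t * ρ * (basisMatrix t)ᴴ) c c).re

/-- Simulate the two circuits in the blocks with even and odd numbers, respectively, and evaluate
a Boolean function of the measurement outcomes of the blocks. -/
def gadgetGates (k : ℕ) (e : BoolExpr (2 * k)) (l : ℕ → List RawGate) : List RawGate :=
  -- Qubit 0 is the output, qubits 1 and 2 are constantly 1, qubits 3 to 5 are scratch for the
  -- simulated Toffoli gates, qubits 6 to `6 + e.width` evaluate `e`, and the blocks follow.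
  prepGates ++ (blockGates (7 + e.width) (2 * k) (2 * k) l ++
    (blockGates (7 + e.width) (2 * k) (2 * k) (fun j => basisGates (j / 2)) ++
      (e.gates (fun j => 7 + e.width + j) 6 ++ [.toffoli 1 (6 + e.width) 0])))

variable {k : ℕ} (e : BoolExpr (2 * k))

theorem post_valid {M : ℕ} (hM : 7 + e.width + 2 * k ≤ M) :
    ∀ g ∈ e.gates (fun j => 7 + e.width + j) 6 ++ [.toffoli 1 (6 + e.width) 0],
      g.Classical ∧ g.Valid M := by
  intro g hg
  rcases List.mem_append.1 hg with hg | hg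
  · exact e.valid_gates (fun j => by have := j.2; omega) (by omega) (fun j => by omega)
      (by omega) g hg
  · obtain rfl := List.mem_singleton.1 hg
    simp only [RawGate.Classical, RawGate.Valid]
    omega

theorem gadgetGates_valid {L : ℕ} (hL : 0 < L) {l : ℕ → List RawGate}
    (hl : ∀ j, ∀ g ∈ l j, g.Below L) :
    ∀ g ∈ gadgetGates k e l, g.Valid (7 + e.width + 2 * k * L) := by
  have hM : 7 + e.width + 2 * k ≤ 7 + e.width + 2 * k * L := by
    have := Nat.le_mul_of_pos_right (2 * k) hL; omega
  intro g hg
  simp only [gadgetGates, List.mem_append] at hg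
  rcases hg with hg | hg | hg | hg
  · simp only [prepGates, notGates, List.mem_append, List.mem_cons, List.not_mem_nil,
      or_false] at hg
    rcases hg with (rfl | rfl | rfl | rfl) | (rfl | rfl | rfl | rfl) <;>
      simp only [RawGate.Valid] <;> omega
  · exact valid_blockGates (by omega) le_rfl hL hl g hg
  · refine valid_blockGates (by omega) le_rfl hL (fun j g hg => ?_) g hg
    have := (basisGates_valid _ g hg).below
    cases g with
    | hadamard a => exact lt_of_lt_of_le this hL
    | phase a => exact lt_of_lt_of_le this hL
    | toffoli a b c =>
      exact ⟨lt_of_lt_of_le this.1 hL, lt_of_lt_of_le this.2.1 hL, lt_of_lt_of_le this.2.2 hL⟩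
  · exact (post_valid e hM g (List.mem_append.2 hg)).2

/-- The blocks are in a product state, so their measured heads are independent bits, and the
classical part writes the value of `e` on these bits to qubit 0. -/
theorem reduced_gadget (hk : 0 < k) {n L : ℕ} (hn : 0 < n) (hL : n ≤ L)
    {l : ℕ → List RawGate} (hl : ∀ j, ∀ g ∈ l j, g.Valid n) :
    reduced (7 + e.width + 2 * k * L) (run (gadgetGates k e l) zeroState) =
      Matrix.diagonal fun c => ((∑ h, (if e.eval h = c then 1 else 0) * ∏ j : Fin (2 * k),
        basisProb (reduced n (run (l j) zeroState)) ((j : ℕ) / 2) (h j) : ℝ) : ℂ) := by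
  have hA : 6 ≤ 7 + e.width := by omega
  have hL' : 0 < L := by omega
  have hM : 7 + e.width + 2 * k ≤ 7 + e.width + 2 * k * L := by
    have := Nat.le_mul_of_pos_right (2 * k) hL'; omega
  have hpost := post_valid e hM
  rw [gadgetGates, run_append, run_append, run_append, run_prepGates (N := 2 * k) hA (by omega),
    run_blockGates hA le_rfl _ hl,
    run_blockGates hA le_rfl _ fun j => basisGates_valid (j / 2)]
  -- `φ j` is the state of block `j` after the simulation and the basis change.
  generalize hφ' : (fun j => if j < 2 * k then run (basisGates (j / 2))
    (if j < 2 * k then run (l j) zeroState else zeroState) else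
      if j < 2 * k then run (l j) zeroState else zeroState) = φ
  have hφ : ∀ j : Fin (2 * k), φ j = run (basisGates ((j : ℕ) / 2)) (run (l j) zeroState) :=
    fun j => by simp [← hφ']
  rw [reduced_run_classical (by omega) (fun g hg => (hpost g hg).1) (fun g hg => (hpost g hg).2)
    _ (fun y => e.eval (heads (7 + e.width) (2 * k) y))]
  · congr 1
    funext c
    rw [sum_blockState (by omega) φ (fun h => if e.eval h = c then 1 else 0)]
    congr 2
    funext h
    congr 2
    funext j
    have := bitProb_eq hL' (φ j) (h j)
    rw [hφ, reduced_basisGates, reduced_eq_of_le hn hL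
      (run_eq_zero (hl j) (zeroState_eq_zero n)), ← hφ] at this
    rw [basisProb, ← this, Complex.ofReal_re]
  · intro y b
    congr 1
    funext j
    exact update_of_ne (by omega) _ _
  · intro y hy
    have anc : ∀ i < 7 + e.width, y i = ancillas i := by
      by_contra h
      simp [blockState, h] at hy
    have zero : ∀ i, 3 ≤ i ∨ i = 0 → i < 7 + e.width → y i = 0 := fun i hi hi' => by
      have h1 : ¬ (i = 1 ∨ i = 2) := by omega
      rw [anc i hi', ancillas, if_neg h1]
    obtain ⟨h1, h2⟩ := e.forward_gates (loc := fun j => 7 + e.width + j) (c := 6) (by omega)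
      (fun j => by omega) (y := y) (by rw [anc 1 (by omega)]; rfl) (by rw [anc 2 (by omega)]; rfl)
      (fun i hi hi' => zero i (by omega) (by omega))
    simp only [forward_append, forward, RawGate.step, flipBit]
    constructor
    · rw [update_self, h1, h2 0 (by omega), h2 1 (by omega), zero 0 (by omega) (by omega),
        anc 1 (by omega)]
      simp [ancillas]
      rfl
    · congr 1
      funext j
      simp only [heads]
      rw [update_of_ne (by omega), h2 _ (by omega)]

/-- The tasks that describe the gadget. -/
def gadgetTasks (k : ℕ) (e : BoolExpr (2 * k)) : List Task :=
  [.count (2 * k) (7 + e.width + 2 * k), .word (encodeAll prepGates)] ++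
    ((List.range k).map fun p =>
      .circuits (2 * k) (7 + e.width + 2 * p) (7 + e.width + (2 * p + 1))) ++
    [.word (encodeAll (blockGates (7 + e.width) (2 * k) (2 * k) (fun j => basisGates (j / 2)) ++
      (e.gates (fun j => 7 + e.width + j) 6 ++ [.toffoli 1 (6 + e.width) 0])) ++ [false])]

theorem eval_gadgetTasks (w : List Bool) :
    (gadgetTasks k e).flatMap (Task.eval w) =
      unaryCode (7 + e.width + 2 * k * (w.length + 1)) ++ (encodeAll (gadgetGates k e fun j =>
        if j % 2 = 0 then firstGates w else secondGates w) ++ [false]) := by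
  -- One pass over the input reads both circuits and therefore fills two consecutive blocks, an even
  -- and an odd one.
  have key : ∀ p, ((List.range p).map fun p => Task.circuits (2 * k) (7 + e.width + 2 * p)
        (7 + e.width + (2 * p + 1))).flatMap (Task.eval w) =
      encodeAll (blockGates (7 + e.width) (2 * k) (2 * p) fun j =>
        if j % 2 = 0 then firstGates w else secondGates w) := by
    intro p
    induction p with
    | zero => rfl
    | succ p ih =>
      have h : (2 * p + 1) % 2 = 1 := by omega
      rw [List.range_succ, List.map_append, List.flatMap_append, ih, blockGates, blockGates,
        mul_add, mul_one, List.range_succ, List.range_succ]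
      simp [encodeAll_append, Task.eval, h]
  have hM : 7 + e.width + 2 * k * (w.length + 1) =
      7 + e.width + 2 * k + w.length * (2 * k) := by ring
  rw [gadgetTasks, List.flatMap_append, List.flatMap_append, key, gadgetGates, hM]
  simp [Task.eval, encodeAll_append]

/-- For each Boolean function `F` there is a polynomial-time map from pairs of descriptions of
circuits to circuits that measure `k` copies of the two output states, cyclically in the three Pauli
bases, and output the value of `F` on the outcomes. -/
theorem exists_gadget (hk : 0 < k) (F : (Fin (2 * k) → Fin 2) → Fin 2) :
    ∃ G G' : List Bool → List Bool, PolyTime G ∧ PolyTime G' ∧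
      ∀ w, ∃ (m : ℕ) (Q : Circuit (m + 1)), G w = Circuit.encode Q ∧
        G' w = Circuit.encode Q ++ Circuit.encode ([] : Circuit (m + 1)) ∧
        ∀ (m₀ : ℕ) (Q₀ Q₁ : Circuit (m₀ + 1)), firstGates w = Q₀.map Gate.raw →
          secondGates w = Q₁.map Gate.raw → m₀ ≤ w.length →
          Circuit.outputState Q = Matrix.diagonal fun c =>
            ((∑ h, (if F h = c then 1 else 0) * ∏ j : Fin (2 * k),
              basisProb (Circuit.outputState (if (j : ℕ) % 2 = 0 then Q₀ else Q₁)) ((j : ℕ) / 2)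
                (h j) : ℝ) : ℂ) := by
  obtain ⟨e, he⟩ := BoolExpr.exists_eval F
  -- The second map appends the number of qubits once more and the end marker: the empty circuit on
  -- the same register.
  refine ⟨_, _, polyTime_tasks (gadgetTasks k e), polyTime_tasks (gadgetTasks k e ++
    [.count (2 * k) (7 + e.width + 2 * k), .word [false]]), fun w => ?_⟩
  have hM : 7 + e.width + 2 * k + w.length * (2 * k) =
      7 + e.width + 2 * k * (w.length + 1) := by ring
  set l : ℕ → List RawGate := fun j => if j % 2 = 0 then firstGates w else secondGates w with hl
  have below : ∀ j, ∀ g ∈ l j, g.Below (w.length + 1) := by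
    intro j
    simp only [hl]
    split_ifs
    · exact firstGates_below w
    · exact secondGates_below w
  have valid := gadgetGates_valid e (Nat.succ_pos _) below
  obtain ⟨m, hm⟩ : ∃ m, 7 + e.width + 2 * k * (w.length + 1) = m + 1 :=
    ⟨6 + e.width + 2 * k * (w.length + 1), by omega⟩
  rw [hm] at valid
  obtain ⟨Q, hQ⟩ := exists_circuit _ valid
  have hG : (gadgetTasks k e).flatMap (Task.eval w) = Circuit.encode Q := by
    rw [eval_gadgetTasks, Circuit.encode_eq, hQ, hm]
  refine ⟨m, Q, hG, ?_, fun m₀ Q₀ Q₁ h₀ h₁ hle => ?_⟩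
  · rw [List.flatMap_append, hG]
    congr 1
    simp [Task.eval, hM, hm, Circuit.encode, encodeGates]
  · have hl' : ∀ j, l j = (if j % 2 = 0 then Q₀ else Q₁).map Gate.raw := by
      intro j
      simp only [hl]
      split_ifs <;> assumption
    have hv : ∀ j, ∀ g ∈ l j, g.Valid (m₀ + 1) := by
      intro j g hg
      rw [hl'] at hg
      obtain ⟨g', -, rfl⟩ := List.mem_map.1 hg
      exact g'.raw_valid
    rw [Circuit.outputState_eq, hQ, ← hm, reduced_gadget e hk (Nat.succ_pos _) (by omega) hv]
    simp only [he, hl', Circuit.outputState_eq]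

/-! ## Bloch vectors and the trace norm -/

/-- The expectations of the three Pauli matrices. -/
def bloch (X : Matrix (Fin 2) (Fin 2) ℂ) : EuclideanSpace ℝ (Fin 3) :=
  WithLp.toLp 2 fun t => basisProb X t 0 - basisProb X t 1

theorem bloch_zero (X : Matrix (Fin 2) (Fin 2) ℂ) : bloch X 0 = (X 0 0).re - (X 1 1).re := by
  simp [bloch, basisProb, basisMatrix]

theorem bloch_one (X : Matrix (Fin 2) (Fin 2) ℂ) : bloch X 1 = (X 0 1).re + (X 1 0).re := by
  have h := inv_sqrt_two_sq
  have e : ((hadamardMatrix * X * hadamardMatrixᴴ) 0 0 -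
      (hadamardMatrix * X * hadamardMatrixᴴ) 1 1) = X 0 1 + X 1 0 := by
    simp only [Matrix.mul_apply, Fin.sum_univ_two, Matrix.conjTranspose_apply]
    simp [hadamardMatrix, Complex.conj_ofReal, -Complex.ofReal_inv]
    linear_combination 2 * (X 0 1 + X 1 0) * h
  have := congrArg Complex.re e
  simpa [bloch, basisProb, basisMatrix] using this

/-- The phase gate followed by the Hadamard gate measures `-σ_y`; the sign does not affect the norm
of the Bloch vector. -/
theorem bloch_two (X : Matrix (Fin 2) (Fin 2) ℂ) : bloch X 2 = (X 0 1).im - (X 1 0).im := by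
  have h := inv_sqrt_two_sq
  have e : ((hadamardMatrix * phaseMatrix * X * (hadamardMatrix * phaseMatrix)ᴴ) 0 0 -
      (hadamardMatrix * phaseMatrix * X * (hadamardMatrix * phaseMatrix)ᴴ) 1 1) =
        -Complex.I * X 0 1 + Complex.I * X 1 0 := by
    simp only [Matrix.mul_apply, Fin.sum_univ_two, Matrix.conjTranspose_apply]
    simp [hadamardMatrix, phaseMatrix, Complex.conj_ofReal, -Complex.ofReal_inv]
    linear_combination 2 * (-Complex.I * X 0 1 + Complex.I * X 1 0) * h
  have := congrArg Complex.re e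
  simp only [Complex.sub_re, Complex.add_re, Complex.mul_re, Complex.neg_re, Complex.I_re,
    Complex.neg_im, Complex.I_im] at this
  simp only [bloch, basisProb, basisMatrix]
  simp only [Fin.isValue, Fin.val_two, Nat.reduceMod, OfNat.ofNat_ne_zero, if_false,
    OfNat.ofNat_ne_one]
  rw [this]
  ring

theorem bloch_sub (X Y : Matrix (Fin 2) (Fin 2) ℂ) : bloch (X - Y) = bloch X - bloch Y := by
  ext t
  fin_cases t
  · simp [bloch_zero]; ring
  · simp [bloch_one]; ring
  · simp [bloch_two]; ring

theorem eigenvalues_smul_one {n : Type} [Fintype n] [DecidableEq n] {A : Matrix n n ℂ}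
    (hA : A.IsHermitian) {c : ℝ} (h : A = (c : ℂ) • 1) (i : n) : hA.eigenvalues i = c := by
  have h1 := hA.mulVec_eigenvectorBasis i
  have h2 : ∀ v, A *ᵥ v = (c : ℂ) • v := fun v => by
    rw [h, Matrix.smul_mulVec, Matrix.one_mulVec]
  rw [h2] at h1
  have hne : (⇑(hA.eigenvectorBasis i) : n → ℂ) ≠ 0 := fun h0 =>
    hA.eigenvectorBasis.toBasis.ne_zero i (by ext j; simpa using congrFun h0 j)
  obtain ⟨j, hj⟩ := Function.ne_iff.1 hne
  have := congrFun h1 j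
  simp only [Pi.smul_apply, smul_eq_mul, Complex.real_smul] at this
  exact_mod_cast (mul_right_cancel₀ hj this).symm

/-- The square of a traceless Hermitian matrix of size 2 is a scalar, so both singular values are
equal. -/
theorem traceNorm_eq {X : Matrix (Fin 2) (Fin 2) ℂ} (hX : Xᴴ = X) (hX' : X 0 0 + X 1 1 = 0) :
    traceNorm X = 2 * √(‖X 0 0‖ ^ 2 + ‖X 0 1‖ ^ 2) := by
  have h11 : X 1 1 = -X 0 0 := by linear_combination hX'
  have h10 : X 1 0 = star (X 0 1) := by
    conv_lhs => rw [← hX]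
    rfl
  have h00 : star (X 0 0) = X 0 0 := by
    conv_rhs => rw [← hX]
    rfl
  have key : Xᴴ * X = ((‖X 0 0‖ ^ 2 + ‖X 0 1‖ ^ 2 : ℝ) : ℂ) • 1 := by
    have n0 : X 0 0 * X 0 0 = ((‖X 0 0‖ ^ 2 : ℝ) : ℂ) := by
      rw [← Complex.normSq_eq_norm_sq, ← Complex.mul_conj,
        show (starRingEnd ℂ) (X 0 0) = X 0 0 from h00]
    have n1 : X 0 1 * star (X 0 1) = ((‖X 0 1‖ ^ 2 : ℝ) : ℂ) := by
      rw [← Complex.normSq_eq_norm_sq, ← Complex.mul_conj, Complex.star_def]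
    rw [hX, Complex.ofReal_add, ← n0, ← n1]
    ext i j
    fin_cases i <;> fin_cases j <;>
      simp [Matrix.mul_apply, Fin.sum_univ_two, h11, h10] <;> ring
  rw [traceNorm, Fin.sum_univ_two, eigenvalues_smul_one _ key, eigenvalues_smul_one _ key]
  ring

theorem traceNorm_eq_norm_bloch {X : Matrix (Fin 2) (Fin 2) ℂ} (hX : Xᴴ = X)
    (hX' : X 0 0 + X 1 1 = 0) : traceNorm X = ‖bloch X‖ := by
  have h11 : X 1 1 = -X 0 0 := by linear_combination hX'
  have h10 : X 1 0 = star (X 0 1) := by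
    conv_lhs => rw [← hX]
    rfl
  have h00 : (X 0 0).im = 0 := by
    have : star (X 0 0) = X 0 0 := by
      conv_rhs => rw [← hX]
      rfl
    exact Complex.conj_eq_iff_im.1 this
  rw [traceNorm_eq hX hX', EuclideanSpace.norm_eq, Fin.sum_univ_three, bloch_zero, bloch_one,
    bloch_two, h11, h10, ← Complex.normSq_eq_norm_sq, ← Complex.normSq_eq_norm_sq,
    Complex.normSq_apply, Complex.normSq_apply, h00]
  have h4 : (2 : ℝ) = √4 := by
    rw [show (4 : ℝ) = 2 ^ 2 by norm_num, Real.sqrt_sq (by norm_num)]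
  rw [h4, ← Real.sqrt_mul (by norm_num)]
  congr 1
  simp only [Real.norm_eq_abs, sq_abs, Complex.neg_re, Complex.star_def, Complex.conj_re,
    Complex.conj_im]
  ring

/-! ### Bloch vectors and outcome probabilities of output states. -/

namespace Circuit

variable {m : ℕ} (Q : Circuit (m + 1))

theorem outputState_isHermitian : (outputState Q)ᴴ = outputState Q := by
  rw [outputState_eq]
  exact reduced_isHermitian _ _

theorem trace_outputState : outputState Q 0 0 + outputState Q 1 1 = 1 := by
  rw [outputState_eq, trace_reduced (Nat.succ_pos _), weight_run, weight_zeroState]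
  intro g hg
  obtain ⟨g', -, rfl⟩ := List.mem_map.1 hg
  exact g'.raw_valid

theorem basisProb_outputState (t : ℕ) (c : Fin 2) : basisProb (outputState Q) t c =
    bitProb (m + 1) (run (basisGates t) (run (Q.map Gate.raw) zeroState)) c := by
  have := bitProb_eq (Nat.succ_pos m)
    (run (basisGates t) (run (Q.map Gate.raw) zeroState)) c
  rw [reduced_basisGates, ← outputState_eq] at this
  rw [basisProb, ← this, Complex.ofReal_re]

theorem basisProb_nonneg (t : ℕ) (c : Fin 2) : 0 ≤ basisProb (outputState Q) t c := by
  rw [basisProb_outputState]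
  exact bitProb_nonneg _ _ _

theorem sum_basisProb (t : ℕ) :
    basisProb (outputState Q) t 0 + basisProb (outputState Q) t 1 = 1 := by
  rw [basisProb_outputState, basisProb_outputState, ← Complex.ofReal_inj, Complex.ofReal_add,
    bitProb_eq (Nat.succ_pos m), bitProb_eq (Nat.succ_pos m), trace_reduced (Nat.succ_pos _),
    weight_run, weight_run, weight_zeroState, Complex.ofReal_one]
  · intro g hg
    obtain ⟨g', -, rfl⟩ := List.mem_map.1 hg
    exact g'.raw_valid
  · intro g hg
    have := basisGates_valid t g hg
    cases g with
    | hadamard a => exact lt_of_lt_of_le this (by omega)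
    | phase a => exact lt_of_lt_of_le this (by omega)
    | toffoli a b c =>
      obtain ⟨h1, h2, h3, h4, h5, h6⟩ := this
      exact ⟨by omega, by omega, by omega, h4, h5, h6⟩

theorem bloch_outputState_zero : bloch (outputState Q) 0 = 1 - 2 * acceptProb Q := by
  have h := congrArg Complex.re (trace_outputState Q)
  rw [Complex.add_re, Complex.one_re] at h
  rw [bloch_zero, acceptProb_eq]
  linarith

theorem traceNorm_sub {m' : ℕ} (Q' : Circuit (m' + 1)) :
    traceNorm (outputState Q - outputState Q') =
      ‖bloch (outputState Q) - bloch (outputState Q')‖ := by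
  rw [← bloch_sub]
  refine traceNorm_eq_norm_bloch ?_ ?_
  · rw [Matrix.conjTranspose_sub, outputState_isHermitian, outputState_isHermitian]
  · rw [Matrix.sub_apply, Matrix.sub_apply]
    linear_combination trace_outputState Q - trace_outputState Q'

theorem traceNorm_sub_half :
    traceNorm (outputState Q - (1 / 2 : ℂ) • (1 : Matrix (Fin 2) (Fin 2) ℂ)) =
      ‖bloch (outputState Q)‖ := by
  have h0 : bloch ((1 / 2 : ℂ) • (1 : Matrix (Fin 2) (Fin 2) ℂ)) = 0 := by
    ext t
    fin_cases t
    · simp [bloch_zero]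
    · simp [bloch_one]
    · simp [bloch_two]
  rw [← sub_zero (bloch (outputState Q)), ← h0, ← bloch_sub]
  refine traceNorm_eq_norm_bloch ?_ ?_
  · rw [Matrix.conjTranspose_sub, outputState_isHermitian, Matrix.conjTranspose_smul,
      Matrix.conjTranspose_one]
    simp
  · simp only [Matrix.sub_apply, Matrix.smul_apply, Matrix.one_apply_eq, smul_eq_mul]
    linear_combination trace_outputState Q

end Circuit

/-- Entries with an index 1 involve an amplitude of the zero state at a string with a one; the
remaining entry is the trace. -/
theorem outputState_nil (m : ℕ) :
    Circuit.outputState ([] : Circuit (m + 1)) = !![1, 0; 0, 0] := by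
  have h1 : ∀ y : Bits, zeroState (update y 0 1) = 0 := by
    intro y
    refine if_neg fun h => ?_
    have := congrFun h 0
    simp at this
  have e : ∀ b b' : Fin 2, b = 1 ∨ b' = 1 →
      Circuit.outputState ([] : Circuit (m + 1)) b b' = 0 := by
    intro b b' h
    rw [Circuit.outputState_eq, reduced_apply]
    refine Finset.sum_eq_zero fun y _ => ?_
    rcases h with rfl | rfl
    · simp [run, h1]
    · simp [run, h1]
  have h := Circuit.trace_outputState ([] : Circuit (m + 1))
  rw [e 1 1 (Or.inl rfl), add_zero] at h
  ext b b'
  fin_cases b <;> fin_cases b'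
  · simpa using h
  · simpa using e 0 1 (Or.inr rfl)
  · simpa using e 1 0 (Or.inl rfl)
  · simpa using e 1 1 (Or.inl rfl)

/-! ## Estimating Bloch vectors -/

section Statistics

variable {N : ℕ} {p : Fin N → Fin 2 → ℝ}

/-- The expectation of a product of functions of independent outcomes is the product of the
expectations. Marginals, covariances and variances below are instances. -/
theorem sum_prod_mul (g : Fin N → Fin 2 → ℝ) :
    ∑ h : Fin N → Fin 2, (∏ j, g j (h j)) * ∏ j, p j (h j) = ∏ j, ∑ c, g j c * p j c := by
  rw [Finset.prod_univ_sum, Fintype.piFinset_univ]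
  simp only [Finset.prod_mul_distrib]

theorem sum_prod (hs : ∀ j, p j 0 + p j 1 = 1) :
    ∑ h : Fin N → Fin 2, ∏ j, p j (h j) = 1 := by
  have := sum_prod_mul (p := p) fun _ _ => 1
  simpa [hs] using this

theorem sum_ite_apply (hs : ∀ j, p j 0 + p j 1 = 1) (i : Fin N) (c : Fin 2) :
    ∑ h : Fin N → Fin 2, (if h i = c then 1 else 0) * ∏ j, p j (h j) = p i c := by
  have h1 := sum_prod_mul (p := p) fun j d => if j = i then (if d = c then 1 else 0) else 1
  simp only [Finset.prod_ite_eq', Finset.mem_univ, if_true] at h1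
  rw [h1, Finset.prod_eq_single i]
  · simp
  · intro j _ hj
    simp [hj, hs]
  · simp

/-- The outcomes `0` and `1` as signs. -/
def sign (c : Fin 2) : ℝ := if c = 0 then 1 else -1

theorem sum_sign_sub (i : Fin N) (hs : p i 0 + p i 1 = 1) :
    ∑ c, (sign c - (p i 0 - p i 1)) * p i c = 0 := by
  simp only [Fin.sum_univ_two, sign, if_true, one_ne_zero, if_false]
  linear_combination (p i 1 - p i 0) * hs

theorem covariance (hs : ∀ j, p j 0 + p j 1 = 1) {i j : Fin N} (hij : i ≠ j) :
    ∑ h : Fin N → Fin 2, ((sign (h i) - (p i 0 - p i 1)) * (sign (h j) - (p j 0 - p j 1))) *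
      ∏ l, p l (h l) = 0 := by
  have h1 := sum_prod_mul (p := p) fun l d =>
    (if l = i then sign d - (p i 0 - p i 1) else 1) *
      (if l = j then sign d - (p j 0 - p j 1) else 1)
  simp only [Finset.prod_mul_distrib, Finset.prod_ite_eq', Finset.mem_univ, if_true] at h1
  rw [h1]
  refine Finset.prod_eq_zero (Finset.mem_univ i) ?_
  simp [hij, sum_sign_sub i (hs i)]

theorem variance (hp : ∀ j c, 0 ≤ p j c) (hs : ∀ j, p j 0 + p j 1 = 1) (i : Fin N) :
    ∑ h : Fin N → Fin 2, ((sign (h i) - (p i 0 - p i 1)) * (sign (h i) - (p i 0 - p i 1))) *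
      ∏ l, p l (h l) ≤ 1 := by
  have h1 := sum_prod_mul (p := p) fun l d =>
    (if l = i then (sign d - (p i 0 - p i 1)) * (sign d - (p i 0 - p i 1)) else 1)
  simp only [Finset.prod_ite_eq', Finset.mem_univ, if_true] at h1
  rw [h1, Finset.prod_eq_single i]
  · simp only [Fin.sum_univ_two, sign, if_true, one_ne_zero, if_false]
    have h0 := hp i 0
    have h1 := hs i
    obtain ⟨q, hq⟩ : ∃ q, q = p i 1 := ⟨_, rfl⟩
    have : p i 0 = 1 - q := by linarith
    rw [this, ← hq]
    -- The variance of a sign with probabilities `1 - q` and `q` is `1 - (1 - 2q)²`.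
    nlinarith [sq_nonneg (1 - 2 * q)]
  · intro j _ hj
    simp [hj, hs]
  · simp

/-- Covariances of different outcomes vanish, so only the diagonal terms remain, and each variance
is at most 1. -/
theorem sum_sq_le (hp : ∀ j c, 0 ≤ p j c) (hs : ∀ j, p j 0 + p j 1 = 1) (w : Fin N → ℝ) :
    ∑ h : Fin N → Fin 2, (∑ j, w j * (sign (h j) - (p j 0 - p j 1))) ^ 2 * ∏ l, p l (h l) ≤
      ∑ j, w j ^ 2 := by
  have e : ∑ h : Fin N → Fin 2, (∑ j, w j * (sign (h j) - (p j 0 - p j 1))) ^ 2 *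
      ∏ l, p l (h l) = ∑ i, ∑ j, w i * w j * ∑ h : Fin N → Fin 2,
        ((sign (h i) - (p i 0 - p i 1)) * (sign (h j) - (p j 0 - p j 1))) * ∏ l, p l (h l) := by
    simp only [sq, Finset.mul_sum, Finset.sum_mul]
    rw [Finset.sum_comm]
    refine Finset.sum_congr rfl fun i _ => ?_
    rw [Finset.sum_comm]
    refine Finset.sum_congr rfl fun j _ => Finset.sum_congr rfl fun h _ => ?_
    ring
  rw [e]
  refine Finset.sum_le_sum fun i _ => ?_
  rw [Finset.sum_eq_single i]
  · rw [← sq]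
    exact mul_le_of_le_one_right (sq_nonneg _) (variance hp hs i)
  · intro j _ hj
    rw [covariance hs hj.symm, mul_zero]
  · simp

end Statistics

/-- The fraction of the blocks that measure the source `s` in the basis `t`. -/
def weights (K : ℕ) (s t : ℕ) (j : ℕ) : ℝ := if j % 2 = s ∧ j / 2 % 3 = t then (K : ℝ)⁻¹ else 0

/-- Among six consecutive blocks each combination of a source and a basis occurs once, so among `6K`
blocks it occurs `K` times. -/
theorem sum_indicator (K : ℕ) (s : Fin 2) (t : Fin 3) (a : ℝ) :
    ∑ j : Fin (2 * (3 * K)), (if (j : ℕ) % 2 = s ∧ (j : ℕ) / 2 % 3 = t then a else 0) = K * a := by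
  rw [← Finset.sum_range fun j => if j % 2 = (s : ℕ) ∧ j / 2 % 3 = (t : ℕ) then a else 0]
  induction K with
  | zero => simp
  | succ K ih =>
    have e : 2 * (3 * (K + 1)) = 2 * (3 * K) + 1 + 1 + 1 + 1 + 1 + 1 := by ring
    rw [e]
    simp only [Finset.sum_range_succ, ih]
    have m0 : 2 * (3 * K) % 2 = 0 ∧ 2 * (3 * K) / 2 % 3 = 0 := by omega
    have m1 : (2 * (3 * K) + 1) % 2 = 1 ∧ (2 * (3 * K) + 1) / 2 % 3 = 0 := by omega
    have m2 : (2 * (3 * K) + 1 + 1) % 2 = 0 ∧ (2 * (3 * K) + 1 + 1) / 2 % 3 = 1 := by omega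
    have m3 : (2 * (3 * K) + 1 + 1 + 1) % 2 = 1 ∧ (2 * (3 * K) + 1 + 1 + 1) / 2 % 3 = 1 := by
      omega
    have m4 : (2 * (3 * K) + 1 + 1 + 1 + 1) % 2 = 0 ∧
        (2 * (3 * K) + 1 + 1 + 1 + 1) / 2 % 3 = 2 := by omega
    have m5 : (2 * (3 * K) + 1 + 1 + 1 + 1 + 1) % 2 = 1 ∧
        (2 * (3 * K) + 1 + 1 + 1 + 1 + 1) / 2 % 3 = 2 := by omega
    simp only [m0, m1, m2, m3, m4, m5]
    push_cast
    fin_cases s <;> fin_cases t <;> simp <;> ring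

/-- The estimate of the Bloch vector of the source `s`. -/
def estimate (K : ℕ) (s : Fin 2) (h : Fin (2 * (3 * K)) → Fin 2) : EuclideanSpace ℝ (Fin 3) :=
  WithLp.toLp 2 fun t => ∑ j : Fin (2 * (3 * K)), weights K s t j * sign (h j)

/-- Chebyshev's inequality: each of the six estimated coordinates has variance at most `1/K`. The
number `K` depends only on `δ` and `ε`, so one gadget serves all inputs. -/
theorem exists_estimate {δ ε : ℝ} (hδ : 0 < δ) (hε : 0 < ε) : ∃ K : ℕ, 0 < K ∧
    ∀ p : Fin (2 * (3 * K)) → Fin 2 → ℝ, (∀ j c, 0 ≤ p j c) → (∀ j, p j 0 + p j 1 = 1) →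
      ∀ r : Fin 2 → EuclideanSpace ℝ (Fin 3),
      (∀ (j : Fin (2 * (3 * K))) (s : Fin 2) (t : Fin 3), (j : ℕ) % 2 = s → (j : ℕ) / 2 % 3 = t →
        p j 0 - p j 1 = r s t) →
      ∀ B : Finset (Fin (2 * (3 * K)) → Fin 2),
        (∀ h, (∀ s, ‖estimate K s h - r s‖ < δ) → h ∉ B) → ∑ h ∈ B, ∏ j, p j (h j) ≤ ε := by
  -- This choice gives `6/K ≤ δ² ε`, where `6/K` bounds the expected total squared error.
  obtain ⟨K, hK⟩ := exists_nat_gt (6 / (δ ^ 2 * ε))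
  have hK0 : (0 : ℝ) < K := lt_of_le_of_lt (by positivity) hK
  refine ⟨K, by exact_mod_cast hK0, fun p hp hs r hr B hB => ?_⟩
  have hP : ∀ h : Fin (2 * (3 * K)) → Fin 2, 0 ≤ ∏ j, p j (h j) := fun h =>
    Finset.prod_nonneg fun j _ => hp _ _
  have dev : ∀ s t h, estimate K s h t - r s t =
      ∑ j : Fin (2 * (3 * K)), weights K s t j * (sign (h j) - (p j 0 - p j 1)) := by
    intro s t h
    have e : ∑ j : Fin (2 * (3 * K)), weights K s t j * (p j 0 - p j 1) = r s t := by
      have : ∀ j : Fin (2 * (3 * K)), weights K s t j * (p j 0 - p j 1) =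
          if (j : ℕ) % 2 = s ∧ (j : ℕ) / 2 % 3 = t then (K : ℝ)⁻¹ * r s t else 0 := by
        intro j
        unfold weights
        split_ifs with hj
        · rw [hr j s t hj.1 hj.2]
        · rw [zero_mul]
      rw [Finset.sum_congr rfl fun j _ => this j, sum_indicator, mul_inv_cancel_left₀ hK0.ne']
    simp only [mul_sub, Finset.sum_sub_distrib] at e ⊢
    rw [e]
    rfl
  have var : ∀ (s : Fin 2) (t : Fin 3), ∑ h : Fin (2 * (3 * K)) → Fin 2,
      (estimate K s h t - r s t) ^ 2 * ∏ j, p j (h j) ≤ (K : ℝ)⁻¹ := by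
    intro s t
    simp only [dev]
    refine (sum_sq_le hp hs _).trans (le_of_eq ?_)
    have : ∀ j : Fin (2 * (3 * K)), weights K s t j ^ 2 =
        if (j : ℕ) % 2 = s ∧ (j : ℕ) / 2 % 3 = t then (K : ℝ)⁻¹ ^ 2 else 0 := by
      intro j
      unfold weights
      split_ifs <;> simp
    rw [Finset.sum_congr rfl fun j _ => this j, sum_indicator, sq,
      mul_inv_cancel_left₀ hK0.ne']
  have total : ∑ h : Fin (2 * (3 * K)) → Fin 2,
      (∑ s, ‖estimate K s h - r s‖ ^ 2) * ∏ j, p j (h j) ≤ 6 * (K : ℝ)⁻¹ := by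
    simp only [EuclideanSpace.norm_sq_eq, Fin.sum_univ_two, Fin.sum_univ_three, Real.norm_eq_abs,
      sq_abs, PiLp.sub_apply, add_mul, Finset.sum_add_distrib]
    have := var 0 0
    have := var 0 1
    have := var 0 2
    have := var 1 0
    have := var 1 1
    have := var 1 2
    linarith
  -- Markov's inequality: on `B` the total squared error is at least `δ²`.
  have markov : δ ^ 2 * ∑ h ∈ B, ∏ j, p j (h j) ≤ 6 * (K : ℝ)⁻¹ := by
    refine le_trans ?_ total
    rw [Finset.mul_sum]
    refine (Finset.sum_le_sum fun h hh => ?_).trans (Finset.sum_le_sum_of_subset_of_nonneg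
      (Finset.subset_univ B) fun h _ _ => mul_nonneg (by positivity) (hP h))
    refine mul_le_mul_of_nonneg_right ?_ (hP h)
    by_contra hlt
    refine hB h (fun s => ?_) hh
    have h1 : ‖estimate K s h - r s‖ ^ 2 < δ ^ 2 := by
      refine lt_of_le_of_lt ?_ (not_le.1 hlt)
      exact Finset.single_le_sum (f := fun s => ‖estimate K s h - r s‖ ^ 2)
        (fun _ _ => sq_nonneg _) (Finset.mem_univ s)
    exact lt_of_pow_lt_pow_left₀ 2 hδ.le h1
  have h6 : 6 * (K : ℝ)⁻¹ ≤ δ ^ 2 * ε := by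
    rw [div_lt_iff₀ (by positivity)] at hK
    rw [← div_eq_mul_inv, div_le_iff₀ hK0]
    linarith
  exact le_of_mul_le_mul_left (markov.trans h6) (by positivity)

/-- For each predicate `D` of the Bloch vectors of two output states and a bit, there is a
polynomial-time map to circuits whose output is `1` with about the probability that a bit
satisfies `D`. -/
theorem exists_decider {δ ε : ℝ} (hδ : 0 < δ) (hε : 0 < ε)
    (D : EuclideanSpace ℝ (Fin 3) → EuclideanSpace ℝ (Fin 3) → Fin 2 → Prop) :
    ∃ G G' : List Bool → List Bool, PolyTime G ∧ PolyTime G' ∧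
      ∀ w, ∃ (m : ℕ) (Q : Circuit (m + 1)), G w = Circuit.encode Q ∧
        G' w = Circuit.encode Q ++ Circuit.encode ([] : Circuit (m + 1)) ∧
        ∀ (m₀ : ℕ) (Q₀ Q₁ : Circuit (m₀ + 1)), firstGates w = Q₀.map Gate.raw →
          secondGates w = Q₁.map Gate.raw → m₀ ≤ w.length →
          ∃ q : ℝ, Circuit.outputState Q = !![1 - (q : ℂ), 0; 0, (q : ℂ)] ∧
            ∀ C : Fin 2 → Prop, [DecidablePred C] →
              (∀ a b c, ‖a - bloch (Circuit.outputState Q₀)‖ < δ →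
                ‖b - bloch (Circuit.outputState Q₁)‖ < δ → (D a b c ↔ C c)) →
              |q - ∑ c, if C c then basisProb (Circuit.outputState Q₁) 1 c else 0| ≤ ε := by
  classical
  obtain ⟨K, hK, H⟩ := exists_estimate hδ hε
  -- Block 3 provides the bit: it is odd, so it holds `Q₁`, and `3 / 2 = 1` selects the Hadamard
  -- basis. It also enters the estimate; independence of the two is not needed.
  have h3 : 3 < 2 * (3 * K) := by omega
  let F : (Fin (2 * (3 * K)) → Fin 2) → Fin 2 := fun h =>
    if D (estimate K 0 h) (estimate K 1 h) (h ⟨3, h3⟩) then 1 else 0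
  obtain ⟨G, G', hG, hG', HG⟩ := exists_gadget (by omega : 0 < 3 * K) F
  refine ⟨G, G', hG, hG', fun w => ?_⟩
  obtain ⟨m, Q, h1, h2, hQ⟩ := HG w
  refine ⟨m, Q, h1, h2, fun m₀ Q₀ Q₁ hf hs hm => ?_⟩
  have hQ := hQ m₀ Q₀ Q₁ hf hs hm
  let p : Fin (2 * (3 * K)) → Fin 2 → ℝ := fun j c =>
    basisProb (Circuit.outputState (if (j : ℕ) % 2 = 0 then Q₀ else Q₁)) ((j : ℕ) / 2) c
  have hp : ∀ j c, 0 ≤ p j c := fun j c => Circuit.basisProb_nonneg _ _ _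
  have hps : ∀ j, p j 0 + p j 1 = 1 := fun j => Circuit.sum_basisProb _ _
  have hP : ∀ h : Fin (2 * (3 * K)) → Fin 2, 0 ≤ ∏ j, p j (h j) := fun h =>
    Finset.prod_nonneg fun j _ => hp _ _
  let q : ℝ := ∑ h, (if F h = 1 then 1 else 0) * ∏ j, p j (h j)
  have hq : ∑ h, (if F h = 0 then 1 else 0) * ∏ j, p j (h j) = 1 - q := by
    have e : ∀ h, ((if F h = 0 then 1 else 0) * ∏ j, p j (h j) : ℝ) =
        ∏ j, p j (h j) - (if F h = 1 then 1 else 0) * ∏ j, p j (h j) := by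
      intro h
      rcases Fin.exists_fin_two.1 ⟨F h, rfl⟩ with h' | h' <;> simp [h']
    rw [Finset.sum_congr rfl fun h _ => e h, Finset.sum_sub_distrib, sum_prod hps]
  refine ⟨q, ?_, fun C _ hC => ?_⟩
  · rw [hQ]
    ext c c'
    fin_cases c <;> fin_cases c'
    · have := congrArg (fun x : ℝ => (x : ℂ)) hq
      simpa [p, -Complex.ofReal_sum] using this
    · simp
    · simp
    · simp [q, p]
  · let r : Fin 2 → EuclideanSpace ℝ (Fin 3) := fun s =>
      if s = 0 then bloch (Circuit.outputState Q₀) else bloch (Circuit.outputState Q₁)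
    let good : (Fin (2 * (3 * K)) → Fin 2) → Prop := fun h => ∀ s, ‖estimate K s h - r s‖ < δ
    have hr : ∀ (j : Fin (2 * (3 * K))) (s : Fin 2) (t : Fin 3), (j : ℕ) % 2 = s →
        (j : ℕ) / 2 % 3 = t → p j 0 - p j 1 = r s t := by
      intro j s t hs ht
      have hb : ∀ ρ, basisProb ρ ((j : ℕ) / 2) = basisProb ρ t := by
        intro ρ
        funext c
        simp only [basisProb, basisMatrix, ← ht, Nat.mod_mod]
      simp only [p, hs, hb]
      rcases Fin.exists_fin_two.1 ⟨s, rfl⟩ with rfl | rfl <;> simp [r, bloch]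
    have bad := H p hp hps r hr (Finset.univ.filter fun h => ¬ good h)
      (fun h hh => by simpa [good] using hh)
    have coin : ∑ h : Fin (2 * (3 * K)) → Fin 2, (if C (h ⟨3, h3⟩) then 1 else 0) * ∏ j, p j (h j) =
        ∑ c, if C c then basisProb (Circuit.outputState Q₁) 1 c else 0 := by
      have e : ∀ h : Fin (2 * (3 * K)) → Fin 2,
          ((if C (h ⟨3, h3⟩) then 1 else 0) * ∏ j, p j (h j) : ℝ) =
          ∑ c, (if C c then (if h ⟨3, h3⟩ = c then 1 else 0) * ∏ j, p j (h j) else 0) := by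
        intro h
        rw [Finset.sum_eq_single (h ⟨3, h3⟩)]
        · simp
        · intro c _ hc
          simp [hc.symm]
        · simp
      rw [Finset.sum_congr rfl fun h _ => e h, Finset.sum_comm]
      refine Finset.sum_congr rfl fun c _ => ?_
      split_ifs
      · rw [sum_ite_apply hps]
        simp [p]
      · simp
    -- The events `F h = 1` and `C` can differ only on outcomes with a bad estimate, whose total
    -- probability is at most `ε`.
    rw [← coin, ← Finset.sum_sub_distrib]
    refine (Finset.abs_sum_le_sum_abs _ _).trans (le_trans ?_ bad)
    rw [Finset.sum_filter]
    refine Finset.sum_le_sum fun h _ => ?_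
    rw [← sub_mul, abs_mul, abs_of_nonneg (hP h)]
    by_cases hg : good h
    · have := hC (estimate K 0 h) (estimate K 1 h) (h ⟨3, h3⟩) (by simpa [r] using hg 0)
        (by simpa [r] using hg 1)
      simp [F, this, hg]
    · rw [if_pos hg]
      refine mul_le_of_le_one_left (hP h) ?_
      split_ifs <;> simp

/-! ## Completeness -/

theorem le_length_encode {n : ℕ} (Q : Circuit n) : n ≤ (Circuit.encode Q).length := by
  simp only [Circuit.encode, unaryCode, List.length_append, List.length_replicate]
  omega

theorem acceptProb_of_outputState_eq {m : ℕ} {Q : Circuit (m + 1)} {q : ℝ}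
    (h : Circuit.outputState Q = !![1 - (q : ℂ), 0; 0, (q : ℂ)]) : Circuit.acceptProb Q = q := by
  rw [Circuit.acceptProb_eq, h]
  simp

theorem apply_sub_le_norm (a b : EuclideanSpace ℝ (Fin 3)) (t : Fin 3) :
    |a t - b t| ≤ ‖a - b‖ := by
  simpa using PiLp.norm_apply_le (a - b) t

/-- A threshold test on the Bloch vectors of two described circuits is in BQP. -/
theorem mem_BQP_of_test (A : PromiseProblem) {δ : ℝ} (hδ : 0 < δ)
    (D : EuclideanSpace ℝ (Fin 3) → EuclideanSpace ℝ (Fin 3) → Prop)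
    (hyes : ∀ w ∈ A.yes, ∃ (m : ℕ) (Q₀ Q₁ : Circuit (m + 1)), firstGates w = Q₀.map Gate.raw ∧
      secondGates w = Q₁.map Gate.raw ∧ m ≤ w.length ∧
      ∀ a b, ‖a - bloch (Circuit.outputState Q₀)‖ < δ →
        ‖b - bloch (Circuit.outputState Q₁)‖ < δ → D a b)
    (hno : ∀ w ∈ A.no, ∃ (m : ℕ) (Q₀ Q₁ : Circuit (m + 1)), firstGates w = Q₀.map Gate.raw ∧
      secondGates w = Q₁.map Gate.raw ∧ m ≤ w.length ∧
      ∀ a b, ‖a - bloch (Circuit.outputState Q₀)‖ < δ →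
        ‖b - bloch (Circuit.outputState Q₁)‖ < δ → ¬ D a b) : A ∈ BQP := by
  obtain ⟨G, _, hG, -, H⟩ := exists_decider hδ (by norm_num : (0 : ℝ) < 1 / 3)
    fun a b _ => D a b
  refine ⟨G, hG, fun w => ?_⟩
  obtain ⟨m, Q, hQ, -, HQ⟩ := H w
  refine ⟨m, Q, hQ, fun hw => ?_, fun hw => ?_⟩
  · obtain ⟨m₀, Q₀, Q₁, h0, h1, hm, hD⟩ := hyes w hw
    obtain ⟨q, hq, Hq⟩ := HQ m₀ Q₀ Q₁ h0 h1 hm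
    have := Hq (fun _ => True) fun a b _ ha hb => iff_true_intro (hD a b ha hb)
    simp only [if_true, Fin.sum_univ_two, Circuit.sum_basisProb] at this
    rw [acceptProb_of_outputState_eq hq]
    linarith [(abs_le.1 this).1]
  · obtain ⟨m₀, Q₀, Q₁, h0, h1, hm, hD⟩ := hno w hw
    obtain ⟨q, hq, Hq⟩ := HQ m₀ Q₀ Q₁ h0 h1 hm
    have := Hq (fun _ => False) fun a b _ ha hb => iff_false_intro (hD a b ha hb)
    simp only [if_false, Finset.sum_const_zero, sub_zero] at this
    rw [acceptProb_of_outputState_eq hq]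
    exact (le_abs_self q).trans this

/-- The norm of the estimate is compared with the midpoint of the gap; an error below half the gap
cannot cross it. -/
theorem oneQSCI_mem_BQP {α β : ℝ} (hαβ : α < β) : oneQSCI α β hαβ ∈ BQP := by
  have parse : ∀ {m : ℕ} (Q : Circuit (m + 1)),
      firstGates (Circuit.encode Q) = Q.map Gate.raw ∧
      secondGates (Circuit.encode Q) = ([] : Circuit (m + 1)).map Gate.raw ∧
      m ≤ (Circuit.encode Q).length := fun {m} Q => by
    have h := firstGates_encode Q []
    rw [List.append_nil] at h
    exact ⟨h, secondGates_encode_nil Q, (Nat.le_succ m).trans (le_length_encode Q)⟩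
  refine mem_BQP_of_test _ (δ := (β - α) / 2) (by linarith) (fun a _ => ‖a‖ < (α + β) / 2) ?_ ?_
  · rintro w ⟨m, Q, rfl, hQ⟩
    rw [Circuit.traceNorm_sub_half] at hQ
    refine ⟨m, Q, [], (parse Q).1, (parse Q).2.1, (parse Q).2.2, fun a b ha _ => ?_⟩
    have := norm_sub_norm_le a (bloch (Circuit.outputState Q))
    linarith
  · rintro w ⟨m, Q, rfl, hQ⟩
    rw [Circuit.traceNorm_sub_half] at hQ
    refine ⟨m, Q, [], (parse Q).1, (parse Q).2.1, (parse Q).2.2, fun a b ha _ => not_lt.2 ?_⟩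
    have := norm_sub_norm_le (bloch (Circuit.outputState Q)) a
    rw [norm_sub_rev] at this
    linarith

/-- Two estimates enter the distance, so each may be off by a quarter of the gap. -/
theorem oneQSD_mem_BQP {α β : ℝ} (hαβ : α < β) : oneQSD α β hαβ ∈ BQP := by
  have parse : ∀ {m : ℕ} (Q Q' : Circuit (m + 1)),
      firstGates (Circuit.encode Q ++ Circuit.encode Q') = Q.map Gate.raw ∧
      secondGates (Circuit.encode Q ++ Circuit.encode Q') = Q'.map Gate.raw ∧
      m ≤ (Circuit.encode Q ++ Circuit.encode Q').length := fun {m} Q Q' => by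
    refine ⟨firstGates_encode Q _, secondGates_encode Q Q', ?_⟩
    rw [List.length_append]
    exact (Nat.le_succ m).trans ((le_length_encode Q).trans (Nat.le_add_right _ _))
  have near : ∀ {a b a' b' : EuclideanSpace ℝ (Fin 3)}, ‖a - a'‖ < (β - α) / 4 →
      ‖b - b'‖ < (β - α) / 4 → |‖a - b‖ - ‖a' - b'‖| < (β - α) / 2 := by
    intro a b a' b' ha hb
    refine (abs_norm_sub_norm_le _ _).trans_lt ?_
    rw [sub_sub_sub_comm]
    exact (norm_sub_le _ _).trans_lt (by linarith)
  refine mem_BQP_of_test _ (δ := (β - α) / 4) (by linarith)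
    (fun a b => (α + β) / 2 ≤ ‖a - b‖) ?_ ?_
  · rintro w ⟨m, Q, Q', rfl, hQ⟩
    rw [Circuit.traceNorm_sub] at hQ
    refine ⟨m, Q, Q', (parse Q Q').1, (parse Q Q').2.1, (parse Q Q').2.2, fun a b ha hb => ?_⟩
    linarith [(abs_lt.1 (near ha hb)).1]
  · rintro w ⟨m, Q, Q', rfl, hQ⟩
    rw [Circuit.traceNorm_sub] at hQ
    refine ⟨m, Q, Q', (parse Q Q').1, (parse Q Q').2.1, (parse Q Q').2.2,
      fun a b ha hb => not_le.2 ?_⟩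
    linarith [(abs_lt.1 (near ha hb)).2]

/-- The source of the fair coin: `|0⟩` measured in the Hadamard basis. -/
theorem basisProb_outputState_nil (m : ℕ) :
    basisProb (Circuit.outputState ([] : Circuit (m + 1))) 1 1 = 1 / 2 := by
  have h1 := Circuit.sum_basisProb ([] : Circuit (m + 1)) 1
  have h2 : bloch (Circuit.outputState ([] : Circuit (m + 1))) 1 = 0 := by
    rw [bloch_one, outputState_nil]
    simp
  have h3 : bloch (Circuit.outputState ([] : Circuit (m + 1))) 1 =
      basisProb (Circuit.outputState ([] : Circuit (m + 1))) 1 0 -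
        basisProb (Circuit.outputState ([] : Circuit (m + 1))) 1 1 := rfl
  linarith

/-- Polynomial-time maps that turn rejection into an output near `|0⟩⟨0|` and acceptance into one
near the maximally mixed state, if `mixed`, or else near `|1⟩⟨1|`. -/
theorem exists_amplification {B : PromiseProblem} (hB : B ∈ BQP) {ε : ℝ} (hε : 0 < ε)
    (mixed : Prop) :
    ∃ f f' : List Bool → List Bool, PolyTime f ∧ PolyTime f' ∧
      ∀ x, ∃ (m : ℕ) (Q : Circuit (m + 1)), f x = Circuit.encode Q ∧
        f' x = Circuit.encode Q ++ Circuit.encode ([] : Circuit (m + 1)) ∧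
        ∃ q : ℝ, Circuit.outputState Q = !![1 - (q : ℂ), 0; 0, (q : ℂ)] ∧
          (x ∈ B.yes → (mixed → |q - 1 / 2| ≤ ε) ∧ (¬ mixed → |q - 1| ≤ ε)) ∧
          (x ∈ B.no → |q| ≤ ε) := by
  obtain ⟨g, hg, Hg⟩ := hB
  -- The first Bloch coordinate is `1 - 2p`, at most `-1/3` on yes-instances and at least `1/3` on
  -- no-instances, so accuracy `1/3` determines its sign. In the mixed case acceptance also requires
  -- the coin to show 1.
  obtain ⟨G, G', hG, hG', H⟩ := exists_decider (by norm_num : (0 : ℝ) < 1 / 3) hε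
    fun a _ c => a 0 < 0 ∧ (mixed → c = 1)
  refine ⟨G ∘ g, G' ∘ g, PolyTime.comp hG hg, PolyTime.comp hG' hg, fun x => ?_⟩
  obtain ⟨m₀, Q₀, hx, hyes, hno⟩ := Hg x
  obtain ⟨m, Q, hQ, hQ', HQ⟩ := H (g x)
  have h0 : firstGates (g x) = Q₀.map Gate.raw := by
    rw [hx, ← List.append_nil (Circuit.encode Q₀)]
    exact firstGates_encode Q₀ []
  have h1 : secondGates (g x) = ([] : Circuit (m₀ + 1)).map Gate.raw := by
    rw [hx]
    exact secondGates_encode_nil Q₀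
  obtain ⟨q, hq, Hq⟩ := HQ m₀ Q₀ [] h0 h1
    (by rw [hx]; exact (Nat.le_succ m₀).trans (le_length_encode Q₀))
  have near : ∀ a : EuclideanSpace ℝ (Fin 3), ‖a - bloch (Circuit.outputState Q₀)‖ < 1 / 3 →
      |a 0 - (1 - 2 * Circuit.acceptProb Q₀)| < 1 / 3 := fun a ha => by
    rw [← Circuit.bloch_outputState_zero]
    exact (apply_sub_le_norm _ _ 0).trans_lt ha
  refine ⟨m, Q, hQ, hQ', q, hq, fun hxy => ⟨fun hm => ?_, fun hm => ?_⟩, fun hxn => ?_⟩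
  · have := Hq (fun c => c = 1) fun a b c ha _ => by
      have := (abs_lt.1 (near a ha)).2
      have := hyes hxy
      exact ⟨fun h => h.2 hm, fun h => ⟨by linarith, fun _ => h⟩⟩
    simpa [basisProb_outputState_nil] using this
  · have := Hq (fun _ => True) fun a b c ha _ => by
      have := (abs_lt.1 (near a ha)).2
      have := hyes hxy
      exact iff_true_intro ⟨by linarith, fun h => (hm h).elim⟩
    simpa only [if_true, Fin.sum_univ_two, Circuit.sum_basisProb] using this
  · have := Hq (fun _ => False) fun a b c ha _ => by
      have := (abs_lt.1 (near a ha)).1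
      have := hno hxn
      exact iff_false_intro fun h => by linarith [h.1]
    simpa only [if_false, Finset.sum_const_zero, sub_zero] using this

theorem traceNorm_diagonal (d : ℝ) :
    traceNorm (!![-(d : ℂ), 0; 0, (d : ℂ)]) = 2 * |d| := by
  rw [traceNorm_eq]
  · simp [Real.sqrt_sq_eq_abs]
  · ext i j
    fin_cases i <;> fin_cases j <;> simp
  · simp

theorem reducesTo_oneQSCI {B : PromiseProblem} (hB : B ∈ BQP) {α β : ℝ} (hα : 0 < α)
    (hαβ : α < β) (hβ : β < 1) : B.ReducesTo (oneQSCI α β hαβ) := by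
  -- The error `α/2` gives `2|q - 1/2| ≤ α` on yes-instances, and `(1-β)/2` gives `2|q - 1/2| ≥ β`
  -- on no-instances.
  obtain ⟨f, _, hf, -, H⟩ := exists_amplification hB
    (lt_min (half_pos hα) (half_pos (sub_pos.2 hβ))) True
  have dist : ∀ {m : ℕ} {Q : Circuit (m + 1)} {q : ℝ},
      Circuit.outputState Q = !![1 - (q : ℂ), 0; 0, (q : ℂ)] →
      traceNorm (Circuit.outputState Q - (1 / 2 : ℂ) • (1 : Matrix (Fin 2) (Fin 2) ℂ)) =
        2 * |q - 1 / 2| := by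
    intro m Q q h
    rw [h, ← traceNorm_diagonal]
    congr 1
    ext i j
    fin_cases i <;> fin_cases j <;> simp
    ring
  refine ⟨f, hf, fun x hx => ?_, fun x hx => ?_⟩
  · obtain ⟨m, Q, hQ, -, q, hq, Hq, -⟩ := H x
    refine ⟨m, Q, hQ, ?_⟩
    have := ((Hq hx).1 trivial).trans (min_le_left _ _)
    rw [dist hq]
    linarith
  · obtain ⟨m, Q, hQ, -, q, hq, -, Hq⟩ := H x
    refine ⟨m, Q, hQ, ?_⟩
    have h1 := (Hq hx).trans (min_le_right _ _)
    have h2 := neg_abs_le (q - 1 / 2)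
    have h3 := le_abs_self q
    rw [dist hq]
    linarith

/-- The two pure states `|0⟩⟨0|` and `|1⟩⟨1|` are at trace norm 2. Allowing every `β < 2` covers
both normalisations at once. -/
theorem reducesTo_oneQSD {B : PromiseProblem} (hB : B ∈ BQP) {α β : ℝ} (hα : 0 < α)
    (hαβ : α < β) (hβ : β < 2) : B.ReducesTo (oneQSD α β hαβ) := by
  -- The error `α/2` gives `2|q| ≤ α` on no-instances, and `(2-β)/2` gives `2|q| ≥ β` on
  -- yes-instances.
  obtain ⟨_, f, -, hf, H⟩ := exists_amplification hB
    (lt_min (half_pos hα) (half_pos (sub_pos.2 hβ))) False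
  have dist : ∀ {m : ℕ} {Q : Circuit (m + 1)} {q : ℝ},
      Circuit.outputState Q = !![1 - (q : ℂ), 0; 0, (q : ℂ)] →
      traceNorm (Circuit.outputState Q - Circuit.outputState ([] : Circuit (m + 1))) =
        2 * |q| := by
    intro m Q q h
    rw [h, outputState_nil, ← traceNorm_diagonal]
    congr 1
    ext i j
    fin_cases i <;> fin_cases j <;> simp
  refine ⟨f, hf, fun x hx => ?_, fun x hx => ?_⟩
  · obtain ⟨m, Q, -, hQ, q, hq, Hq, -⟩ := H x
    refine ⟨m, Q, [], hQ, ?_⟩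
    have h1 := ((Hq hx).2 id).trans (min_le_right _ _)
    have h2 := neg_abs_le (q - 1)
    have h3 := le_abs_self q
    rw [dist hq]
    linarith
  · obtain ⟨m, Q, -, hQ, q, hq, -, Hq⟩ := H x
    refine ⟨m, Q, [], hQ, ?_⟩
    have := (Hq hx).trans (min_le_left _ _)
    rw [dist hq]
    linarith

end QComp

end

theorem mainTheorem4 (α β : ℝ) (hα : 0 < α) (hαβ : α < β) (hβ : β < 1) :
    QComp.BQPComplete (QComp.oneQSCI α β hαβ) ∧
    QComp.BQPComplete (QComp.oneQSD α β hαβ) ∧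
    QComp.BQPComplete (QComp.oneQSD (2 * α) (2 * β)
      (mul_lt_mul_of_pos_left hαβ two_pos)) :=
  ⟨⟨QComp.oneQSCI_mem_BQP hαβ, fun _ hB => QComp.reducesTo_oneQSCI hB hα hαβ hβ⟩,
    ⟨QComp.oneQSD_mem_BQP hαβ, fun _ hB => QComp.reducesTo_oneQSD hB hα hαβ (by linarith)⟩,
    ⟨QComp.oneQSD_mem_BQP _, fun _ hB =>
      QComp.reducesTo_oneQSD hB (by linarith) _ (by linarith)⟩⟩
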